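/- Let $(\Omega,\mathcal F,(\mathcal F_t)_{t\ge 0},P)$ be a filtered probability space such that every $P$-null subset of $\Omega$ belongs to $\mathcal F_0$, and let $B$ be a $d$-dimensional standard Brownian motion with respect to $(\mathcal F_t)$. Let $T>0$, let $b:[0,T]\to\mathbb R^{m\times m}$ and $\sigma:[0,T]\to\mathbb R^{m\times d}$ be deterministic and continuous (hence bounded), let $x_0\in\mathbb R^m$, and let $X$ be a solution on $[0,T]$ of the linear equation with additive noise $$dX_t=b(t)X_t\,dt+\sigma(t)\,dB_t,\qquad X_0=x_0 .$$ Let the first variation process $Y$ be a continuous $\mathbb R^{m\times m}$-valued process with $dY_t=b(t)Y_t\,dt$, $Y_0=I_m$, on $[0,T]$, almost surely. Let $H=L^2([0,\infty);\mathbb R^d)$, let $D$ be the Malliavin derivative with respect to $B$ (the closure of its restriction to smooth cylindrical functionals, with domain $\mathbb D^{1,2}$), and let $\delta$ be its adjoint, the Skorokhod integral. Let $\gamma_{X_T}=(\langle DX_T^i,DX_T^j\rangle_H)_{i,j}$ be the Malliavin covariance matrix of $X_T$, and assume that it is almost surely invertible. For $1\le k\le m$ define the covering vector field $$u_k(t)=\sum_{j=1}^m\gamma_{X_T}^{-1}(k,j)\,\bigl[Y_TY_t^{-1}\sigma(t)\bigr]_{j\cdot}\,\mathbf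 1_{[0,T]}(t),$$ where $[\cdot]_{j\cdot}$ denotes the $j$-th row. Then: 1. $Y$ is deterministic: there is a deterministic continuous $\Phi:[0,T]\to\mathbb R^{m\times m}$ with $\dot\Phi(t)=b(t)\Phi(t)$, $\Phi(0)=I_m$, and with every $\Phi(t)$ invertible, such that almost surely $Y_t=\Phi(t)$ for all $t\in[0,T]$. If $t\in[0,T]$ and $b(r)b(s)=b(s)b(r)$ for all $r,s\in[0,t]$, then $\Phi(t)=\exp\bigl(\int_0^t b(s)\,ds\bigr)$. 2. Each $u_k$ is deterministic (almost surely equal, for all $t$, to a deterministic function of $t$), and is adapted to $(\mathcal F_t)$. 3. Each $u_k$ belongs to $\operatorname{Dom}\delta$, the Itô integrals below exist, and almost surely $$\delta(u_k)=\int_0^T u_k(t)\cdot dB_t=\sum_{j=1}^m\gamma_{X_T}^{-1}(k,j)\int_0^T\bigl[Y_TY_t^{-1}\sigma(t)\bigr]_{j\cdot}\,dB_t .$$ -/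

import Mathlib

open MeasureTheory ProbabilityTheory Filter Topology
open scoped NNReal ENNReal

noncomputable section

/-- Lebesgue measure on the time axis `[0, ∞)`. -/
def timeMeasure : Measure ℝ≥0 := (volume : Measure ℝ).comap (fun t : ℝ≥0 => (t : ℝ))

section LinearSDE

variable {Ω : Type*} {mΩ : MeasurableSpace Ω} {d : ℕ}

/-- `B` is a `d`-dimensional standard Brownian motion with respect to the filtration `F`: its
components are independent real Brownian motions, it is adapted to `F`, and its increments after
time `s` are independent of `F s`. -/
structure IsBrownianMotion (F : Filtration ℝ≥0 mΩ) (B : Fin d → ℝ≥0 → Ω → ℝ) (P : Measure Ω) :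
    Prop where
  isBrownianReal : ∀ l, IsBrownianReal (B l) P
  indep_components : iIndepFun (fun l ω t => B l t ω) P
  adapted : ∀ l, StronglyAdapted F (B l)
  indep_increments : ∀ s t : ℝ≥0, s ≤ t →
    Indep (F s) (MeasurableSpace.comap (fun ω l => B l t ω - B l s ω) inferInstance) P

/-- The filtration is `P`-complete: every `P`-null subset of `Ω` belongs to `F 0`. -/
def IsCompleteFiltration (F : Filtration ℝ≥0 mΩ) (P : Measure Ω) : Prop :=
  ∀ s : Set Ω, P s = 0 → MeasurableSet[F 0] s

/-! ### The Itô integral on `[0, ∞)` -/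

/-- A simple adapted process `∑ i, 1_{(left i, right i]}(t) ξ i`, with `ξ i` bounded and
`F (left i)`-measurable. -/
structure SimpleProcess (F : Filtration ℝ≥0 mΩ) (d : ℕ) where
  n : ℕ
  left : Fin n → ℝ≥0
  right : Fin n → ℝ≥0
  left_le_right : ∀ i, left i ≤ right i
  coef : Fin n → Ω → EuclideanSpace ℝ (Fin d)
  coef_measurable : ∀ i, StronglyMeasurable[F (left i)] (coef i)
  coef_bounded : ∀ i, ∃ C : ℝ, ∀ ω, ‖coef i ω‖ ≤ C

namespace SimpleProcess

variable {F : Filtration ℝ≥0 mΩ}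

/-- The process itself. -/
def eval (S : SimpleProcess F d) (t : ℝ≥0) (ω : Ω) : EuclideanSpace ℝ (Fin d) :=
  ∑ i, (Set.Ioc (S.left i) (S.right i)).indicator (fun _ => S.coef i ω) t

/-- Its elementary stochastic integral `∑ i, ξ i · (B_{right i} - B_{left i})`. -/
def integral (S : SimpleProcess F d) (B : Fin d → ℝ≥0 → Ω → ℝ) (ω : Ω) : ℝ :=
  ∑ i, ∑ l, S.coef i ω l * (B l (S.right i) ω - B l (S.left i) ω)

end SimpleProcess

/-- `Z` is (a version of) the Itô integral `∫₀^∞ u_t · dB_t`: `u` is an `L²(dt ⊗ P)` limit of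
simple adapted processes whose elementary integrals converge to `Z` in `L²(P)`. -/
def IsItoIntegral (F : Filtration ℝ≥0 mΩ) (B : Fin d → ℝ≥0 → Ω → ℝ) (P : Measure Ω)
    (u : ℝ≥0 → Ω → EuclideanSpace ℝ (Fin d)) (Z : Ω → ℝ) : Prop :=
  MemLp (fun p : ℝ≥0 × Ω => u p.1 p.2) 2 (timeMeasure.prod P) ∧ MemLp Z 2 P ∧
  ∃ S : ℕ → SimpleProcess F d,
    Tendsto (fun n => eLpNorm (fun p : ℝ≥0 × Ω => (S n).eval p.1 p.2 - u p.1 p.2) 2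
      (timeMeasure.prod P)) atTop (𝓝 0) ∧
    Tendsto (fun n => eLpNorm (fun ω => (S n).integral B ω - Z ω) 2 P) atTop (𝓝 0)

/-- `u` is Itô integrable over `[0, ∞)` (in the `L²` sense). -/
def ItoIntegrable (F : Filtration ℝ≥0 mΩ) (B : Fin d → ℝ≥0 → Ω → ℝ) (P : Measure Ω)
    (u : ℝ≥0 → Ω → EuclideanSpace ℝ (Fin d)) : Prop :=
  ∃ Z, IsItoIntegral F B P u Z

open Classical in
/-- The Itô integral `∫₀^∞ u_t · dB_t` (zero when `u` is not Itô integrable). -/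
def itoIntegral (F : Filtration ℝ≥0 mΩ) (B : Fin d → ℝ≥0 → Ω → ℝ) (P : Measure Ω)
    (u : ℝ≥0 → Ω → EuclideanSpace ℝ (Fin d)) : Ω → ℝ :=
  if h : ItoIntegrable F B P u then h.choose else 0

/-! ### The Wiener integral of deterministic functions -/

/-- An `ℝ^d`-valued step function `∑ i, 1_{(left i, right i]}(t) c i`. -/
structure StepFunction (d : ℕ) where
  n : ℕ
  left : Fin n → ℝ≥0
  right : Fin n → ℝ≥0
  left_le_right : ∀ i, left i ≤ right i
  coef : Fin n → EuclideanSpace ℝ (Fin d)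

namespace StepFunction

/-- The function itself. -/
def toFunction (S : StepFunction d) (t : ℝ≥0) : EuclideanSpace ℝ (Fin d) :=
  ∑ i, (Set.Ioc (S.left i) (S.right i)).indicator (fun _ => S.coef i) t

/-- Its elementary Wiener integral. -/
def integral (S : StepFunction d) (B : Fin d → ℝ≥0 → Ω → ℝ) (ω : Ω) : ℝ :=
  ∑ i, ∑ l, S.coef i l * (B l (S.right i) ω - B l (S.left i) ω)

end StepFunction

/-- `W` is (a version of) the Wiener integral `B(h) = ∫₀^∞ h_t · dB_t` of
`h ∈ H = L²([0, ∞); ℝ^d)`. -/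
def IsWienerIntegral (B : Fin d → ℝ≥0 → Ω → ℝ) (P : Measure Ω)
    (h : ℝ≥0 → EuclideanSpace ℝ (Fin d)) (W : Ω → ℝ) : Prop :=
  MemLp h 2 timeMeasure ∧ MemLp W 2 P ∧
  ∃ S : ℕ → StepFunction d,
    Tendsto (fun n => eLpNorm (fun t => (S n).toFunction t - h t) 2 timeMeasure) atTop (𝓝 0) ∧
    Tendsto (fun n => eLpNorm (fun ω => (S n).integral B ω - W ω) 2 P) atTop (𝓝 0)

/-! ### Malliavin calculus -/

/-- A smooth cylindrical functional `f (B(h 1), …, B(h n))`, where `f` is smooth and `f` and all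
its derivatives have polynomial growth. -/
structure SmoothFunctional (B : Fin d → ℝ≥0 → Ω → ℝ) (P : Measure Ω) where
  n : ℕ
  h : Fin n → ℝ≥0 → EuclideanSpace ℝ (Fin d)
  W : Fin n → Ω → ℝ
  isWienerIntegral : ∀ i, IsWienerIntegral B P (h i) (W i)
  f : (Fin n → ℝ) → ℝ
  growth : Function.HasTemperateGrowth f

namespace SmoothFunctional

variable {B : Fin d → ℝ≥0 → Ω → ℝ} {P : Measure Ω}

/-- The random variable `f (B(h 1), …, B(h n))`. -/
def toFun (S : SmoothFunctional B P) (ω : Ω) : ℝ := S.f (fun i => S.W i ω)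

/-- Its Malliavin derivative `∑ i, ∂ᵢ f (B(h 1), …, B(h n)) h i(t)`. -/
def deriv (S : SmoothFunctional B P) (t : ℝ≥0) (ω : Ω) : EuclideanSpace ℝ (Fin d) :=
  ∑ i, (fderiv ℝ S.f (fun j => S.W j ω) (Pi.single i 1)) • S.h i t

end SmoothFunctional

/-- `G` belongs to `𝔻^{1,2}` and `D` is (a version of) its Malliavin derivative: `(G, D)` is in
the closure, in `L²(Ω) × L²(Ω; H)`, of the graph of the derivative on smooth cylindrical
functionals. Here `L²(Ω; H)` is written as `L²([0, ∞) × Ω; ℝ^d)`. -/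
def IsMalliavinDerivative (B : Fin d → ℝ≥0 → Ω → ℝ) (P : Measure Ω) (G : Ω → ℝ)
    (D : ℝ≥0 → Ω → EuclideanSpace ℝ (Fin d)) : Prop :=
  MemLp G 2 P ∧ MemLp (fun p : ℝ≥0 × Ω => D p.1 p.2) 2 (timeMeasure.prod P) ∧
  ∃ S : ℕ → SmoothFunctional B P,
    Tendsto (fun n => eLpNorm (fun ω => (S n).toFun ω - G ω) 2 P) atTop (𝓝 0) ∧
    Tendsto (fun n => eLpNorm (fun p : ℝ≥0 × Ω => (S n).deriv p.1 p.2 - D p.1 p.2) 2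
      (timeMeasure.prod P)) atTop (𝓝 0)

open Classical in
/-- The Malliavin derivative `D_t G` of `G ∈ 𝔻^{1,2}` (zero outside `𝔻^{1,2}`). -/
def malliavinDerivative (B : Fin d → ℝ≥0 → Ω → ℝ) (P : Measure Ω) (G : Ω → ℝ) :
    ℝ≥0 → Ω → EuclideanSpace ℝ (Fin d) :=
  if h : ∃ D, IsMalliavinDerivative B P G D then h.choose else 0

/-- The Malliavin covariance matrix `γ_G(i, j) = ⟨D Gⁱ, D Gʲ⟩_H` of a random vector `G`. -/
def malliavinMatrix {m : ℕ} (B : Fin d → ℝ≥0 → Ω → ℝ) (P : Measure Ω) (G : Ω → Fin m → ℝ)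
    (ω : Ω) : Matrix (Fin m) (Fin m) ℝ :=
  Matrix.of fun i j => ∫ t, inner ℝ (malliavinDerivative B P (fun ω' => G ω' i) t ω)
    (malliavinDerivative B P (fun ω' => G ω' j) t ω) ∂timeMeasure

/-- The σ-algebra on `Ω` generated by the Brownian motion. -/
@[reducible]
def brownianSigma (B : Fin d → ℝ≥0 → Ω → ℝ) : MeasurableSpace Ω :=
  ⨆ (l : Fin d) (t : ℝ≥0), MeasurableSpace.comap (B l t) inferInstance

/-- `u` is in the domain of the divergence operator and `Z` is (a version of) its Skorokhod
integral `δ(u)`. The divergence is the adjoint of the Malliavin derivative on the probability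
space whose σ-algebra is generated by `B` (up to null sets): `u ∈ L²(Ω; H)`, `Z ∈ L²(Ω)` and
`E[G Z] = E[⟨D G, u⟩_H]` for every `G ∈ 𝔻^{1,2}`. -/
def IsSkorokhodIntegral (B : Fin d → ℝ≥0 → Ω → ℝ) (P : Measure Ω)
    (u : ℝ≥0 → Ω → EuclideanSpace ℝ (Fin d)) (Z : Ω → ℝ) : Prop :=
  MemLp (fun p : ℝ≥0 × Ω => u p.1 p.2) 2 (timeMeasure.prod P) ∧
  AEStronglyMeasurable[MeasurableSpace.prod inferInstance (brownianSigma B)]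
    (fun p : ℝ≥0 × Ω => u p.1 p.2) (timeMeasure.prod P) ∧
  MemLp Z 2 P ∧ AEStronglyMeasurable[brownianSigma B] Z P ∧
  ∀ G D, IsMalliavinDerivative B P G D →
    ∫ ω, G ω * Z ω ∂P = ∫ ω, (∫ t, inner ℝ (D t ω) (u t ω) ∂timeMeasure) ∂P

/-- `u ∈ Dom δ`. -/
def InSkorokhodDomain (B : Fin d → ℝ≥0 → Ω → ℝ) (P : Measure Ω)
    (u : ℝ≥0 → Ω → EuclideanSpace ℝ (Fin d)) : Prop :=
  ∃ Z, IsSkorokhodIntegral B P u Z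

open Classical in
/-- The Skorokhod integral `δ(u)` (zero when `u ∉ Dom δ`). -/
def skorokhodIntegral (B : Fin d → ℝ≥0 → Ω → ℝ) (P : Measure Ω)
    (u : ℝ≥0 → Ω → EuclideanSpace ℝ (Fin d)) : Ω → ℝ :=
  if h : InSkorokhodDomain B P u then h.choose else 0

/-! ### The linear equation with additive noise -/

variable {m : ℕ}

/-- `X` solves `dX_t = b(t) X_t dt + σ(t) dB_t`, `X_0 = x₀`, on `[0, T]`: it is adapted, has
almost surely continuous paths, and satisfies the integral equation almost surely for each
`t ∈ [0, T]`. -/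
structure IsLinearSDESolution (F : Filtration ℝ≥0 mΩ) (B : Fin d → ℝ≥0 → Ω → ℝ) (P : Measure Ω)
    (T : ℝ≥0) (b : ℝ≥0 → Matrix (Fin m) (Fin m) ℝ) (σ : ℝ≥0 → Matrix (Fin m) (Fin d) ℝ)
    (x₀ : Fin m → ℝ) (X : ℝ≥0 → Ω → Fin m → ℝ) : Prop where
  adapted : ∀ t ≤ T, StronglyMeasurable[F t] (X t)
  continuous_paths : ∀ᵐ ω ∂P, ContinuousOn (fun t => X t ω) (Set.Icc 0 T)
  equation : ∀ t ≤ T, ∀ᵐ ω ∂P, ∀ i, X t ω i = x₀ i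
    + ∫ s in Set.Icc 0 t, ((b s).mulVec (X s ω)) i ∂timeMeasure
    + itoIntegral F B P
        (fun s _ => (Set.Icc 0 t).indicator (fun r => WithLp.toLp 2 (fun l => σ r i l)) s) ω

/-- The matrix path `y` solves `dy_t = b(t) y_t dt`, `y_0 = I_m`, on `[0, T]`. -/
def SolvesVariationEquation (T : ℝ≥0) (b : ℝ≥0 → Matrix (Fin m) (Fin m) ℝ)
    (y : ℝ≥0 → Matrix (Fin m) (Fin m) ℝ) : Prop :=
  ContinuousOn y (Set.Icc 0 T) ∧ ∀ t ≤ T, ∀ i j, y t i j =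
    (1 : Matrix (Fin m) (Fin m) ℝ) i j + ∫ s in Set.Icc 0 t, (b s * y s) i j ∂timeMeasure

/-- The process `[Y_T Y_t⁻¹ σ(t)]_{j·} 1_{[0,T]}(t)`. -/
def rowProcess (T : ℝ≥0) (σ : ℝ≥0 → Matrix (Fin m) (Fin d) ℝ)
    (Y : ℝ≥0 → Ω → Matrix (Fin m) (Fin m) ℝ) (j : Fin m) (t : ℝ≥0) (ω : Ω) :
    EuclideanSpace ℝ (Fin d) :=
  (Set.Icc 0 T).indicator
    (fun s => WithLp.toLp 2 (fun l => (Y T ω * (Y s ω)⁻¹ * σ s) j l)) t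

/-- The covering vector field
`u_k(t) = ∑_j γ_{X_T}⁻¹(k, j) [Y_T Y_t⁻¹ σ(t)]_{j·} 1_{[0,T]}(t)`, where `γ_{X_T}` is the Malliavin
matrix of the random vector `XT`. -/
def coveringField (B : Fin d → ℝ≥0 → Ω → ℝ) (P : Measure Ω) (T : ℝ≥0)
    (σ : ℝ≥0 → Matrix (Fin m) (Fin d) ℝ) (Y : ℝ≥0 → Ω → Matrix (Fin m) (Fin m) ℝ)
    (XT : Ω → Fin m → ℝ) (k : Fin m) (t : ℝ≥0) (ω : Ω) : EuclideanSpace ℝ (Fin d) :=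
  ∑ j, (malliavinMatrix B P XT ω)⁻¹ k j • rowProcess T σ Y j t ω

end LinearSDE

end

noncomputable section

/-! ### The time axis -/

/-! The noise is additive, so every object in the statement is either deterministic or lies in the
first Wiener chaos up to a constant. The equation for `Y` contains no noise and is linear with
continuous coefficients; pathwise uniqueness (`SolvesVariationEquation.eq_of_le`) therefore
identifies almost every path of `Y` with one fixed path `Φ`. The same uniqueness principle,
`eqOn_zero_of_hasDerivWithinAt_linear`, gives invertibility, the exponential formula and a pathwise
variation of constants formula.

Put `N t = X t - x₀ - ∫ b X`, which for each fixed time is a Wiener integral. Variation of constants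
gives `X T = Φ T x₀ + N T + Φ T ∫ Φ⁻¹ b N`, with an ordinary time integral of a continuous path. Its
Riemann sums are Wiener integrals, and an almost sure limit of Wiener integrals is again one
(`IsWienerIntegral.of_tendsto_ae`): for centred Gaussians the characteristic function controls the
`L²` distance. Hence `X T` is a constant plus `B(h)`, its Malliavin derivative is `h`, and its
covariance matrix is a constant matrix. The covering fields are thus deterministic elements of `H`
outside a null set, and completeness of the filtration makes them adapted.

For deterministic `h` both stochastic integrals are the Wiener integral `B(h)`: step functions are
simple processes, which settles the Itô side, and the duality `E[G B(h)] = E⟨DG, h⟩` settles the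
Skorokhod side. The last formula of the theorem is linearity of `B`.

The operators are defined by choosing a version, so each needs a uniqueness theorem. For the Itô
integral it is the isometry. For the Malliavin derivative it is closability, derived from Gaussian
integration by parts (`integral_comp_mul_wienerIntegral`, which rests on Stein's identity). For the
Skorokhod integral it is totality of smooth functionals in `L²` of the Brownian σ-algebra
(`ae_eq_zero_of_forall_smoothFunctional`). -/

lemma measurableEmbedding_nnreal_coe : MeasurableEmbedding (fun t : ℝ≥0 => (t : ℝ)) :=
  MeasurableEmbedding.subtype_coe measurableSet_Ici

lemma map_coe_timeMeasure :
    timeMeasure.map (fun t : ℝ≥0 => (t : ℝ)) = volume.restrict (Set.Ici 0) := by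
  rw [timeMeasure, measurableEmbedding_nnreal_coe.map_comap]
  congr 1
  ext x
  exact ⟨by rintro ⟨y, rfl⟩; exact y.2, fun hx => ⟨⟨x, hx⟩, rfl⟩⟩

instance sigmaFinite_timeMeasure : SigmaFinite timeMeasure := by
  have : SigmaFinite (timeMeasure.map (fun t : ℝ≥0 => (t : ℝ))) := by
    rw [map_coe_timeMeasure]; infer_instance
  exact SigmaFinite.of_map _ measurableEmbedding_nnreal_coe.measurable.aemeasurable this

lemma timeMeasure_Ioc (s t : ℝ≥0) : timeMeasure (Set.Ioc s t) = ENNReal.ofReal (t - s) := by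
  rw [timeMeasure, measurableEmbedding_nnreal_coe.comap_apply, ← Real.volume_Ioc]
  congr 1
  ext x
  constructor
  · rintro ⟨y, ⟨h1, h2⟩, rfl⟩
    exact ⟨by exact_mod_cast h1, by exact_mod_cast h2⟩
  · rintro ⟨h1, h2⟩
    exact ⟨⟨x, s.2.trans h1.le⟩, ⟨by exact_mod_cast h1, by exact_mod_cast h2⟩, rfl⟩

lemma timeMeasure_real_Ioc {s t : ℝ≥0} (h : s ≤ t) :
    timeMeasure.real (Set.Ioc s t) = (t : ℝ) - s := by
  rw [Measure.real, timeMeasure_Ioc, ENNReal.toReal_ofReal]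
  simpa using h

/-- Converts to interval integrals, for which the fundamental theorem of calculus is available. -/
lemma setIntegral_timeMeasure {E : Type*} [NormedAddCommGroup E] [NormedSpace ℝ E]
    (f : ℝ≥0 → E) (t : ℝ≥0) :
    ∫ s in Set.Icc 0 t, f s ∂timeMeasure = ∫ x in (0 : ℝ)..t, f x.toNNReal := by
  have h1 : ∀ s, f s = (fun x : ℝ => f x.toNNReal) ((fun t : ℝ≥0 => (t : ℝ)) s) := fun s => by
    simp
  have h2 : Set.Icc 0 t = (fun t : ℝ≥0 => (t : ℝ)) ⁻¹' Set.Icc 0 (t : ℝ) := by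
    ext x; simp
  rw [integral_congr_ae (Eventually.of_forall h1), h2,
    ← measurableEmbedding_nnreal_coe.setIntegral_map (fun x : ℝ => f x.toNNReal), timeMeasure,
    measurableEmbedding_nnreal_coe.map_comap, Measure.restrict_restrict measurableSet_Icc,
    intervalIntegral.integral_of_le (NNReal.coe_nonneg t), ← integral_Icc_eq_integral_Ioc]
  congr 2
  ext x
  simp only [Set.mem_inter_iff, Set.mem_Icc, Set.mem_range, and_iff_left_iff_imp]
  rintro ⟨h, -⟩
  exact ⟨⟨x, h⟩, rfl⟩

/-! ### `L²` norms -/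

section L2

variable {α β : Type*} {mα : MeasurableSpace α} {mβ : MeasurableSpace β} {μ : Measure α}
  {ν : Measure β} {E G : Type*} [NormedAddCommGroup E] [NormedAddCommGroup G]

lemma eLpNorm_two_eq_ofReal_sqrt {f : α → E} (hf : MemLp f 2 μ) :
    eLpNorm f 2 μ = ENNReal.ofReal (√(∫ x, ‖f x‖ ^ 2 ∂μ)) := by
  rw [hf.eLpNorm_eq_integral_rpow_norm two_ne_zero ENNReal.ofNat_ne_top]
  simp [Real.sqrt_eq_rpow]

lemma eLpNorm_two_eq_of_integral_norm_sq_eq {f : α → E} {g : β → G} (hf : MemLp f 2 μ)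
    (hg : MemLp g 2 ν) (h : ∫ x, ‖f x‖ ^ 2 ∂μ = ∫ x, ‖g x‖ ^ 2 ∂ν) :
    eLpNorm f 2 μ = eLpNorm g 2 ν := by
  rw [eLpNorm_two_eq_ofReal_sqrt hf, eLpNorm_two_eq_ofReal_sqrt hg, h]

end L2

/-! ### Increments of Brownian motion -/

section BM

variable {Ω : Type*} {mΩ : MeasurableSpace Ω} {d : ℕ} {P : Measure Ω}
  {F : Filtration ℝ≥0 mΩ} {B : Fin d → ℝ≥0 → Ω → ℝ}

namespace IsBrownianMotion

lemma stronglyMeasurable (hB : IsBrownianMotion F B P) (l : Fin d) (t : ℝ≥0) :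
    StronglyMeasurable (B l t) := (hB.adapted l t).mono (F.le t)

lemma hasGaussianLaw_increment (hB : IsBrownianMotion F B P) (l : Fin d) (s t : ℝ≥0) :
    HasGaussianLaw (fun ω => B l t ω - B l s ω) P :=
  ((hB.isBrownianReal l).toIsPreBrownianReal.hasLaw_sub t s).hasGaussianLaw

lemma memLp_increment (hB : IsBrownianMotion F B P) (l : Fin d) (s t : ℝ≥0) {p : ℝ≥0∞}
    (hp : p ≠ ∞) : MemLp (fun ω => B l t ω - B l s ω) p P :=
  (hB.hasGaussianLaw_increment l s t).memLp hp

lemma integral_increment (hB : IsBrownianMotion F B P) (l : Fin d) (s t : ℝ≥0) :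
    ∫ ω, (B l t ω - B l s ω) ∂P = 0 := by
  have h := ((hB.isBrownianReal l).toIsPreBrownianReal.hasLaw_sub t s).integral_eq
  rw [integral_id_gaussianReal] at h
  exact h

lemma integral_increment_sq (hB : IsBrownianMotion F B P) (l : Fin d) {s t : ℝ≥0} (hst : s ≤ t) :
    ∫ ω, (B l t ω - B l s ω) * (B l t ω - B l s ω) ∂P = (t : ℝ) - s := by
  have h := ((hB.isBrownianReal l).toIsPreBrownianReal.hasLaw_sub t s).variance_eq
  rw [variance_id_gaussianReal, variance_of_integral_eq_zero
    ((hB.stronglyMeasurable l t).sub (hB.stronglyMeasurable l s)).aestronglyMeasurable.aemeasurable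
    (hB.integral_increment l s t)] at h
  have h2 : ∫ ω, (B l t ω - B l s ω) * (B l t ω - B l s ω) ∂P
      = ∫ ω, (B l t - B l s) ω ^ 2 ∂P := by
    simp [pow_two]
  rw [h2, h, coe_nndist, NNReal.val_eq_coe, NNReal.val_eq_coe, Real.dist_eq, abs_of_nonneg]
  simpa using hst

lemma integral_increment_mul_of_ne [IsProbabilityMeasure P] (hB : IsBrownianMotion F B P)
    {l l' : Fin d} (hl : l ≠ l')
    (s t : ℝ≥0) : ∫ ω, (B l t ω - B l s ω) * (B l' t ω - B l' s ω) ∂P = 0 := by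
  have h := (hB.indep_components.indepFun hl).comp
    (φ := fun w : ℝ≥0 → ℝ => w t - w s) (ψ := fun w : ℝ≥0 → ℝ => w t - w s)
    (by fun_prop) (by fun_prop)
  have h2 := h.integral_mul_eq_mul_integral
    ((hB.stronglyMeasurable l t).sub (hB.stronglyMeasurable l s)).aestronglyMeasurable
    ((hB.stronglyMeasurable l' t).sub (hB.stronglyMeasurable l' s)).aestronglyMeasurable
  simp only [Pi.mul_apply, Function.comp_apply] at h2
  rw [h2, hB.integral_increment l, zero_mul]

lemma integral_increment_mul [IsProbabilityMeasure P] (hB : IsBrownianMotion F B P) (l l' : Fin d)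
    {s t : ℝ≥0} (hst : s ≤ t) :
    ∫ ω, (B l t ω - B l s ω) * (B l' t ω - B l' s ω) ∂P
      = if l = l' then (t : ℝ) - s else 0 := by
  split_ifs with h
  · subst h; exact hB.integral_increment_sq l hst
  · exact hB.integral_increment_mul_of_ne h s t

/-- The increment vector is independent of the past. A general `g` covers both uses: a coordinate,
which has mean zero, and a product of two coordinates, which gives the covariance. -/
lemma integral_mul_comp_increment (hB : IsBrownianMotion F B P) {s t : ℝ≥0} (hst : s ≤ t)
    {G : Ω → ℝ} (hG : StronglyMeasurable[F s] G) {g : (Fin d → ℝ) → ℝ} (hg : Measurable g) :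
    ∫ ω, G ω * g (fun l => B l t ω - B l s ω) ∂P
      = (∫ ω, G ω ∂P) * ∫ ω, g (fun l => B l t ω - B l s ω) ∂P := by
  have h : IndepFun G (fun ω l => B l t ω - B l s ω) P :=
    indep_of_indep_of_le_left (hB.indep_increments s t hst) hG.measurable.comap_le
  have hm : Measurable (fun ω l => B l t ω - B l s ω) :=
    measurable_pi_lambda _ fun l =>
      ((hB.stronglyMeasurable l t).sub (hB.stronglyMeasurable l s)).measurable
  have := h.integral_comp_mul_comp (f := id) (g := g)
    (hG.mono (F.le s)).measurable.aemeasurable hm.aemeasurable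
    aestronglyMeasurable_id hg.aestronglyMeasurable
  simpa using this

lemma integral_mul_increment (hB : IsBrownianMotion F B P) {s t : ℝ≥0} (hst : s ≤ t)
    {G : Ω → ℝ} (hG : StronglyMeasurable[F s] G) (l : Fin d) :
    ∫ ω, G ω * (B l t ω - B l s ω) ∂P = 0 := by
  have := hB.integral_mul_comp_increment hst hG (g := fun x => x l) (by fun_prop)
  simp only at this
  rw [this, hB.integral_increment, mul_zero]

lemma integrable_bdd_mul_increment_mul_increment (hB : IsBrownianMotion F B P) {ξ : Ω → ℝ}
    (hξ : StronglyMeasurable ξ) {C : ℝ} (hC : ∀ ω, ‖ξ ω‖ ≤ C) (l l' : Fin d) (a b a' b' : ℝ≥0) :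
    Integrable (fun ω => ξ ω * ((B l b ω - B l a ω) * (B l' b' ω - B l' a' ω))) P :=
  ((hB.memLp_increment l a b (p := 2) (by simp)).integrable_mul
    (hB.memLp_increment l' a' b' (p := 2) (by simp))).bdd_mul hξ.aestronglyMeasurable
    (Eventually.of_forall hC)

/-- Covariance of two weighted increments, the second interval starting after the first one. -/
lemma integral_weighted_increments_of_le [IsProbabilityMeasure P] (hB : IsBrownianMotion F B P)
    {s t s' t' : ℝ≥0} (hst' : s' ≤ t') (hss : s ≤ s') {ζ : Ω → ℝ}
    (hζ : StronglyMeasurable[F s'] ζ) {C : ℝ} (hC : ∀ ω, ‖ζ ω‖ ≤ C) (l l' : Fin d) :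
    ∫ ω, ζ ω * ((B l t ω - B l s ω) * (B l' t' ω - B l' s' ω)) ∂P
      = if l = l' then (∫ ω, ζ ω ∂P) * timeMeasure.real (Set.Ioc s t ∩ Set.Ioc s' t') else 0 := by
  have hBm : ∀ {a b : ℝ≥0} (l : Fin d), a ≤ b → StronglyMeasurable[F b] (B l a) :=
    fun l hab => (hB.adapted l _).mono (F.mono hab)
  rcases le_total t s' with h | h
  · have h0 : Set.Ioc s t ∩ Set.Ioc s' t' = ∅ := by
      ext x
      simp only [Set.mem_inter_iff, Set.mem_Ioc, Set.mem_empty_iff_false, iff_false]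
      rintro ⟨⟨_, h1⟩, h2, _⟩
      exact absurd (h1.trans h) (not_le.2 h2)
    have h1 := hB.integral_mul_increment hst' (G := fun ω => ζ ω * (B l t ω - B l s ω))
      (hζ.mul ((hBm l h).sub (hBm l hss))) l'
    simp only [mul_assoc] at h1
    rw [h1, h0]
    simp
  -- Overlapping intervals: cut at `s'` and at `c`. Only the common piece `(s', c]` contributes;
  -- every other product contains an increment independent of the remaining factors.
  · set c := min t t' with hc
    have hsc : s' ≤ c := le_min h hst'
    have hct : c ≤ t := min_le_left _ _
    have hct' : c ≤ t' := min_le_right _ _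
    have hI : Set.Ioc s t ∩ Set.Ioc s' t' = Set.Ioc s' c := by
      rw [Set.Ioc_inter_Ioc, hc]
      congr 1
      exact max_eq_right hss
    have hζm : StronglyMeasurable ζ := hζ.mono (F.le _)
    have i1 := hB.integrable_bdd_mul_increment_mul_increment hζm hC l l' s s' s' t'
    have i2 := hB.integrable_bdd_mul_increment_mul_increment hζm hC l l' s' c s' c
    have i3 := hB.integrable_bdd_mul_increment_mul_increment hζm hC l l' s' c c t'
    have i4 := hB.integrable_bdd_mul_increment_mul_increment hζm hC l l' c t s' c
    have e1 : ∫ ω, ζ ω * ((B l s' ω - B l s ω) * (B l' t' ω - B l' s' ω)) ∂P = 0 := by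
      have h1 := hB.integral_mul_increment hst' (G := fun ω => ζ ω * (B l s' ω - B l s ω))
        (hζ.mul ((hBm l le_rfl).sub (hBm l hss))) l'
      simpa only [mul_assoc] using h1
    have e2 : ∫ ω, ζ ω * ((B l c ω - B l s' ω) * (B l' c ω - B l' s' ω)) ∂P
        = (∫ ω, ζ ω ∂P) * if l = l' then (c : ℝ) - s' else 0 := by
      rw [← hB.integral_increment_mul l l' hsc]
      exact hB.integral_mul_comp_increment hsc hζ (g := fun x => x l * x l') (by fun_prop)
    have e3 : ∫ ω, ζ ω * ((B l c ω - B l s' ω) * (B l' t' ω - B l' c ω)) ∂P = 0 := by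
      have h1 := hB.integral_mul_increment hct' (G := fun ω => ζ ω * (B l c ω - B l s' ω))
        ((hζ.mono (F.mono hsc)).mul ((hBm l le_rfl).sub (hBm l hsc))) l'
      simpa only [mul_assoc] using h1
    have e4 : ∫ ω, ζ ω * ((B l t ω - B l c ω) * (B l' c ω - B l' s' ω)) ∂P = 0 := by
      have h1 := hB.integral_mul_increment hct (G := fun ω => ζ ω * (B l' c ω - B l' s' ω))
        ((hζ.mono (F.mono hsc)).mul ((hBm l' le_rfl).sub (hBm l' hsc))) l
      rw [← h1]
      congr 1
      ext ω
      ring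
    have key : (fun ω => ζ ω * ((B l t ω - B l s ω) * (B l' t' ω - B l' s' ω)))
        = (fun ω => ζ ω * ((B l s' ω - B l s ω) * (B l' t' ω - B l' s' ω)))
          + (fun ω => ζ ω * ((B l c ω - B l s' ω) * (B l' c ω - B l' s' ω)))
          + (fun ω => ζ ω * ((B l c ω - B l s' ω) * (B l' t' ω - B l' c ω)))
          + fun ω => ζ ω * ((B l t ω - B l c ω) * (B l' c ω - B l' s' ω)) := by
      ext ω
      simp only [Pi.add_apply]
      rcases min_choice t t' with h' | h' <;> rw [← hc] at h' <;> rw [h'] <;> ring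
    rw [key, integral_add' ((i1.add i2).add i3) i4, integral_add' (i1.add i2) i3,
      integral_add' i1 i2, e1, e2, e3, e4, hI, timeMeasure_real_Ioc hsc]
    split_ifs <;> ring

/-- By symmetry one may order the left end points; both weights are then measurable at the later one
and merge into a single weight. -/
lemma integral_weighted_increments [IsProbabilityMeasure P] (hB : IsBrownianMotion F B P)
    {s t s' t' : ℝ≥0} (hst : s ≤ t) (hst' : s' ≤ t') {ξ η : Ω → ℝ}
    (hξ : StronglyMeasurable[F s] ξ) (hη : StronglyMeasurable[F s'] η) {C C' : ℝ}
    (hC : ∀ ω, ‖ξ ω‖ ≤ C) (hC' : ∀ ω, ‖η ω‖ ≤ C') (l l' : Fin d) :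
    ∫ ω, (ξ ω * (B l t ω - B l s ω)) * (η ω * (B l' t' ω - B l' s' ω)) ∂P
      = if l = l' then (∫ ω, ξ ω * η ω ∂P) * timeMeasure.real (Set.Ioc s t ∩ Set.Ioc s' t')
        else 0 := by
  have hb : ∀ ω, ‖ξ ω * η ω‖ ≤ C * C' := fun ω => by
    rw [norm_mul]
    exact mul_le_mul (hC ω) (hC' ω) (norm_nonneg _) ((norm_nonneg _).trans (hC ω))
  rcases le_total s s' with h | h
  · have := hB.integral_weighted_increments_of_le (t := t) hst' h
      ((hξ.mono (F.mono h)).mul hη) hb l l'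
    simp only [Pi.mul_apply] at this
    rw [← this]
    congr 1
    ext ω
    ring
  · have := hB.integral_weighted_increments_of_le (t := t') hst h
      (hξ.mul (hη.mono (F.mono h))) hb l' l
    simp only [Pi.mul_apply, eq_comm (a := l')] at this
    rw [Set.inter_comm, ← this]
    congr 1
    ext ω
    ring

end IsBrownianMotion

end BM

/-! ### The Itô isometry and uniqueness of the Itô integral -/

section Ito

variable {Ω : Type*} {mΩ : MeasurableSpace Ω} {d : ℕ} {P : Measure Ω}
  {F : Filtration ℝ≥0 mΩ} {B : Fin d → ℝ≥0 → Ω → ℝ}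

namespace SimpleProcess

lemma coef_apply_measurable (S : SimpleProcess F d) (i : Fin S.n) (l : Fin d) :
    StronglyMeasurable[F (S.left i)] (fun ω => S.coef i ω l) :=
  (EuclideanSpace.proj l : EuclideanSpace ℝ (Fin d) →L[ℝ] ℝ).continuous.comp_stronglyMeasurable
    (S.coef_measurable i)

lemma coef_apply_bounded (S : SimpleProcess F d) (i : Fin S.n) (l : Fin d) :
    ∃ C : ℝ, ∀ ω, ‖S.coef i ω l‖ ≤ C := by
  obtain ⟨C, hC⟩ := S.coef_bounded i
  exact ⟨C, fun ω => (PiLp.norm_apply_le _ l).trans (hC ω)⟩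

lemma memLp_coef_apply [IsProbabilityMeasure P] (S : SimpleProcess F d) (i : Fin S.n)
    (l : Fin d) (p : ℝ≥0∞) : MemLp (fun ω => S.coef i ω l) p P := by
  obtain ⟨C, hC⟩ := S.coef_apply_bounded i l
  exact MemLp.of_bound ((S.coef_apply_measurable i l).mono (F.le _)).aestronglyMeasurable C
    (Eventually.of_forall hC)

lemma memLp_eval [IsProbabilityMeasure P] (S : SimpleProcess F d) :
    MemLp (fun p : ℝ≥0 × Ω => S.eval p.1 p.2) 2 (timeMeasure.prod P) := by
  refine memLp_finsetSum _ fun i _ => ?_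
  obtain ⟨C, hC⟩ := S.coef_bounded i
  have h : (fun p : ℝ≥0 × Ω => (Set.Ioc (S.left i) (S.right i)).indicator
      (fun _ => S.coef i p.2) p.1) =
      (Set.Ioc (S.left i) (S.right i) ×ˢ Set.univ).indicator (fun p : ℝ≥0 × Ω => S.coef i p.2) := by
    ext1 p
    by_cases hp : p.1 ∈ Set.Ioc (S.left i) (S.right i) <;> simp [Set.indicator, hp]
  have hs : MeasurableSet (Set.Ioc (S.left i) (S.right i) ×ˢ (Set.univ : Set Ω)) :=
    measurableSet_Ioc.prod MeasurableSet.univ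
  rw [h, memLp_indicator_iff_restrict hs, ← Measure.prod_restrict, Measure.restrict_univ]
  have : IsFiniteMeasure (timeMeasure.restrict (Set.Ioc (S.left i) (S.right i))) := by
    refine ⟨?_⟩
    rw [Measure.restrict_apply_univ, timeMeasure_Ioc]
    exact ENNReal.ofReal_lt_top
  exact MemLp.of_bound (((S.coef_measurable i).mono (F.le _)).aestronglyMeasurable.comp_snd) C
    (Eventually.of_forall fun p => hC p.2)

lemma memLp_integral_term [IsProbabilityMeasure P] (hB : IsBrownianMotion F B P)
    (S : SimpleProcess F d) (i : Fin S.n) (l : Fin d) :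
    MemLp (fun ω => S.coef i ω l * (B l (S.right i) ω - B l (S.left i) ω)) 2 P := by
  obtain ⟨C, hC⟩ := S.coef_apply_bounded i l
  refine ((hB.memLp_increment l (S.left i) (S.right i) (p := 2) (by simp)).const_mul C).mono
    (((S.coef_apply_measurable i l).mono (F.le _)).aestronglyMeasurable.mul
      ((hB.stronglyMeasurable l _).sub (hB.stronglyMeasurable l _)).aestronglyMeasurable)
    (Eventually.of_forall fun ω => ?_)
  rw [norm_mul, norm_mul]
  gcongr
  exact (hC ω).trans (le_abs_self C)

lemma memLp_integral [IsProbabilityMeasure P] (hB : IsBrownianMotion F B P)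
    (S : SimpleProcess F d) : MemLp (S.integral B) 2 P :=
  memLp_finsetSum _ fun i _ => memLp_finsetSum _ fun l _ => memLp_integral_term hB S i l

/-- The right-hand side is arranged to coincide with that of `integral_sq_integral`, so that the
isometry is a comparison of two expansions. -/
lemma integral_norm_sq_eval [IsProbabilityMeasure P] (S : SimpleProcess F d) :
    ∫ p, ‖S.eval p.1 p.2‖ ^ 2 ∂(timeMeasure.prod P) =
      ∑ l, ∑ i, ∑ j, timeMeasure.real (Set.Ioc (S.left i) (S.right i) ∩
        Set.Ioc (S.left j) (S.right j)) * ∫ ω, S.coef i ω l * S.coef j ω l ∂P := by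
  have h1 : ∀ p : ℝ≥0 × Ω, ‖S.eval p.1 p.2‖ ^ 2 = ∑ l, ∑ i, ∑ j,
      (Set.Ioc (S.left i) (S.right i) ∩ Set.Ioc (S.left j) (S.right j)).indicator
        (fun _ => (1 : ℝ)) p.1 * (S.coef i p.2 l * S.coef j p.2 l) := by
    intro p
    rw [EuclideanSpace.norm_sq_eq]
    refine Finset.sum_congr rfl fun l _ => ?_
    have h2 : S.eval p.1 p.2 l = ∑ i, (Set.Ioc (S.left i) (S.right i)).indicator
        (fun _ => S.coef i p.2 l) p.1 := by
      simp only [eval, WithLp.ofLp_sum, Finset.sum_apply]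
      refine Finset.sum_congr rfl fun i _ => ?_
      by_cases hp : p.1 ∈ Set.Ioc (S.left i) (S.right i) <;> simp [Set.indicator, hp]
    rw [h2, Real.norm_eq_abs, sq_abs, pow_two, Finset.sum_mul_sum]
    refine Finset.sum_congr rfl fun i _ => Finset.sum_congr rfl fun j _ => ?_
    by_cases hp : p.1 ∈ Set.Ioc (S.left i) (S.right i) <;>
    by_cases hp' : p.1 ∈ Set.Ioc (S.left j) (S.right j) <;>
      simp [Set.indicator, hp, hp', -Set.mem_Ioc]
  have h3 : ∀ l i j, Integrable (fun p : ℝ≥0 × Ω =>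
      (Set.Ioc (S.left i) (S.right i) ∩ Set.Ioc (S.left j) (S.right j)).indicator
        (fun _ => (1 : ℝ)) p.1 * (S.coef i p.2 l * S.coef j p.2 l)) (timeMeasure.prod P) := by
    intro l i j
    refine Integrable.mul_prod (f := (Set.Ioc (S.left i) (S.right i) ∩
      Set.Ioc (S.left j) (S.right j)).indicator (fun _ => (1 : ℝ)))
      (g := fun ω => S.coef i ω l * S.coef j ω l) ?_ ?_
    · refine (integrable_indicator_iff (measurableSet_Ioc.inter measurableSet_Ioc)).2 ?_
      refine integrableOn_const (lt_of_le_of_lt (measure_mono Set.inter_subset_left) ?_).ne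
      rw [timeMeasure_Ioc]
      exact ENNReal.ofReal_lt_top
    · exact (S.memLp_coef_apply i l 2).integrable_mul (S.memLp_coef_apply j l 2)
  rw [integral_congr_ae (Eventually.of_forall h1), integral_finsetSum _
    fun l _ => integrable_finsetSum _ fun i _ => integrable_finsetSum _ fun j _ => h3 l i j]
  refine Finset.sum_congr rfl fun l _ => ?_
  rw [integral_finsetSum _ fun i _ => integrable_finsetSum _ fun j _ => h3 l i j]
  refine Finset.sum_congr rfl fun i _ => ?_
  rw [integral_finsetSum _ fun j _ => h3 l i j]
  refine Finset.sum_congr rfl fun j _ => ?_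
  rw [integral_prod_mul ((Set.Ioc (S.left i) (S.right i) ∩
      Set.Ioc (S.left j) (S.right j)).indicator (fun _ => (1 : ℝ)))
      (fun ω => S.coef i ω l * S.coef j ω l),
    integral_indicator_const _ (measurableSet_Ioc.inter measurableSet_Ioc)]
  simp

lemma integral_sq_integral [IsProbabilityMeasure P] (hB : IsBrownianMotion F B P)
    (S : SimpleProcess F d) :
    ∫ ω, ‖S.integral B ω‖ ^ 2 ∂P =
      ∑ l, ∑ i, ∑ j, timeMeasure.real (Set.Ioc (S.left i) (S.right i) ∩
        Set.Ioc (S.left j) (S.right j)) * ∫ ω, S.coef i ω l * S.coef j ω l ∂P := by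
  have h1 : ∀ ω, ‖S.integral B ω‖ ^ 2 = ∑ i, ∑ j, ∑ l, ∑ l',
      (S.coef i ω l * (B l (S.right i) ω - B l (S.left i) ω)) *
        (S.coef j ω l' * (B l' (S.right j) ω - B l' (S.left j) ω)) := by
    intro ω
    rw [Real.norm_eq_abs, sq_abs, pow_two, integral, Finset.sum_mul_sum]
    exact Finset.sum_congr rfl fun i _ => Finset.sum_congr rfl fun j _ => Finset.sum_mul_sum _ _ _ _
  have h2 : ∀ i j l l', Integrable (fun ω =>
      (S.coef i ω l * (B l (S.right i) ω - B l (S.left i) ω)) *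
        (S.coef j ω l' * (B l' (S.right j) ω - B l' (S.left j) ω))) P := fun i j l l' =>
    (memLp_integral_term hB S i l).integrable_mul (memLp_integral_term hB S j l')
  have h3 : ∫ ω, ‖S.integral B ω‖ ^ 2 ∂P = ∑ i, ∑ j, ∑ l, ∑ l', ∫ ω,
      (S.coef i ω l * (B l (S.right i) ω - B l (S.left i) ω)) *
        (S.coef j ω l' * (B l' (S.right j) ω - B l' (S.left j) ω)) ∂P := by
    rw [integral_congr_ae (Eventually.of_forall h1), integral_finsetSum _ fun i _ =>
      integrable_finsetSum _ fun j _ => integrable_finsetSum _ fun l _ =>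
        integrable_finsetSum _ fun l' _ => h2 i j l l']
    refine Finset.sum_congr rfl fun i _ => ?_
    rw [integral_finsetSum _ fun j _ => integrable_finsetSum _ fun l _ =>
        integrable_finsetSum _ fun l' _ => h2 i j l l']
    refine Finset.sum_congr rfl fun j _ => ?_
    rw [integral_finsetSum _ fun l _ => integrable_finsetSum _ fun l' _ => h2 i j l l']
    refine Finset.sum_congr rfl fun l _ => ?_
    rw [integral_finsetSum _ fun l' _ => h2 i j l l']
  rw [h3, Finset.sum_comm' (t' := Finset.univ) (s' := fun _ => Finset.univ) (by simp)]
  conv_rhs => rw [Finset.sum_comm]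
  rw [Finset.sum_comm]
  refine Finset.sum_congr rfl fun i _ => ?_
  rw [Finset.sum_comm (s := (Finset.univ : Finset (Fin d)))]
  refine Finset.sum_congr rfl fun j _ => ?_
  refine Finset.sum_congr rfl fun l _ => ?_
  obtain ⟨C, hC⟩ := S.coef_apply_bounded i l
  -- Distinct components are uncorrelated, so the double sum over components collapses to its
  -- diagonal.
  have h4 : ∀ l', ∫ ω, (S.coef i ω l * (B l (S.right i) ω - B l (S.left i) ω)) *
        (S.coef j ω l' * (B l' (S.right j) ω - B l' (S.left j) ω)) ∂P = if l = l' then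
        (∫ ω, S.coef i ω l * S.coef j ω l' ∂P) * timeMeasure.real
          (Set.Ioc (S.left i) (S.right i) ∩ Set.Ioc (S.left j) (S.right j)) else 0 := by
    intro l'
    obtain ⟨C', hC'⟩ := S.coef_apply_bounded j l'
    exact hB.integral_weighted_increments (S.left_le_right i) (S.left_le_right j)
      (S.coef_apply_measurable i l) (S.coef_apply_measurable j l') hC hC' l l'
  simp_rw [h4]
  rw [Finset.sum_ite_eq]
  simp [mul_comm]

/-- The Itô isometry for simple processes. -/
lemma eLpNorm_integral [IsProbabilityMeasure P] (hB : IsBrownianMotion F B P)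
    (S : SimpleProcess F d) :
    eLpNorm (S.integral B) 2 P =
      eLpNorm (fun p : ℝ≥0 × Ω => S.eval p.1 p.2) 2 (timeMeasure.prod P) := by
  refine eLpNorm_two_eq_of_integral_norm_sq_eq (S.memLp_integral hB) S.memLp_eval ?_
  rw [S.integral_sq_integral hB, S.integral_norm_sq_eval]

/-- The difference of two simple processes. -/
def sub (S S' : SimpleProcess F d) : SimpleProcess F d where
  n := S.n + S'.n
  left := Fin.append S.left S'.left
  right := Fin.append S.right S'.right
  left_le_right i := by
    refine Fin.addCases (fun i => ?_) (fun i => ?_) i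
    · simpa using S.left_le_right i
    · simpa using S'.left_le_right i
  coef := Fin.append S.coef (fun i ω => -S'.coef i ω)
  coef_measurable i := by
    refine Fin.addCases (fun i => ?_) (fun i => ?_) i
    · rw [Fin.append_left S.coef]
      exact (Fin.append_left S.left S'.left i).symm ▸ S.coef_measurable i
    · rw [Fin.append_right S.coef]
      exact (Fin.append_right S.left S'.left i).symm ▸ (S'.coef_measurable i).neg
  coef_bounded i := by
    refine Fin.addCases (fun i => ?_) (fun i => ?_) i
    · simpa using S.coef_bounded i
    · simpa using S'.coef_bounded i

lemma sub_eval (S S' : SimpleProcess F d) (t : ℝ≥0) (ω : Ω) :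
    (S.sub S').eval t ω = S.eval t ω - S'.eval t ω := by
  refine (Fin.sum_univ_add (a := S.n) (b := S'.n) _).trans ?_
  simp only [eval, sub, Fin.append_left, Fin.append_right, sub_eq_add_neg,
    ← Finset.sum_neg_distrib]
  congr 1
  refine Finset.sum_congr rfl fun i _ => ?_
  by_cases h : t ∈ Set.Ioc (S'.left i) (S'.right i) <;> simp [Set.indicator, h]

lemma sub_integral (S S' : SimpleProcess F d) (ω : Ω) :
    (S.sub S').integral B ω = S.integral B ω - S'.integral B ω := by
  refine (Fin.sum_univ_add (a := S.n) (b := S'.n) _).trans ?_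
  simp [integral, sub, sub_eq_add_neg]

end SimpleProcess

lemma IsItoIntegral.congr {u u' : ℝ≥0 → Ω → EuclideanSpace ℝ (Fin d)} {Z Z' : Ω → ℝ}
    (h : IsItoIntegral F B P u Z)
    (hu : (fun p : ℝ≥0 × Ω => u p.1 p.2) =ᵐ[timeMeasure.prod P] fun p => u' p.1 p.2)
    (hZ : Z =ᵐ[P] Z') : IsItoIntegral F B P u' Z' := by
  obtain ⟨h1, h2, S, h3, h4⟩ := h
  refine ⟨h1.ae_eq hu, h2.ae_eq hZ, S, ?_, ?_⟩
  · refine h3.congr fun n => eLpNorm_congr_ae ?_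
    filter_upwards [hu] with p hp
    rw [hp]
  · refine h4.congr fun n => eLpNorm_congr_ae ?_
    filter_upwards [hZ] with p hp
    rw [hp]

/-- The isometry, applied to the difference of the two approximating simple processes, bounds the
`L²` distance of the two candidates by four approximation errors. -/
lemma IsItoIntegral.ae_eq [IsProbabilityMeasure P] (hB : IsBrownianMotion F B P)
    {u : ℝ≥0 → Ω → EuclideanSpace ℝ (Fin d)} {Z Z' : Ω → ℝ}
    (h : IsItoIntegral F B P u Z) (h' : IsItoIntegral F B P u Z') : Z =ᵐ[P] Z' := by
  obtain ⟨hu, hZ, S, h3, h4⟩ := h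
  obtain ⟨-, hZ', S', h3', h4'⟩ := h'
  have key : ∀ n, eLpNorm (fun ω => Z ω - Z' ω) 2 P ≤
      eLpNorm (fun ω => (S n).integral B ω - Z ω) 2 P +
      ((eLpNorm (fun p : ℝ≥0 × Ω => (S n).eval p.1 p.2 - u p.1 p.2) 2 (timeMeasure.prod P) +
      eLpNorm (fun p : ℝ≥0 × Ω => (S' n).eval p.1 p.2 - u p.1 p.2) 2 (timeMeasure.prod P)) +
      eLpNorm (fun ω => (S' n).integral B ω - Z' ω) 2 P) := by
    intro n
    have m1 := (((S n).memLp_integral hB).sub hZ).1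
    have m2 := (((S' n).memLp_integral hB).sub hZ').1
    have m3 := (((S n).sub (S' n)).memLp_integral hB).1
    have e1 : (fun ω => Z ω - Z' ω) = -((S n).integral B - Z) +
        (((S n).sub (S' n)).integral B + ((S' n).integral B - Z')) := by
      ext ω
      simp [SimpleProcess.sub_integral]
    rw [e1]
    refine (eLpNorm_add_le m1.neg (m3.add m2) (by norm_num)).trans ?_
    rw [eLpNorm_neg]
    refine add_le_add le_rfl ((eLpNorm_add_le m3 m2 (by norm_num)).trans
      (add_le_add ?_ le_rfl))
    rw [SimpleProcess.eLpNorm_integral hB]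
    have e2 : (fun p : ℝ≥0 × Ω => ((S n).sub (S' n)).eval p.1 p.2) =
        (fun p : ℝ≥0 × Ω => (S n).eval p.1 p.2 - u p.1 p.2) -
        fun p : ℝ≥0 × Ω => (S' n).eval p.1 p.2 - u p.1 p.2 := by
      ext1 p
      simp [SimpleProcess.sub_eval]
    rw [e2]
    exact eLpNorm_sub_le ((S n).memLp_eval.sub hu).1 ((S' n).memLp_eval.sub hu).1 (by norm_num)
  have hlim := h4.add ((h3.add h3').add h4')
  simp only [add_zero] at hlim
  have h0 : eLpNorm (fun ω => Z ω - Z' ω) 2 P = 0 :=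
    le_antisymm (ge_of_tendsto' hlim key) bot_le
  have h0 := (eLpNorm_eq_zero_iff (hZ.sub hZ').1 (by norm_num)).1 h0
  filter_upwards [h0] with ω hω
  exact sub_eq_zero.1 hω

/-- Makes the chosen version computable: exhibiting any one Itô integral determines it almost
surely. -/
lemma IsItoIntegral.ae_eq_itoIntegral [IsProbabilityMeasure P] (hB : IsBrownianMotion F B P)
    {u : ℝ≥0 → Ω → EuclideanSpace ℝ (Fin d)} {Z : Ω → ℝ} (h : IsItoIntegral F B P u Z) :
    itoIntegral F B P u =ᵐ[P] Z := by
  have h' : ItoIntegrable F B P u := ⟨Z, h⟩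
  rw [itoIntegral, dif_pos h']
  exact h'.choose_spec.ae_eq hB h

end Ito

section Wiener

variable {Ω : Type*} {mΩ : MeasurableSpace Ω} {d : ℕ} {P : Measure Ω}
  {F : Filtration ℝ≥0 mΩ} {B : Fin d → ℝ≥0 → Ω → ℝ}

/-! ### Step functions -/

namespace StepFunction

/-- A step function as a deterministic simple process. -/
def toSimple (F : Filtration ℝ≥0 mΩ) (S : StepFunction d) : SimpleProcess F d where
  n := S.n
  left := S.left
  right := S.right
  left_le_right := S.left_le_right
  coef i _ := S.coef i
  coef_measurable _ := stronglyMeasurable_const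
  coef_bounded i := ⟨‖S.coef i‖, fun _ => le_rfl⟩

lemma memLp_toFunction (S : StepFunction d) : MemLp S.toFunction 2 timeMeasure := by
  refine memLp_finsetSum _ fun i _ => ?_
  refine memLp_indicator_const 2 measurableSet_Ioc _ (Or.inr ?_)
  rw [timeMeasure_Ioc]
  exact ENNReal.ofReal_ne_top

lemma memLp_integral [IsProbabilityMeasure P] (hB : IsBrownianMotion F B P)
    (S : StepFunction d) : MemLp (S.integral B) 2 P :=
  (S.toSimple F).memLp_integral hB

lemma eLpNorm_integral [IsProbabilityMeasure P] (hB : IsBrownianMotion F B P)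
    (S : StepFunction d) : eLpNorm (S.integral B) 2 P = eLpNorm S.toFunction 2 timeMeasure := by
  refine ((S.toSimple F).eLpNorm_integral hB).trans ?_
  -- The process is constant in `ω` and `P` has mass one, so the norm on the product is the norm in
  -- time.
  exact eLpNorm_comp_measurePreserving (g := S.toFunction) S.memLp_toFunction.1
    measurePreserving_fst

/-- The zero step function. -/
def zero : StepFunction d := ⟨0, Fin.elim0, Fin.elim0, fun i => i.elim0, Fin.elim0⟩

/-- The sum of two step functions. -/
def add (S S' : StepFunction d) : StepFunction d where
  n := S.n + S'.n
  left := Fin.append S.left S'.left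
  right := Fin.append S.right S'.right
  left_le_right i := by
    refine Fin.addCases (fun i => ?_) (fun i => ?_) i
    · simpa using S.left_le_right i
    · simpa using S'.left_le_right i
  coef := Fin.append S.coef S'.coef

/-- A multiple of a step function. -/
def smul (c : ℝ) (S : StepFunction d) : StepFunction d :=
  { S with coef := fun i => c • S.coef i }

lemma zero_toFunction : (zero : StepFunction d).toFunction = 0 := by
  ext1 t
  exact Fin.sum_univ_zero _

lemma zero_integral : (zero : StepFunction d).integral B = 0 := by
  ext1 t
  exact Fin.sum_univ_zero _

lemma add_toFunction (S S' : StepFunction d) :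
    (S.add S').toFunction = S.toFunction + S'.toFunction := by
  ext1 t
  refine (Fin.sum_univ_add (a := S.n) (b := S'.n) _).trans ?_
  simp [toFunction, add]

lemma add_integral (S S' : StepFunction d) :
    (S.add S').integral B = S.integral B + S'.integral B := by
  ext1 t
  refine (Fin.sum_univ_add (a := S.n) (b := S'.n) _).trans ?_
  simp [integral, add]

lemma smul_toFunction (c : ℝ) (S : StepFunction d) :
    (S.smul c).toFunction = c • S.toFunction := by
  ext1 t
  simp only [toFunction, Pi.smul_apply, Finset.smul_sum]
  refine Finset.sum_congr rfl fun i _ => ?_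
  exact Set.indicator_const_smul_apply _ c (fun _ => S.coef i) t

lemma smul_integral (c : ℝ) (S : StepFunction d) :
    (S.smul c).integral B = c • S.integral B := by
  ext1 ω
  simp only [integral, Pi.smul_apply, Finset.smul_sum]
  refine Finset.sum_congr rfl fun i _ => Finset.sum_congr rfl fun l _ => ?_
  exact mul_assoc _ _ _

end StepFunction

/-! ### The closed graph of the Wiener integral -/

/-- The graph of the elementary Wiener integral on step functions. -/
def wienerStepGraph [IsProbabilityMeasure P] (hB : IsBrownianMotion F B P) :
    Submodule ℝ (Lp (EuclideanSpace ℝ (Fin d)) 2 timeMeasure × Lp ℝ 2 P) where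
  carrier := Set.range fun S : StepFunction d =>
    (S.memLp_toFunction.toLp _, (S.memLp_integral hB).toLp _)
  add_mem' := by
    rintro _ _ ⟨S, rfl⟩ ⟨S', rfl⟩
    refine ⟨S.add S', ?_⟩
    simp only [Prod.mk_add_mk, ← MemLp.toLp_add, S.add_toFunction, S.add_integral]
  zero_mem' := by
    refine ⟨StepFunction.zero, ?_⟩
    simp only [StepFunction.zero_toFunction, StepFunction.zero_integral, MemLp.toLp_zero]
    rfl
  smul_mem' := by
    rintro c _ ⟨S, rfl⟩
    refine ⟨S.smul c, ?_⟩
    simp only [Prod.smul_mk, ← MemLp.toLp_const_smul, S.smul_toFunction, S.smul_integral]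

/-- The graph of the Wiener integral. -/
def wienerGraph [IsProbabilityMeasure P] (hB : IsBrownianMotion F B P) :
    Submodule ℝ (Lp (EuclideanSpace ℝ (Fin d)) 2 timeMeasure × Lp ℝ 2 P) :=
  (wienerStepGraph hB).topologicalClosure

lemma isClosed_wienerGraph [IsProbabilityMeasure P] (hB : IsBrownianMotion F B P) :
    IsClosed (wienerGraph hB : Set (Lp (EuclideanSpace ℝ (Fin d)) 2 timeMeasure × Lp ℝ 2 P)) :=
  Submodule.isClosed_topologicalClosure _

/-- Closure and sequential closure agree in a metric space. The Wiener integral thereby becomes a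
closed subspace of a product of `L²` spaces, so that linearity and limits come for free. -/
lemma isWienerIntegral_iff [IsProbabilityMeasure P] (hB : IsBrownianMotion F B P)
    {h : ℝ≥0 → EuclideanSpace ℝ (Fin d)} {W : Ω → ℝ} :
    IsWienerIntegral B P h W ↔ ∃ (hh : MemLp h 2 timeMeasure) (hW : MemLp W 2 P),
      (hh.toLp h, hW.toLp W) ∈ wienerGraph hB := by
  have key : ∀ (hh : MemLp h 2 timeMeasure) (hW : MemLp W 2 P) (S : ℕ → StepFunction d),
      Tendsto (fun n => ((S n).memLp_toFunction.toLp _, ((S n).memLp_integral hB).toLp _)) atTop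
        (𝓝 (hh.toLp h, hW.toLp W)) ↔
      Tendsto (fun n => eLpNorm (fun t => (S n).toFunction t - h t) 2 timeMeasure) atTop (𝓝 0) ∧
      Tendsto (fun n => eLpNorm (fun ω => (S n).integral B ω - W ω) 2 P) atTop (𝓝 0) := by
    intro hh hW S
    rw [Prod.tendsto_iff]
    exact and_congr
      (Lp.tendsto_Lp_iff_tendsto_eLpNorm'' (fun n => (S n).toFunction)
        (fun n => (S n).memLp_toFunction) h hh)
      (Lp.tendsto_Lp_iff_tendsto_eLpNorm'' (fun n => (S n).integral B)
        (fun n => (S n).memLp_integral hB) W hW)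
  constructor
  · rintro ⟨hh, hW, S, hS⟩
    refine ⟨hh, hW, mem_closure_iff_seq_limit.2 ⟨_, fun n => ⟨S n, rfl⟩, (key hh hW S).2 hS⟩⟩
  · rintro ⟨hh, hW, hm⟩
    obtain ⟨x, hx, hx'⟩ := mem_closure_iff_seq_limit.1 hm
    choose S hS using hx
    refine ⟨hh, hW, S, (key hh hW S).1 ?_⟩
    exact hx'.congr fun n => (hS n).symm

lemma wienerGraph_coe [IsProbabilityMeasure P] (hB : IsBrownianMotion F B P)
    {p : Lp (EuclideanSpace ℝ (Fin d)) 2 timeMeasure × Lp ℝ 2 P} (hp : p ∈ wienerGraph hB) :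
    IsWienerIntegral B P p.1 p.2 := by
  refine (isWienerIntegral_iff hB).2 ⟨Lp.memLp _, Lp.memLp _, ?_⟩
  rwa [Lp.toLp_coeFn, Lp.toLp_coeFn]

/-- A closed property of pairs which holds on the graph of the elementary integral holds on the
graph of the Wiener integral. -/
lemma wienerGraph_induction [IsProbabilityMeasure P] (hB : IsBrownianMotion F B P)
    {s : Set (Lp (EuclideanSpace ℝ (Fin d)) 2 timeMeasure × Lp ℝ 2 P)} (hs : IsClosed s)
    (h : ∀ S : StepFunction d, (S.memLp_toFunction.toLp _, (S.memLp_integral hB).toLp _) ∈ s)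
    {p : Lp (EuclideanSpace ℝ (Fin d)) 2 timeMeasure × Lp ℝ 2 P} (hp : p ∈ wienerGraph hB) :
    p ∈ s := by
  refine closure_minimal ?_ hs hp
  rintro _ ⟨S, rfl⟩
  exact h S

/-- Equality of norms is a closed condition, and on step functions it is the Itô isometry. -/
lemma norm_eq_of_mem_wienerGraph [IsProbabilityMeasure P] (hB : IsBrownianMotion F B P)
    {p : Lp (EuclideanSpace ℝ (Fin d)) 2 timeMeasure × Lp ℝ 2 P} (hp : p ∈ wienerGraph hB) :
    ‖p.1‖ = ‖p.2‖ := by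
  refine wienerGraph_induction (s := {p | ‖p.1‖ = ‖p.2‖}) hB
    (isClosed_eq (by fun_prop) (by fun_prop)) (fun S => ?_) hp
  simp only [Set.mem_ofPred_eq, Lp.norm_toLp, S.eLpNorm_integral hB]

/-- Polarization of the isometry, the graph being closed under addition. -/
lemma inner_eq_of_mem_wienerGraph [IsProbabilityMeasure P] (hB : IsBrownianMotion F B P)
    {p q : Lp (EuclideanSpace ℝ (Fin d)) 2 timeMeasure × Lp ℝ 2 P} (hp : p ∈ wienerGraph hB)
    (hq : q ∈ wienerGraph hB) : inner ℝ p.1 q.1 = inner ℝ p.2 q.2 := by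
  rw [real_inner_eq_norm_add_mul_self_sub_norm_mul_self_sub_norm_mul_self_div_two,
    real_inner_eq_norm_add_mul_self_sub_norm_mul_self_sub_norm_mul_self_div_two,
    norm_eq_of_mem_wienerGraph hB hp, norm_eq_of_mem_wienerGraph hB hq,
    ← Prod.fst_add, ← Prod.snd_add, norm_eq_of_mem_wienerGraph hB (add_mem hp hq)]

namespace IsWienerIntegral

variable {h h' : ℝ≥0 → EuclideanSpace ℝ (Fin d)} {W W' : Ω → ℝ}

lemma congr (hW : IsWienerIntegral B P h W) (hh : h =ᵐ[timeMeasure] h') (hWW : W =ᵐ[P] W') :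
    IsWienerIntegral B P h' W' := by
  obtain ⟨h1, h2, S, h3, h4⟩ := hW
  refine ⟨h1.ae_eq hh, h2.ae_eq hWW, S, ?_, ?_⟩
  · refine h3.congr fun n => eLpNorm_congr_ae ?_
    filter_upwards [hh] with p hp
    rw [hp]
  · refine h4.congr fun n => eLpNorm_congr_ae ?_
    filter_upwards [hWW] with p hp
    rw [hp]

lemma congr_right (hW : IsWienerIntegral B P h W) (hWW : W =ᵐ[P] W') :
    IsWienerIntegral B P h W' := hW.congr (ae_eq_refl _) hWW

lemma memLp_integrand (hW : IsWienerIntegral B P h W) : MemLp h 2 timeMeasure := hW.1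

lemma memLp_two (hW : IsWienerIntegral B P h W) : MemLp W 2 P := hW.2.1

lemma step [IsProbabilityMeasure P] (hB : IsBrownianMotion F B P) (S : StepFunction d) :
    IsWienerIntegral B P S.toFunction (S.integral B) :=
  ⟨S.memLp_toFunction, S.memLp_integral hB, fun _ => S, by simp, by simp⟩

lemma add [IsProbabilityMeasure P] (hB : IsBrownianMotion F B P)
    (hW : IsWienerIntegral B P h W) (hW' : IsWienerIntegral B P h' W') :
    IsWienerIntegral B P (fun t => h t + h' t) (fun ω => W ω + W' ω) := by
  obtain ⟨a1, a2, a3⟩ := (isWienerIntegral_iff hB).1 hW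
  obtain ⟨b1, b2, b3⟩ := (isWienerIntegral_iff hB).1 hW'
  exact (isWienerIntegral_iff hB).2 ⟨a1.add b1, a2.add b2, add_mem a3 b3⟩

lemma const_smul [IsProbabilityMeasure P] (hB : IsBrownianMotion F B P)
    (hW : IsWienerIntegral B P h W) (c : ℝ) :
    IsWienerIntegral B P (fun t => c • h t) (fun ω => c * W ω) := by
  obtain ⟨a1, a2, a3⟩ := (isWienerIntegral_iff hB).1 hW
  exact (isWienerIntegral_iff hB).2
    ⟨a1.const_smul c, a2.const_smul c, Submodule.smul_mem _ c a3⟩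

lemma zero [IsProbabilityMeasure P] (hB : IsBrownianMotion F B P) :
    IsWienerIntegral B P (fun _ => (0 : EuclideanSpace ℝ (Fin d))) (fun _ => 0) :=
  (isWienerIntegral_iff hB).2 ⟨MemLp.zero, MemLp.zero, zero_mem (wienerGraph hB)⟩

lemma sub [IsProbabilityMeasure P] (hB : IsBrownianMotion F B P)
    (hW : IsWienerIntegral B P h W) (hW' : IsWienerIntegral B P h' W') :
    IsWienerIntegral B P (fun t => h t - h' t) (fun ω => W ω - W' ω) := by
  simpa [sub_eq_add_neg] using hW.add hB (hW'.const_smul hB (-1))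

lemma sum [IsProbabilityMeasure P] (hB : IsBrownianMotion F B P) {ι : Type*} (s : Finset ι)
    {h : ι → ℝ≥0 → EuclideanSpace ℝ (Fin d)} {W : ι → Ω → ℝ}
    (hW : ∀ i ∈ s, IsWienerIntegral B P (h i) (W i)) :
    IsWienerIntegral B P (fun t => ∑ i ∈ s, h i t) (fun ω => ∑ i ∈ s, W i ω) := by
  classical
  induction s using Finset.induction_on with
  | empty => simpa using zero hB
  | insert a s ha ih =>
    simp_rw [Finset.sum_insert ha]
    exact (hW a (Finset.mem_insert_self a s)).add hB
      (ih fun i hi => hW i (Finset.mem_insert_of_mem hi))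

lemma linearCombination [IsProbabilityMeasure P] (hB : IsBrownianMotion F B P) {ι : Type*}
    (s : Finset ι) {h : ι → ℝ≥0 → EuclideanSpace ℝ (Fin d)} {W : ι → Ω → ℝ}
    (hW : ∀ i ∈ s, IsWienerIntegral B P (h i) (W i)) (c : ι → ℝ) :
    IsWienerIntegral B P (fun t => ∑ i ∈ s, c i • h i t) (fun ω => ∑ i ∈ s, c i * W i ω) :=
  sum hB s fun i hi => (hW i hi).const_smul hB (c i)

lemma integral_mul [IsProbabilityMeasure P] (hB : IsBrownianMotion F B P)
    (hW : IsWienerIntegral B P h W) (hW' : IsWienerIntegral B P h' W') :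
    ∫ ω, W ω * W' ω ∂P = ∫ t, inner ℝ (h t) (h' t) ∂timeMeasure := by
  obtain ⟨a1, a2, a3⟩ := (isWienerIntegral_iff hB).1 hW
  obtain ⟨b1, b2, b3⟩ := (isWienerIntegral_iff hB).1 hW'
  have := inner_eq_of_mem_wienerGraph hB b3 a3
  rw [L2.inner_def, L2.inner_def] at this
  have e1 : ∫ t, inner ℝ (h t) (h' t) ∂timeMeasure =
      ∫ t, inner ℝ (b1.toLp h' t) (a1.toLp h t) ∂timeMeasure := by
    refine integral_congr_ae ?_
    filter_upwards [a1.coeFn_toLp, b1.coeFn_toLp] with t h1 h2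
    rw [h1, h2, real_inner_comm]
  rw [e1, this]
  refine integral_congr_ae ?_
  filter_upwards [a2.coeFn_toLp, b2.coeFn_toLp] with t h1 h2
  rw [h1, h2]
  simp

/-- The Wiener integral exists for `L²`-limits of Wiener integrable functions. -/
lemma exists_of_tendsto [IsProbabilityMeasure P] (hB : IsBrownianMotion F B P)
    {g : ℕ → ℝ≥0 → EuclideanSpace ℝ (Fin d)} {V : ℕ → Ω → ℝ}
    (hV : ∀ n, IsWienerIntegral B P (g n) (V n)) (hh : MemLp h 2 timeMeasure)
    (hlim : Tendsto (fun n => eLpNorm (g n - h) 2 timeMeasure) atTop (𝓝 0)) :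
    ∃ W, IsWienerIntegral B P h W := by
  choose a1 a2 a3 using fun n => (isWienerIntegral_iff hB).1 (hV n)
  have h1 : Tendsto (fun n => (a1 n).toLp (g n)) atTop (𝓝 (hh.toLp h)) :=
    (Lp.tendsto_Lp_iff_tendsto_eLpNorm'' g a1 h hh).2 hlim
  -- The isometry carries the Cauchy property from the integrands to the integrals.
  have h2 : CauchySeq fun n => (a2 n).toLp (V n) := by
    refine Metric.cauchySeq_iff.2 fun ε hε => ?_
    obtain ⟨N, hN⟩ := Metric.cauchySeq_iff.1 h1.cauchySeq ε hε
    refine ⟨N, fun m hm n hn => ?_⟩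
    rw [dist_eq_norm]
    have := norm_eq_of_mem_wienerGraph hB (sub_mem (a3 m) (a3 n))
    simp only [Prod.fst_sub, Prod.snd_sub] at this
    rw [← this, ← dist_eq_norm]
    exact hN m hm n hn
  obtain ⟨w, hw⟩ := cauchySeq_tendsto_of_complete h2
  have h3 : (hh.toLp h, w) ∈ wienerGraph hB :=
    (isClosed_wienerGraph hB).mem_of_tendsto (h1.prodMk_nhds hw) (Eventually.of_forall a3)
  exact ⟨w, (wienerGraph_coe hB h3).congr hh.coeFn_toLp (ae_eq_refl _)⟩

/-- The isometry read backwards: the Wiener integrals form a closed subspace of `L²(P)`. -/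
lemma of_tendsto [IsProbabilityMeasure P] (hB : IsBrownianMotion F B P)
    {g : ℕ → ℝ≥0 → EuclideanSpace ℝ (Fin d)} {V : ℕ → Ω → ℝ}
    (hV : ∀ n, IsWienerIntegral B P (g n) (V n)) (hW : MemLp W 2 P)
    (hlim : Tendsto (fun n => eLpNorm (V n - W) 2 P) atTop (𝓝 0)) :
    ∃ h, IsWienerIntegral B P h W := by
  choose a1 a2 a3 using fun n => (isWienerIntegral_iff hB).1 (hV n)
  have h1 : Tendsto (fun n => (a2 n).toLp (V n)) atTop (𝓝 (hW.toLp W)) :=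
    (Lp.tendsto_Lp_iff_tendsto_eLpNorm'' V a2 W hW).2 hlim
  have h2 : CauchySeq fun n => (a1 n).toLp (g n) := by
    refine Metric.cauchySeq_iff.2 fun ε hε => ?_
    obtain ⟨N, hN⟩ := Metric.cauchySeq_iff.1 h1.cauchySeq ε hε
    refine ⟨N, fun m hm n hn => ?_⟩
    rw [dist_eq_norm]
    have := norm_eq_of_mem_wienerGraph hB (sub_mem (a3 m) (a3 n))
    simp only [Prod.fst_sub, Prod.snd_sub] at this
    rw [this, ← dist_eq_norm]
    exact hN m hm n hn
  obtain ⟨w, hw⟩ := cauchySeq_tendsto_of_complete h2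
  have h3 : (w, hW.toLp W) ∈ wienerGraph hB :=
    (isClosed_wienerGraph hB).mem_of_tendsto (hw.prodMk_nhds h1) (Eventually.of_forall a3)
  exact ⟨w, (wienerGraph_coe hB h3).congr (ae_eq_refl _) hW.coeFn_toLp⟩

/-- The Wiener integral of a deterministic function is its Itô integral. -/
lemma isItoIntegral [IsProbabilityMeasure P] (hW : IsWienerIntegral B P h W) :
    IsItoIntegral F B P (fun t _ => h t) W := by
  obtain ⟨h1, h2, S, h3, h4⟩ := hW
  refine ⟨h1.comp_fst P, h2, fun n => (S n).toSimple F, ?_, h4⟩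
  refine h3.congr fun n => ?_
  exact (eLpNorm_comp_measurePreserving (g := fun t => (S n).toFunction t - h t)
    ((S n).memLp_toFunction.sub h1).1 measurePreserving_fst).symm

lemma itoIntegral_ae_eq [IsProbabilityMeasure P] (hB : IsBrownianMotion F B P)
    (hW : IsWienerIntegral B P h W) : itoIntegral F B P (fun t _ => h t) =ᵐ[P] W :=
  (hW.isItoIntegral (F := F)).ae_eq_itoIntegral hB

end IsWienerIntegral

end Wiener

section WienerLaw

variable {Ω : Type*} {mΩ : MeasurableSpace Ω} {d : ℕ} {P : Measure Ω}
  {F : Filtration ℝ≥0 mΩ} {B : Fin d → ℝ≥0 → Ω → ℝ}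

/-! ### Gaussian laws -/

lemma hasGaussianLaw_of_dual {E : Type*} [NormedAddCommGroup E] [NormedSpace ℝ E]
    [MeasurableSpace E] [BorelSpace E] {Y : Ω → E} (hY : AEMeasurable Y P)
    (h : ∀ L : StrongDual ℝ E, HasGaussianLaw (fun ω => L (Y ω)) P) : HasGaussianLaw Y P := by
  refine ⟨⟨fun L => ?_⟩⟩
  have h1 := (h L).map_eq_gaussianReal
  have hL : Measurable L := L.continuous.measurable
  rw [AEMeasurable.map_map_of_aemeasurable hL.aemeasurable hY,
    integral_map hY hL.aestronglyMeasurable, variance_map hL.aemeasurable hY]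
  exact h1

lemma IsBrownianMotion.hasGaussianLaw_sum_increments (hB : IsBrownianMotion F B P) (l : Fin d)
    {ι : Type*} [Fintype ι] (c : ι → ℝ) (s t : ι → ℝ≥0) :
    HasGaussianLaw (fun ω => ∑ i, c i * (B l (t i) ω - B l (s i) ω)) P := by
  classical
  -- On the finite set of all end points the path is a Gaussian vector, and the sum is a linear
  -- functional of it.
  set I : Finset ℝ≥0 := Finset.univ.image t ∪ Finset.univ.image s with hI
  have ht : ∀ i, t i ∈ I := fun i => by simp [hI]
  have hs : ∀ i, s i ∈ I := fun i => by simp [hI]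
  have h1 := ((hB.isBrownianReal l).hasLaw I).hasGaussianLaw.map_fun (∑ i, c i •
    (ContinuousLinearMap.proj (R := ℝ) (φ := fun _ : I => ℝ) ⟨t i, ht i⟩ -
      ContinuousLinearMap.proj (R := ℝ) (φ := fun _ : I => ℝ) ⟨s i, hs i⟩))
  simpa using h1

lemma StepFunction.hasGaussianLaw_integral [IsProbabilityMeasure P]
    (hB : IsBrownianMotion F B P) (S : StepFunction d) : HasGaussianLaw (S.integral B) P := by
  -- Grouping by component gives independent Gaussian summands.
  have h1 : S.integral B = fun ω => ∑ l, ∑ i, S.coef i l *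
      (B l (S.right i) ω - B l (S.left i) ω) := by
    ext1 ω
    exact Finset.sum_comm
  have hm : ∀ l, Measurable (fun w : ℝ≥0 → ℝ => ∑ i, S.coef i l *
      (w (S.right i) - w (S.left i))) := fun l => by fun_prop
  rw [h1]
  exact iIndepFun.hasGaussianLaw_fun_sum
    (fun l => hB.hasGaussianLaw_sum_increments l _ S.left S.right)
    (hB.indep_components.comp _ hm)

lemma StepFunction.integral_integral [IsProbabilityMeasure P]
    (hB : IsBrownianMotion F B P) (S : StepFunction d) : ∫ ω, S.integral B ω ∂P = 0 := by
  have h1 : ∀ i l, Integrable (fun ω => S.coef i l *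
      (B l (S.right i) ω - B l (S.left i) ω)) P := fun i l =>
    ((hB.memLp_increment l (S.left i) (S.right i) (p := 1) (by simp)).integrable
      le_rfl).const_mul _
  simp only [StepFunction.integral]
  rw [integral_finsetSum _ fun i _ => integrable_finsetSum _ fun l _ => h1 i l]
  refine Finset.sum_eq_zero fun i _ => ?_
  rw [integral_finsetSum _ fun l _ => h1 i l]
  refine Finset.sum_eq_zero fun l _ => ?_
  rw [integral_const_mul, hB.integral_increment, mul_zero]

lemma map_eq_gaussianReal_of_charFun [IsProbabilityMeasure P] {W : Ω → ℝ}
    (hW : AEMeasurable W P) {v : ℝ≥0}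
    (h : ∀ t : ℝ, ∫ ω, Complex.exp (t * W ω * Complex.I) ∂P = Complex.exp (-(v * t ^ 2 / 2))) :
    P.map W = gaussianReal 0 v := by
  have : IsProbabilityMeasure (P.map W) := Measure.isProbabilityMeasure_map hW
  refine Measure.ext_of_charFun ?_
  ext t
  rw [charFun_gaussianReal, charFun_apply_real, integral_map hW (by fun_prop), h t]
  simp

lemma integral_exp_of_map_eq_gaussianReal {W : Ω → ℝ}
    (hW : AEMeasurable W P) {v : ℝ≥0} (h : P.map W = gaussianReal 0 v) (t : ℝ) :
    ∫ ω, Complex.exp (t * W ω * Complex.I) ∂P = Complex.exp (-(v * t ^ 2 / 2)) := by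
  have := charFun_gaussianReal (μ := 0) (v := v) t
  rw [← h, charFun_apply_real, integral_map hW (by fun_prop)] at this
  rw [this]
  simp

/-- Continuity of the characteristic function in `L²`, needed to pass Gaussian laws to limits: `x ↦
exp(itx)` is `|t|`-Lipschitz, and on a probability space the `L¹` norm is at most the `L²` norm. -/
lemma lipschitz_integral_exp [IsProbabilityMeasure P] (t : ℝ) :
    LipschitzWith ‖t‖₊ (fun W : Lp ℝ 2 P => ∫ ω, Complex.exp (t * W ω * Complex.I) ∂P) := by
  have hint : ∀ W : Lp ℝ 2 P, Integrable (fun ω => Complex.exp (t * W ω * Complex.I)) P := by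
    intro W
    have hm : AEStronglyMeasurable (fun ω => Complex.exp (t * W ω * Complex.I)) P :=
      (by fun_prop : Continuous fun x : ℝ =>
        Complex.exp (t * x * Complex.I)).comp_aestronglyMeasurable (Lp.aestronglyMeasurable W)
    refine Integrable.of_bound hm 1 (Eventually.of_forall fun ω => ?_)
    rw [← Complex.ofReal_mul, Complex.norm_exp_ofReal_mul_I]
  refine LipschitzWith.of_dist_le_mul fun W V => ?_
  rw [dist_eq_norm, ← integral_sub (hint W) (hint V), dist_eq_norm]
  have hb : ∀ x y : ℝ, ‖Complex.exp (t * x * Complex.I) - Complex.exp (t * y * Complex.I)‖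
      ≤ ‖t‖ * ‖x - y‖ := by
    intro x y
    have h1 : Complex.exp (t * x * Complex.I) - Complex.exp (t * y * Complex.I) =
        Complex.exp ((t * y : ℝ) * Complex.I) *
          (Complex.exp (Complex.I * (t * (x - y) : ℝ)) - 1) := by
      rw [mul_sub, ← Complex.exp_add, mul_one]
      congr 2 <;> push_cast <;> ring
    rw [h1, norm_mul, Complex.norm_exp_ofReal_mul_I, one_mul, ← norm_mul]
    exact Real.norm_exp_I_mul_ofReal_sub_one_le
  have hi : Integrable (fun ω => (W - V : Lp ℝ 2 P) ω) P :=
    (Lp.memLp (W - V)).integrable (by norm_num)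
  calc ‖∫ ω, (Complex.exp (t * W ω * Complex.I) - Complex.exp (t * V ω * Complex.I)) ∂P‖
      ≤ ∫ ω, ‖t‖ * ‖(W - V : Lp ℝ 2 P) ω‖ ∂P := by
        refine norm_integral_le_of_norm_le (hi.norm.const_mul _) ?_
        filter_upwards [Lp.coeFn_sub W V] with ω hω
        rw [hω]
        exact hb _ _
    _ = ‖t‖ * ∫ ω, ‖(W - V : Lp ℝ 2 P) ω‖ ∂P := integral_const_mul _ _
    _ ≤ ‖t‖ * ‖W - V‖ := by
        gcongr
        rw [integral_norm_eq_lintegral_enorm hi.1, ← eLpNorm_one_eq_lintegral_enorm, Lp.norm_def]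
        exact ENNReal.toReal_mono (Lp.memLp _).eLpNorm_ne_top
          (eLpNorm_le_eLpNorm_of_exponent_le (by norm_num) (Lp.aestronglyMeasurable _))
    _ = _ := by simp

/-- Both sides are continuous on the graph, so step functions suffice; there the variance of the
centred Gaussian is its squared `L²` norm. -/
lemma integral_exp_of_mem_wienerGraph [IsProbabilityMeasure P] (hB : IsBrownianMotion F B P)
    {p : Lp (EuclideanSpace ℝ (Fin d)) 2 timeMeasure × Lp ℝ 2 P} (hp : p ∈ wienerGraph hB)
    (t : ℝ) : ∫ ω, Complex.exp (t * p.2 ω * Complex.I) ∂P =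
      Complex.exp (-((‖p.2‖₊ ^ 2 : ℝ≥0) * t ^ 2 / 2)) := by
  refine wienerGraph_induction (s := {p | ∫ ω, Complex.exp (t * p.2 ω * Complex.I) ∂P =
      Complex.exp (-((‖p.2‖₊ ^ 2 : ℝ≥0) * t ^ 2 / 2))}) hB
    (isClosed_eq ((lipschitz_integral_exp t).continuous.comp continuous_snd) ?_) (fun S => ?_) hp
  · have : Continuous fun p : Lp (EuclideanSpace ℝ (Fin d)) 2 timeMeasure × Lp ℝ 2 P =>
        Complex.exp (-(((‖p.2‖ ^ 2 : ℝ) : ℂ) * t ^ 2 / 2)) := by fun_prop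
    simpa using this
  · have h1 := S.memLp_integral hB
    have h2 := (S.hasGaussianLaw_integral hB).map_eq_gaussianReal
    rw [S.integral_integral hB] at h2
    have h3 : Var[S.integral B; P].toNNReal = ‖h1.toLp (S.integral B)‖₊ ^ 2 := by
      ext
      rw [variance_of_integral_eq_zero h1.1.aemeasurable (S.integral_integral hB),
        Real.coe_toNNReal _ (by positivity), NNReal.coe_pow, coe_nnnorm, Lp.norm_toLp,
        eLpNorm_two_eq_ofReal_sqrt h1, ENNReal.toReal_ofReal (by positivity),
        Real.sq_sqrt (by positivity)]
      simp
    have h4 := integral_exp_of_map_eq_gaussianReal h1.1.aemeasurable h2 t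
    rw [h3] at h4
    simp only [Set.mem_ofPred_eq]
    rw [← h4]
    refine integral_congr_ae ?_
    filter_upwards [h1.coeFn_toLp] with ω hω
    rw [hω]

namespace IsWienerIntegral

variable {h : ℝ≥0 → EuclideanSpace ℝ (Fin d)} {W : Ω → ℝ}

/-- The Wiener integral of `h` is centred Gaussian with variance `‖h‖²`. -/
lemma map_eq_gaussianReal [IsProbabilityMeasure P] (hB : IsBrownianMotion F B P)
    (hW : IsWienerIntegral B P h W) :
    P.map W = gaussianReal 0 (∫ t, ‖h t‖ ^ 2 ∂timeMeasure).toNNReal := by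
  obtain ⟨a1, a2, a3⟩ := (isWienerIntegral_iff hB).1 hW
  refine map_eq_gaussianReal_of_charFun hW.memLp_two.1.aemeasurable fun t => ?_
  have h1 := integral_exp_of_mem_wienerGraph hB a3 t
  have h2 : (∫ t, ‖h t‖ ^ 2 ∂timeMeasure).toNNReal = ‖a2.toLp W‖₊ ^ 2 := by
    ext
    rw [Real.coe_toNNReal _ (by positivity), NNReal.coe_pow, coe_nnnorm,
      ← norm_eq_of_mem_wienerGraph hB a3, Lp.norm_toLp,
      eLpNorm_two_eq_ofReal_sqrt a1, ENNReal.toReal_ofReal (by positivity),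
      Real.sq_sqrt (by positivity)]
  rw [h2, ← h1]
  refine integral_congr_ae ?_
  filter_upwards [a2.coeFn_toLp] with ω hω
  rw [hω]

lemma hasGaussianLaw [IsProbabilityMeasure P] (hB : IsBrownianMotion F B P)
    (hW : IsWienerIntegral B P h W) : HasGaussianLaw W P :=
  ⟨by rw [hW.map_eq_gaussianReal hB]; infer_instance⟩

lemma integral_eq_zero [IsProbabilityMeasure P] (hB : IsBrownianMotion F B P)
    (hW : IsWienerIntegral B P h W) : ∫ ω, W ω ∂P = 0 := by
  have h1 := integral_map hW.memLp_two.1.aemeasurable (f := fun x : ℝ => x)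
    (by fun_prop)
  rw [← h1, hW.map_eq_gaussianReal hB, integral_id_gaussianReal]

/-- Finitely many Wiener integrals are jointly Gaussian. -/
lemma hasGaussianLaw_pi [IsProbabilityMeasure P] (hB : IsBrownianMotion F B P) {ι : Type*}
    [Fintype ι] {h : ι → ℝ≥0 → EuclideanSpace ℝ (Fin d)} {W : ι → Ω → ℝ}
    (hW : ∀ i, IsWienerIntegral B P (h i) (W i)) :
    HasGaussianLaw (fun ω i => W i ω) P := by
  classical
  refine hasGaussianLaw_of_dual
    (aemeasurable_pi_lambda _ fun i => (hW i).memLp_two.1.aemeasurable) fun L => ?_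
  -- A linear functional of Wiener integrals is itself a Wiener integral, hence Gaussian.
  have h1 : (fun ω => L (fun i => W i ω)) = fun ω => ∑ i, L (Pi.single i 1) * W i ω := by
    ext ω
    conv_lhs => rw [pi_eq_sum_univ' (fun i => W i ω), map_sum]
    refine Finset.sum_congr rfl fun i _ => ?_
    rw [map_smul, smul_eq_mul, mul_comm]
  rw [h1]
  exact (linearCombination hB Finset.univ (fun i _ => hW i) _).hasGaussianLaw hB

/-- An almost sure limit of Wiener integrals is a Wiener integral. -/
lemma of_tendsto_ae [IsProbabilityMeasure P] (hB : IsBrownianMotion F B P)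
    {g : ℕ → ℝ≥0 → EuclideanSpace ℝ (Fin d)} {V : ℕ → Ω → ℝ}
    (hV : ∀ n, IsWienerIntegral B P (g n) (V n))
    (hlim : ∀ᵐ ω ∂P, Tendsto (fun n => V n ω) atTop (𝓝 (W ω))) :
    ∃ h, IsWienerIntegral B P h W := by
  choose a1 a2 a3 using fun n => (isWienerIntegral_iff hB).1 (hV n)
  set w : ℕ → Lp ℝ 2 P := fun n => (a2 n).toLp (V n) with hw
  -- Almost sure convergence makes these expectations tend to one by dominated convergence. As they
  -- equal `exp(-‖·‖²/2)` of the `L²` distances, the sequence is Cauchy in `L²`.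
  have e1 : ∀ q : ℕ × ℕ, ∫ ω, Complex.exp ((V q.1 ω - V q.2 ω : ℝ) * Complex.I) ∂P =
      (Real.exp (-(‖w q.1 - w q.2‖ ^ 2 / 2)) : ℂ) := by
    intro q
    have := integral_exp_of_mem_wienerGraph hB (sub_mem (a3 q.1) (a3 q.2)) 1
    simp only [Prod.snd_sub] at this
    have h2 : (Real.exp (-(‖w q.1 - w q.2‖ ^ 2 / 2)) : ℂ) =
      Complex.exp (-((‖w q.1 - w q.2‖₊ ^ 2 : ℝ≥0) * (1 : ℝ) ^ 2 / 2)) := by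
      push_cast
      simp
    rw [h2, ← this]
    refine integral_congr_ae ?_
    filter_upwards [(a2 q.1).coeFn_toLp, (a2 q.2).coeFn_toLp, Lp.coeFn_sub (w q.1) (w q.2)]
      with ω h1 h2 h3
    rw [h3, Pi.sub_apply, hw, h1, h2]
    simp
  have e2 : Tendsto (fun q : ℕ × ℕ => ∫ ω, Complex.exp ((V q.1 ω - V q.2 ω : ℝ) * Complex.I) ∂P)
      atTop (𝓝 (∫ _, (1 : ℂ) ∂P)) := by
    refine tendsto_integral_filter_of_dominated_convergence (fun _ => 1) ?_ ?_
      (integrable_const _) ?_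
    · refine Eventually.of_forall fun q => ?_
      exact (by fun_prop : Continuous fun x : ℝ =>
        Complex.exp (x * Complex.I)).comp_aestronglyMeasurable ((a2 q.1).1.sub (a2 q.2).1)
    · refine Eventually.of_forall fun q => Eventually.of_forall fun ω => ?_
      rw [Complex.norm_exp_ofReal_mul_I]
    · filter_upwards [hlim] with ω hω
      rw [← prod_atTop_atTop_eq]
      have h1 : Tendsto (fun q : ℕ × ℕ => V q.1 ω - V q.2 ω) (atTop ×ˢ atTop)
          (𝓝 (W ω - W ω)) :=
        (hω.comp tendsto_fst).sub (hω.comp tendsto_snd)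
      rw [sub_self] at h1
      have h2 := ((by fun_prop : Continuous fun x : ℝ =>
        Complex.exp (x * Complex.I)).tendsto 0).comp h1
      simpa [Function.comp_def] using h2
  have e3 : Tendsto (fun q : ℕ × ℕ => Real.exp (-(‖w q.1 - w q.2‖ ^ 2 / 2))) atTop (𝓝 1) := by
    have : Tendsto (fun q : ℕ × ℕ => Complex.re (Real.exp (-(‖w q.1 - w q.2‖ ^ 2 / 2)) : ℂ))
        atTop (𝓝 (Complex.re 1)) := by
      refine (Complex.continuous_re.tendsto 1).comp ?_
      simpa only [e1, integral_const, probReal_univ, one_smul] using e2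
    simpa only [Complex.ofReal_re, Complex.one_re] using this
  have e4 : CauchySeq w := by
    rw [cauchySeq_iff_tendsto_dist_atTop_0]
    have h1 := (Real.continuousAt_log one_ne_zero).tendsto.comp e3
    simp only [Function.comp_def, Real.log_exp, Real.log_one] at h1
    have h2 := ((h1.const_mul (-2)).sqrt)
    simp only [mul_zero, Real.sqrt_zero] at h2
    refine h2.congr fun q => ?_
    rw [dist_eq_norm, show -2 * -(‖w q.1 - w q.2‖ ^ 2 / 2) = ‖w q.1 - w q.2‖ ^ 2 by ring,
      Real.sqrt_sq (norm_nonneg _)]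
  obtain ⟨v, hv⟩ := cauchySeq_tendsto_of_complete e4
  have h5 : Tendsto (fun n => eLpNorm (V n - ⇑v) 2 P) atTop (𝓝 0) := by
    refine (Lp.tendsto_Lp_iff_tendsto_eLpNorm'' V a2 v (Lp.memLp v)).1 ?_
    rwa [Lp.toLp_coeFn]
  obtain ⟨h, hh⟩ := of_tendsto hB hV (Lp.memLp v) h5
  refine ⟨h, hh.congr_right ?_⟩
  -- The `L²` limit agrees with the almost sure limit along a subsequence.
  obtain ⟨ns, hns, hns'⟩ := (tendstoInMeasure_of_tendsto_eLpNorm two_ne_zero (fun n => (a2 n).1)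
    (Lp.aestronglyMeasurable v) h5).exists_seq_tendsto_ae
  filter_upwards [hlim, hns'] with ω h1 h2
  exact tendsto_nhds_unique h2 (h1.comp hns.tendsto_atTop)

end IsWienerIntegral

end WienerLaw

section Riemann

/-! ### Approximation of continuous functions by step functions -/

variable {E : Type*} [NormedAddCommGroup E]

/-- The point `k T / N` of the uniform grid of `[0, T]`. -/
def gridPoint (T : ℝ≥0) (N k : ℕ) : ℝ≥0 := k * T / N

lemma gridPoint_mono (T : ℝ≥0) (N : ℕ) : Monotone (gridPoint T N) := fun k l h => by
  unfold gridPoint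
  gcongr

lemma gridPoint_le {T : ℝ≥0} {N k : ℕ} (h : k ≤ N) : gridPoint T N k ≤ T := by
  rcases Nat.eq_zero_or_pos N with rfl | hN
  · simp [gridPoint]
  · refine (gridPoint_mono T N h).trans (le_of_eq ?_)
    have : (N : ℝ≥0) ≠ 0 := by exact_mod_cast hN.ne'
    rw [gridPoint]
    field_simp

/-- The step function with the values of `g` at the right end points of the grid intervals. -/
def gridStep (T : ℝ≥0) (g : ℝ≥0 → E) (N : ℕ) (t : ℝ≥0) : E :=
  ∑ k : Fin N, (Set.Ioc (gridPoint T N k) (gridPoint T N (k + 1))).indicator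
    (fun _ => g (gridPoint T N (k + 1))) t

lemma gridStep_of_notMem {T : ℝ≥0} (g : ℝ≥0 → E) (N : ℕ) {t : ℝ≥0} (ht : t ∉ Set.Ioc 0 T) :
    gridStep T g N t = 0 := by
  refine Finset.sum_eq_zero fun k _ => Set.indicator_of_notMem (fun h => ht ?_) _
  exact ⟨lt_of_le_of_lt (zero_le) h.1, h.2.trans (gridPoint_le k.2)⟩

lemma exists_gridStep_eq {T : ℝ≥0} (g : ℝ≥0 → E) {N : ℕ} (hN : 0 < N) {t : ℝ≥0}
    (ht : t ∈ Set.Ioc 0 T) :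
    ∃ s ≤ T, dist s t ≤ T / N ∧ gridStep T g N t = g s := by
  have hT : 0 < T := ht.1.trans_le ht.2
  have hN' : (0 : ℝ≥0) < N := by exact_mod_cast hN
  -- The cell containing `t` is `(jT/N, (j+1)T/N]` with `j + 1 = ⌈tN/T⌉`; the ceiling matches cells
  -- closed on the right.
  set k := ⌈t * N / T⌉₊ with hk
  have hk0 : 0 < k := Nat.ceil_pos.2 (by have := ht.1; positivity)
  obtain ⟨j, hj⟩ := Nat.exists_eq_succ_of_ne_zero hk0.ne'
  have hkN : k ≤ N := Nat.ceil_le.2 (by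
    rw [div_le_iff₀ hT, mul_comm]
    exact mul_le_mul_right ht.2 _)
  have hiff : ∀ i : ℕ, t ∈ Set.Ioc (gridPoint T N i) (gridPoint T N (i + 1)) ↔ i = j := by
    intro i
    have h1 : gridPoint T N i < t ↔ (i : ℝ≥0) < t * N / T := by
      rw [gridPoint, div_lt_iff₀ hN', lt_div_iff₀ hT]
    have h2 : t ≤ gridPoint T N (i + 1) ↔ t * N / T ≤ (i + 1 : ℕ) := by
      rw [gridPoint, le_div_iff₀ hN', div_le_iff₀ hT]
    rw [Set.mem_Ioc, h1, h2, ← Nat.ceil_le, ← Nat.lt_ceil, ← hk, hj]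
    omega
  refine ⟨gridPoint T N (j + 1), gridPoint_le (by omega), ?_, ?_⟩
  · obtain ⟨h1, h2⟩ := (hiff j).2 rfl
    have h3 : (gridPoint T N (j + 1) : ℝ) = gridPoint T N j + T / N := by
      simp only [gridPoint]
      push_cast
      ring
    rw [NNReal.dist_eq, abs_of_nonneg (by simpa using h2)]
    have h1' : (gridPoint T N j : ℝ) < t := h1
    linarith
  · rw [gridStep, Finset.sum_eq_single ⟨j, by omega⟩]
    · exact Set.indicator_of_mem ((hiff j).2 rfl) _
    · intro i _ hi
      refine Set.indicator_of_notMem (fun h => hi ?_) _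
      exact Fin.ext ((hiff i).1 h)
    · simp

lemma exists_norm_gridStep_sub_le {T : ℝ≥0} {g : ℝ≥0 → E} (hg : ContinuousOn g (Set.Icc 0 T))
    {ε : ℝ} (hε : 0 < ε) :
    ∀ᶠ N in atTop, ∀ t, ‖gridStep T g N t - (Set.Ioc 0 T).indicator g t‖ ≤
      (Set.Ioc 0 T).indicator (fun _ => ε) t := by
  have hu := isCompact_Icc.uniformContinuousOn_of_continuous hg
  obtain ⟨δ, hδ, hδ'⟩ := Metric.uniformContinuousOn_iff_le.1 hu ε hε
  have h1 : Tendsto (fun N : ℕ => (T : ℝ) / N) atTop (𝓝 0) :=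
    tendsto_const_div_atTop_nhds_zero_nat _
  filter_upwards [h1.eventually (gt_mem_nhds hδ), eventually_gt_atTop 0] with N hN hN0 t
  by_cases ht : t ∈ Set.Ioc 0 T
  · rw [Set.indicator_of_mem ht, Set.indicator_of_mem ht]
    obtain ⟨s, hs, hst, h⟩ := exists_gridStep_eq g hN0 ht
    rw [h, ← dist_eq_norm]
    exact hδ' s ⟨zero_le, hs⟩ t ⟨ht.1.le, ht.2⟩ (hst.trans hN.le)
  · rw [Set.indicator_of_notMem ht, Set.indicator_of_notMem ht, gridStep_of_notMem g N ht]
    simp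

lemma tendsto_eLpNorm_gridStep {T : ℝ≥0} {g : ℝ≥0 → E} (hg : ContinuousOn g (Set.Icc 0 T)) :
    Tendsto (fun N => eLpNorm (gridStep T g N - (Set.Ioc 0 T).indicator g) 2 timeMeasure) atTop
      (𝓝 0) := by
  set C : ℝ≥0∞ := timeMeasure (Set.Ioc 0 T) ^ (1 / (2 : ℝ≥0∞).toReal) with hC
  have hC' : C ≠ ∞ := by
    refine ENNReal.rpow_ne_top_of_nonneg (by positivity) ?_
    rw [timeMeasure_Ioc]
    exact ENNReal.ofReal_ne_top
  rw [ENNReal.tendsto_nhds_zero]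
  intro ε hε
  -- A uniform error `η` on `(0, T]` costs at most `η * C` in `L²`.
  obtain ⟨η, hη, hη'⟩ : ∃ η : ℝ, 0 < η ∧ ENNReal.ofReal η * C ≤ ε := by
    have h0 : Tendsto (fun x : ℝ => ENNReal.ofReal x * C) (𝓝[>] 0) (𝓝 0) := by
      have : Tendsto (fun x : ℝ => ENNReal.ofReal x * C) (𝓝 0) (𝓝 (ENNReal.ofReal 0 * C)) :=
        ENNReal.Tendsto.mul_const (ENNReal.continuous_ofReal.tendsto 0) (Or.inr hC')
      simpa using this.mono_left nhdsWithin_le_nhds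
    obtain ⟨x, hx, hx'⟩ := ((ENNReal.tendsto_nhds_zero.1 h0 ε hε).and self_mem_nhdsWithin).exists
    exact ⟨x, hx', hx⟩
  filter_upwards [exists_norm_gridStep_sub_le hg hη] with N hN
  refine le_trans ?_ hη'
  refine (eLpNorm_mono_real (g := (Set.Ioc 0 T).indicator (fun _ => η)) hN).trans ?_
  rw [eLpNorm_indicator_const measurableSet_Ioc two_ne_zero ENNReal.ofNat_ne_top,
    Real.enorm_eq_ofReal hη.le]

lemma integral_gridStep [NormedSpace ℝ E] [CompleteSpace E] (T : ℝ≥0) (g : ℝ≥0 → E) (N : ℕ) :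
    ∫ t, gridStep T g N t ∂timeMeasure =
      ∑ k : Fin N, ((gridPoint T N (k + 1) : ℝ) - gridPoint T N k) •
        g (gridPoint T N (k + 1)) := by
  have hfin : ∀ k, timeMeasure (Set.Ioc (gridPoint T N k) (gridPoint T N (k + 1))) ≠ ∞ := by
    intro k
    rw [timeMeasure_Ioc]
    exact ENNReal.ofReal_ne_top
  simp only [gridStep]
  have hint : ∀ k : Fin N, Integrable ((Set.Ioc (gridPoint T N k)
      (gridPoint T N (k + 1))).indicator (fun _ => g (gridPoint T N (k + 1)))) timeMeasure :=
    fun k => (integrable_indicator_iff measurableSet_Ioc).2 (integrableOn_const (hfin k))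
  refine (integral_finsetSum _ fun k _ => hint k).trans ?_
  refine Finset.sum_congr rfl fun k _ => ?_
  rw [integral_indicator_const _ measurableSet_Ioc,
    timeMeasure_real_Ioc (gridPoint_mono T N (Nat.le_succ _))]

/-- Convergence of Riemann sums. -/
lemma tendsto_riemannSum [NormedSpace ℝ E] [CompleteSpace E] {T : ℝ≥0} {g : ℝ≥0 → E}
    (hg : ContinuousOn g (Set.Icc 0 T)) :
    Tendsto (fun N => ∑ k : Fin N, ((gridPoint T N (k + 1) : ℝ) - gridPoint T N k) •
        g (gridPoint T N (k + 1))) atTop (𝓝 (∫ t in Set.Ioc 0 T, g t ∂timeMeasure)) := by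
  simp_rw [← integral_gridStep]
  rw [← integral_indicator measurableSet_Ioc]
  obtain ⟨C, hC⟩ := isCompact_Icc.exists_bound_of_continuousOn hg
  refine tendsto_integral_filter_of_dominated_convergence
    ((Set.Ioc 0 T).indicator fun _ => C + 1) ?_ ?_ ?_ ?_
  · refine Eventually.of_forall fun N => ?_
    refine Finset.aestronglyMeasurable_fun_sum _ fun k _ => ?_
    exact aestronglyMeasurable_const.indicator measurableSet_Ioc
  · filter_upwards [exists_norm_gridStep_sub_le hg one_pos] with N hN
    refine Eventually.of_forall fun t => ?_
    have h1 := norm_le_norm_add_norm_sub' (gridStep T g N t) ((Set.Ioc 0 T).indicator g t)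
    refine (h1.trans (add_le_add le_rfl (hN t))).trans ?_
    by_cases ht : t ∈ Set.Ioc 0 T
    · simpa [Set.indicator, ht, -Set.mem_Ioc] using hC t (Set.Ioc_subset_Icc_self ht)
    · simp [Set.indicator, ht, -Set.mem_Ioc]
  · refine (integrable_indicator_iff measurableSet_Ioc).2 (integrableOn_const ?_)
    rw [timeMeasure_Ioc]
    exact ENNReal.ofReal_ne_top
  · refine Eventually.of_forall fun t => ?_
    rw [Metric.tendsto_nhds]
    intro ε hε
    filter_upwards [exists_norm_gridStep_sub_le hg (half_pos hε)] with N hN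
    rw [dist_eq_norm]
    refine (hN t).trans_lt (lt_of_le_of_lt (Set.indicator_le_self' ?_ t) (half_lt_self hε))
    exact fun _ _ => by positivity

end Riemann

/-! ### Existence of Wiener integrals and their time integrals -/

section WienerExistence

variable {Ω : Type*} {mΩ : MeasurableSpace Ω} {d : ℕ} {P : Measure Ω}
  {F : Filtration ℝ≥0 mΩ} {B : Fin d → ℝ≥0 → Ω → ℝ}

/-- The step function of `gridStep`. -/
def gridStepFunction (T : ℝ≥0) (g : ℝ≥0 → EuclideanSpace ℝ (Fin d)) (N : ℕ) :
    StepFunction d where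
  n := N
  left k := gridPoint T N k
  right k := gridPoint T N (k + 1)
  left_le_right _ := gridPoint_mono T N (Nat.le_succ _)
  coef k := g (gridPoint T N (k + 1))

/-- The grid cells are open on the left and miss the time `0`, which is a null point. -/
lemma Ioc_indicator_ae_eq (T : ℝ≥0) {E : Type*} [Zero E] (g : ℝ≥0 → E) :
    (Set.Ioc 0 T).indicator g =ᵐ[timeMeasure] (Set.Icc 0 T).indicator g := by
  have h0 : timeMeasure {0} = 0 := by
    rw [timeMeasure, measurableEmbedding_nnreal_coe.comap_apply]
    simp
  filter_upwards [measure_eq_zero_iff_ae_notMem.1 h0] with t ht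
  have ht' : 0 < t := pos_iff_ne_zero.2 ht
  simp [Set.indicator, ht']

/-- Functions which are continuous on `[0, T]` have a Wiener integral over `[0, T]`. -/
lemma exists_isWienerIntegral_indicator [IsProbabilityMeasure P] (hB : IsBrownianMotion F B P)
    {T : ℝ≥0} {g : ℝ≥0 → EuclideanSpace ℝ (Fin d)} (hg : ContinuousOn g (Set.Icc 0 T)) :
    ∃ W, IsWienerIntegral B P ((Set.Icc 0 T).indicator g) W := by
  have h1 := tendsto_eLpNorm_gridStep hg
  have hm : ∀ N, MemLp (gridStep T g N) 2 timeMeasure := fun N =>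
    (gridStepFunction T g N).memLp_toFunction
  have hgm : AEStronglyMeasurable ((Set.Ioc 0 T).indicator g) timeMeasure := by
    rw [aestronglyMeasurable_indicator_iff measurableSet_Ioc]
    exact (hg.mono Set.Ioc_subset_Icc_self).aestronglyMeasurable measurableSet_Ioc
  obtain ⟨N, hN⟩ := (h1.eventually (gt_mem_nhds zero_lt_one)).exists
  -- Square integrability follows from being at finite `L²` distance from a step function.
  have h2 : MemLp ((Set.Ioc 0 T).indicator g) 2 timeMeasure := by
    have h3 : MemLp (gridStep T g N - (Set.Ioc 0 T).indicator g) 2 timeMeasure :=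
      ⟨(hm N).1.sub hgm, hN.trans ENNReal.one_lt_top⟩
    have h4 := (hm N).sub h3
    simpa using h4
  obtain ⟨W, hW⟩ := IsWienerIntegral.exists_of_tendsto hB
    (fun N => IsWienerIntegral.step hB (gridStepFunction T g N)) h2 h1
  exact ⟨W, hW.congr (Ioc_indicator_ae_eq T g) (ae_eq_refl _)⟩

/-- The pathwise time integral of a family of Wiener integrals is a Wiener integral. -/
lemma exists_isWienerIntegral_integral [IsProbabilityMeasure P] (hB : IsBrownianMotion F B P)
    {T : ℝ≥0} {ι : Type*} [Fintype ι] {N : ι → ℝ≥0 → Ω → ℝ}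
    (hN : ∀ i, ∀ t ≤ T, ∃ h, IsWienerIntegral B P h (N i t))
    {c : ι → ℝ≥0 → ℝ} (hc : ∀ i, ContinuousOn (c i) (Set.Icc 0 T))
    (hcont : ∀ i, ∀ᵐ ω ∂P, ContinuousOn (fun t => N i t ω) (Set.Icc 0 T)) :
    ∃ h, IsWienerIntegral B P h
      (fun ω => ∫ t in Set.Icc 0 T, ∑ i, c i t * N i t ω ∂timeMeasure) := by
  classical
  choose! h hh using hN
  have hV : ∀ n : ℕ, IsWienerIntegral B P
      (fun t => ∑ k : Fin n, ((gridPoint T n (k + 1) : ℝ) - gridPoint T n k) •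
        ∑ i, c i (gridPoint T n (k + 1)) • h i (gridPoint T n (k + 1)) t)
      (fun ω => ∑ k : Fin n, ((gridPoint T n (k + 1) : ℝ) - gridPoint T n k) *
        ∑ i, c i (gridPoint T n (k + 1)) * N i (gridPoint T n (k + 1)) ω) := fun n =>
    IsWienerIntegral.linearCombination hB Finset.univ (fun k _ =>
      IsWienerIntegral.linearCombination hB Finset.univ
        (fun i _ => hh i _ (gridPoint_le k.2)) _) _
  -- The Riemann sums converge path by path, by continuity alone; no moment bound on the supremum of
  -- a path is needed.
  refine IsWienerIntegral.of_tendsto_ae hB hV ?_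
  filter_upwards [ae_all_iff.2 hcont] with ω hω
  have h1 := tendsto_riemannSum (T := T) (g := fun t => ∑ i, c i t * N i t ω)
    (continuousOn_finsetSum _ fun i _ => (hc i).mul (hω i))
  simp only [smul_eq_mul] at h1
  convert h1 using 2
  rw [← integral_indicator measurableSet_Icc, ← integral_indicator measurableSet_Ioc]
  exact integral_congr_ae (Ioc_indicator_ae_eq T _).symm

end WienerExistence

lemma integrable_inner_of_memLp {α H : Type*} {mα : MeasurableSpace α} {μ : Measure α}
    [NormedAddCommGroup H] [InnerProductSpace ℝ H] {f g : α → H} (hf : MemLp f 2 μ)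
    (hg : MemLp g 2 μ) : Integrable (fun x => inner ℝ (f x) (g x)) μ := by
  refine (hf.norm.integrable_mul hg.norm).mono (hf.1.inner hg.1) (Eventually.of_forall fun x => ?_)
  refine (norm_inner_le_norm _ _).trans (le_of_eq ?_)
  simp

/-! ### Temperate growth and Stein's identity -/

section Growth

variable {E G : Type*} [NormedAddCommGroup E] [NormedSpace ℝ E] [NormedAddCommGroup G]
  [NormedSpace ℝ G]

lemma Function.HasTemperateGrowth.fderiv_apply {f : E → G} (hf : f.HasTemperateGrowth) (v : E) :
    Function.HasTemperateGrowth (fun x => fderiv ℝ f x v) := by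
  have h1 : Function.HasTemperateGrowth (fderiv ℝ f) := by
    refine ⟨hf.1.fderiv_right (by simp), fun n => ?_⟩
    obtain ⟨k, C, h⟩ := hf.2 (n + 1)
    exact ⟨k, C, fun x => by rw [norm_iteratedFDeriv_fderiv]; exact h x⟩
  exact (ContinuousLinearMap.apply ℝ G v).hasTemperateGrowth.comp h1

lemma Function.HasTemperateGrowth.deriv {f : ℝ → G} (hf : f.HasTemperateGrowth) :
    Function.HasTemperateGrowth (_root_.deriv f) :=
  hf.fderiv_apply 1

lemma ProbabilityTheory.HasGaussianLaw.memLp_comp_hasTemperateGrowth {Ω : Type*}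
    {mΩ : MeasurableSpace Ω} {P : Measure Ω} [MeasurableSpace E] [BorelSpace E] [CompleteSpace E]
    [SecondCountableTopology E] {Y : Ω → E} (hY : HasGaussianLaw Y P) {f : E → G}
    (hf : f.HasTemperateGrowth) {p : ℝ≥0∞} (hp : p ≠ ∞) : MemLp (fun ω => f (Y ω)) p P := by
  have := hY.isProbabilityMeasure
  obtain ⟨k, C, h⟩ := hf.2 0
  simp only [norm_iteratedFDeriv_zero] at h
  have hk : MemLp (fun ω => (1 + ‖Y ω‖) ^ k) p P := by
    rcases Nat.eq_zero_or_pos k with rfl | hk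
    · simpa using memLp_const (μ := P) (p := p) (1 : ℝ)
    · have h1 : MemLp (fun ω => 1 + ‖Y ω‖) (p * k) P :=
        (memLp_const (1 : ℝ)).add (hY.memLp (ENNReal.mul_ne_top hp (by simp))).norm
      have h2 := h1.norm_rpow_div k
      rw [ENNReal.mul_div_cancel_right (by exact_mod_cast hk.ne') (by simp)] at h2
      refine h2.ae_eq (Eventually.of_forall fun ω => ?_)
      simp only [ENNReal.toReal_natCast, Real.rpow_natCast]
      rw [Real.norm_of_nonneg (by positivity)]
  refine (hk.const_mul C).mono
    (hf.1.continuous.comp_aestronglyMeasurable hY.aemeasurable.aestronglyMeasurable)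
    (Eventually.of_forall fun ω => (h (Y ω)).trans (le_abs_self _))

/-- Stein's identity. -/
lemma integral_mul_gaussianReal {φ : ℝ → ℝ} (hφ : φ.HasTemperateGrowth) (v : ℝ≥0) :
    ∫ x, φ x * x ∂gaussianReal 0 v = v * ∫ x, deriv φ x ∂gaussianReal 0 v := by
  -- The degenerate Gaussian is a Dirac mass at `0` without a density; both sides vanish.
  rcases eq_or_ne v 0 with rfl | hv
  · simp
  have hv' : (v : ℝ) ≠ 0 := by exact_mod_cast hv
  have hint : ∀ {ψ : ℝ → ℝ}, ψ.HasTemperateGrowth →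
      Integrable (fun x => ψ x * gaussianPDFReal 0 v x) := by
    intro ψ hψ
    have h1 : Integrable ψ (gaussianReal 0 v) :=
      ((IsGaussian.hasGaussianLaw_id (μ := gaussianReal 0 v)).memLp_comp_hasTemperateGrowth
        hψ (p := 1) (by simp)).integrable le_rfl
    rw [gaussianReal_of_var_ne_zero _ hv, integrable_withDensity_iff_integrable_smul'
      (measurable_gaussianPDF 0 v) (Eventually.of_forall fun x => ENNReal.ofReal_lt_top)] at h1
    refine h1.congr (Eventually.of_forall fun x => ?_)
    simp only [toReal_gaussianPDF, smul_eq_mul, mul_comm]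
  -- The density satisfies `p' = -(x/v) p`, so the identity is integration by parts on the line.
  have hd : ∀ x, HasDerivAt (gaussianPDFReal 0 v) (-(x * gaussianPDFReal 0 v x) / v) x := by
    intro x
    rw [gaussianPDFReal_def]
    have h1 : HasDerivAt (fun x : ℝ => -(x - 0) ^ 2 / (2 * v)) ((2 * -x) / (2 * v)) x := by
      have := (((hasDerivAt_id x).sub_const 0).pow 2).neg.div_const (2 * v : ℝ)
      simpa using this
    refine (h1.exp.const_mul (√(2 * Real.pi * v))⁻¹).congr_deriv ?_
    rw [mul_div_mul_left _ _ two_ne_zero]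
    ring
  have hφd : ∀ x, HasDerivAt φ (deriv φ x) x := fun x =>
    (hφ.1.differentiable (by simp)).differentiableAt.hasDerivAt
  have hid : Function.HasTemperateGrowth (fun x : ℝ => x) := .id'
  have i1 : Integrable (fun x => φ x * x * gaussianPDFReal 0 v x) := hint (hφ.mul hid)
  have i1' : Integrable (φ * fun x => -(x * gaussianPDFReal 0 v x) / v) := by
    refine (i1.const_mul (-(v : ℝ)⁻¹)).congr (Eventually.of_forall fun x => ?_)
    simp only [Pi.mul_apply]
    ring
  have key := integral_mul_deriv_eq_deriv_mul_of_integrable (u := φ) (v := gaussianPDFReal 0 v)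
    (fun x _ => hφd x) (fun x _ => hd x) i1' (hint hφ.deriv) (hint hφ)
  rw [integral_gaussianReal_eq_integral_smul hv, integral_gaussianReal_eq_integral_smul hv]
  simp only [smul_eq_mul]
  have e1 : ∫ x, gaussianPDFReal 0 v x * deriv φ x = ∫ x, deriv φ x * gaussianPDFReal 0 v x := by
    simp only [mul_comm]
  rw [e1, ← neg_eq_iff_eq_neg.2 key, ← integral_neg, ← integral_const_mul]
  congr 1
  ext x
  field_simp

end Growth

/-! ### Gaussian integration by parts -/

section IBP

variable {Ω : Type*} {mΩ : MeasurableSpace Ω} {d : ℕ} {P : Measure Ω}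
  {F : Filtration ℝ≥0 mΩ} {B : Fin d → ℝ≥0 → Ω → ℝ}

/-- Gaussian integration by parts for Wiener integrals. -/
lemma integral_comp_mul_wienerIntegral [IsProbabilityMeasure P] (hB : IsBrownianMotion F B P)
    {ι : Type*} [Fintype ι] [DecidableEq ι] {h : ι → ℝ≥0 → EuclideanSpace ℝ (Fin d)}
    {W : ι → Ω → ℝ}
    (hW : ∀ i, IsWienerIntegral B P (h i) (W i)) {g : ℝ≥0 → EuclideanSpace ℝ (Fin d)}
    {V : Ω → ℝ} (hV : IsWienerIntegral B P g V) {f : (ι → ℝ) → ℝ} (hf : f.HasTemperateGrowth) :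
    ∫ ω, f (fun i => W i ω) * V ω ∂P = ∑ i, (∫ ω, fderiv ℝ f (fun i => W i ω) (Pi.single i 1) ∂P) *
      ∫ t, inner ℝ (h i t) (g t) ∂timeMeasure := by
  set v : ℝ≥0 := (∫ t, ‖g t‖ ^ 2 ∂timeMeasure).toNNReal with hv
  have hv1 : (v : ℝ) = ∫ t, ‖g t‖ ^ 2 ∂timeMeasure := Real.coe_toNNReal _ (by positivity)
  have hlawV : P.map V = gaussianReal 0 v := hV.map_eq_gaussianReal hB
  set a : ι → ℝ := fun i => ∫ t, inner ℝ (h i t) (g t) ∂timeMeasure with ha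
  -- Regression coefficients of `W i` on `V`, chosen so that the residuals `W i - c i * V` are
  -- uncorrelated with `V`. If `v = 0` then `g` vanishes almost everywhere, so `a i = 0` and the
  -- division by zero is harmless.
  set c : ι → ℝ := fun i => a i / v with hc
  have hca : ∀ i, v * c i = a i := by
    intro i
    rcases eq_or_ne v 0 with h0 | h0
    · have h1 : eLpNorm g 2 timeMeasure = 0 := by
        rw [eLpNorm_two_eq_ofReal_sqrt hV.memLp_integrand, ← hv1, h0]
        simp
      have h2 := (eLpNorm_eq_zero_iff hV.memLp_integrand.1 two_ne_zero).1 h1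
      have h3 : a i = 0 := by
        rw [ha]
        refine integral_eq_zero_of_ae ?_
        filter_upwards [h2] with t ht
        rw [ht]
        simp
      rw [h3, h0]
      simp
    · have : (v : ℝ) ≠ 0 := by exact_mod_cast h0
      simp only [hc]
      field_simp
  set R : ι → Ω → ℝ := fun i ω => W i ω - c i * V ω with hR
  have hRW : ∀ i, IsWienerIntegral B P (fun t => h i t - c i • g t) (R i) := fun i =>
    (hW i).sub hB (hV.const_smul hB (c i))
  have hRG := IsWienerIntegral.hasGaussianLaw_pi hB hRW
  have hVG := hV.hasGaussianLaw hB
  have hWG := IsWienerIntegral.hasGaussianLaw_pi hB hW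
  have hind : IndepFun (fun ω i => R i ω) V P := by
    -- For jointly Gaussian families zero covariance gives independence; `V` is viewed as a family
    -- over `Unit` to fit that criterion.
    have hjoint : HasGaussianLaw (fun ω => ((fun i => R i ω), fun _ : Unit => V ω)) P := by
      have h1 := IsWienerIntegral.hasGaussianLaw_pi hB (ι := ι ⊕ Unit)
        (h := Sum.elim (fun i t => h i t - c i • g t) (fun _ => g)) (W := Sum.elim R (fun _ => V))
        (by rintro (i | i); exacts [hRW i, hV])
      let L : (ι ⊕ Unit → ℝ) →L[ℝ] (ι → ℝ) × (Unit → ℝ) := ContinuousLinearMap.prod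
        (ContinuousLinearMap.pi fun i => ContinuousLinearMap.proj (Sum.inl i))
        (ContinuousLinearMap.pi fun _ => ContinuousLinearMap.proj (Sum.inr ()))
      exact h1.map_fun L
    have h2 := hjoint.indepFun_of_covariance_eval (fun i _ => ?_)
    · exact h2.comp (φ := id) (ψ := fun x : Unit → ℝ => x ()) measurable_id (by fun_prop)
    · rw [covariance_eq_sub (hRW i).memLp_two hV.memLp_two, (hRW i).integral_eq_zero hB, zero_mul,
        sub_zero]
      have h3 := (hRW i).integral_mul hB hV
      refine h3.trans ?_
      have i1 : Integrable (fun t => inner ℝ (h i t) (g t)) timeMeasure :=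
        integrable_inner_of_memLp (hW i).memLp_integrand hV.memLp_integrand
      have i2 : Integrable (fun t => inner ℝ (g t) (g t)) timeMeasure :=
        integrable_inner_of_memLp hV.memLp_integrand hV.memLp_integrand
      simp only [inner_sub_left, real_inner_smul_left]
      rw [integral_sub i1 (i2.const_mul _), integral_const_mul]
      simp only [real_inner_self_eq_norm_sq]
      rw [← hv1, mul_comm, hca]
      simp [ha]
  have hmap : P.map (fun ω => ((fun i => R i ω), V ω)) =
      (P.map (fun ω i => R i ω)).prod (gaussianReal 0 v) := by
    rw [← hlawV]
    exact (indepFun_iff_map_prod_eq_prod_map_map hRG.aemeasurable hVG.aemeasurable).1 hind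
  have hmeas : AEMeasurable (fun ω => ((fun i => R i ω), V ω)) P :=
    hRG.aemeasurable.prodMk hVG.aemeasurable
  have hWR : ∀ ω, (fun i => W i ω) = (fun i => R i ω) + V ω • c := by
    intro ω
    ext i
    simp [hR, mul_comm]
  have : IsProbabilityMeasure (P.map (fun ω i => R i ω)) :=
    Measure.isProbabilityMeasure_map hRG.aemeasurable
  -- By independence the expectation becomes an iterated integral, with the residuals frozen while
  -- `V` is integrated out.
  have htrans : ∀ (ψ : (ι → ℝ) → ℝ → ℝ), Continuous (fun q : (ι → ℝ) × ℝ => ψ q.1 q.2) →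
      Integrable (fun ω => ψ (fun i => R i ω) (V ω)) P →
      ∫ ω, ψ (fun i => R i ω) (V ω) ∂P =
        ∫ r, ∫ x, ψ r x ∂gaussianReal 0 v ∂(P.map (fun ω i => R i ω)) := by
    intro ψ hψ hi
    have h1 : ∫ ω, ψ (fun i => R i ω) (V ω) ∂P =
        ∫ q, ψ q.1 q.2 ∂(P.map (fun ω => ((fun i => R i ω), V ω))) :=
      (integral_map hmeas (f := fun q : (ι → ℝ) × ℝ => ψ q.1 q.2) hψ.aestronglyMeasurable).symm
    have h2 : Integrable (fun q : (ι → ℝ) × ℝ => ψ q.1 q.2)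
        (P.map (fun ω => ((fun i => R i ω), V ω))) :=
      (integrable_map_measure hψ.aestronglyMeasurable hmeas).2 hi
    rw [hmap] at h1 h2
    rw [h1, integral_prod _ h2]
  have hfderiv : ∀ i, Function.HasTemperateGrowth (fun x => fderiv ℝ f x (Pi.single i 1)) :=
    fun i => hf.fderiv_apply _
  have hfd : Function.HasTemperateGrowth (fun x => fderiv ℝ f x c) := hf.fderiv_apply _
  have i1 : Integrable (fun ω => f (fun i => W i ω) * V ω) P :=
    (hWG.memLp_comp_hasTemperateGrowth hf (p := 2) (by simp)).integrable_mul hV.memLp_two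
  have i2 : Integrable (fun ω => fderiv ℝ f (fun i => W i ω) c) P :=
    (hWG.memLp_comp_hasTemperateGrowth hfd (p := 1) (by simp)).integrable le_rfl
  have i3 : ∀ i, Integrable (fun ω => fderiv ℝ f (fun i => W i ω) (Pi.single i 1)) P := fun i =>
    (hWG.memLp_comp_hasTemperateGrowth (hfderiv i) (p := 1) (by simp)).integrable le_rfl
  have e1 : ∫ ω, f (fun i => W i ω) * V ω ∂P =
      ∫ r, ∫ x, f (r + x • c) * x ∂gaussianReal 0 v ∂(P.map (fun ω i => R i ω)) := by
    have hcont : Continuous f := hf.1.continuous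
    simp only [hWR] at i1 ⊢
    exact htrans (fun r x => f (r + x • c) * x) (by fun_prop) i1
  have e2 : ∫ ω, fderiv ℝ f (fun i => W i ω) c ∂P =
      ∫ r, ∫ x, fderiv ℝ f (r + x • c) c ∂gaussianReal 0 v ∂(P.map (fun ω i => R i ω)) := by
    have hcont : Continuous (fun x => fderiv ℝ f x c) := hfd.1.continuous
    simp only [hWR] at i2 ⊢
    exact htrans (fun r x => fderiv ℝ f (r + x • c) c) (by fun_prop) i2
  -- Stein's identity in one variable, along the line through `r` in direction `c`.
  have e3 : ∀ r : ι → ℝ, ∫ x, f (r + x • c) * x ∂gaussianReal 0 v =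
      v * ∫ x, fderiv ℝ f (r + x • c) c ∂gaussianReal 0 v := by
    intro r
    have hg : Function.HasTemperateGrowth (fun x : ℝ => f (r + x • c)) := by
      have : Function.HasTemperateGrowth (fun x : ℝ => r + x • c) :=
        (Function.HasTemperateGrowth.const r).add
          (ContinuousLinearMap.toSpanSingleton ℝ c).hasTemperateGrowth
      exact hf.comp this
    rw [integral_mul_gaussianReal hg]
    congr 2
    ext x
    have h1 : HasFDerivAt f (fderiv ℝ f (r + x • c)) (r + x • c) :=
      (hf.1.differentiable (by simp)).differentiableAt.hasFDerivAt
    have h2 : HasDerivAt (fun x : ℝ => r + x • c) c x := by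
      simpa using ((hasDerivAt_id x).smul_const c).const_add r
    exact (h1.comp_hasDerivAt x h2).deriv
  have e4 : ∀ x, fderiv ℝ f x c = ∑ i, c i * fderiv ℝ f x (Pi.single i 1) := by
    intro x
    conv_lhs => rw [pi_eq_sum_univ' c, map_sum]
    refine Finset.sum_congr rfl fun i _ => ?_
    rw [map_smul, smul_eq_mul]
  rw [e1]
  simp_rw [e3]
  rw [integral_const_mul, ← e2]
  simp_rw [e4]
  rw [integral_finsetSum _ fun i _ => (i3 i).const_mul _, Finset.mul_sum]
  refine Finset.sum_congr rfl fun i _ => ?_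
  rw [integral_const_mul, ← mul_assoc, hca, mul_comm]

end IBP

/-! ### Passing to limits in `L²` pairings -/

section L2Limits

variable {α H : Type*} {mα : MeasurableSpace α} {μ : Measure α} [NormedAddCommGroup H]
  [InnerProductSpace ℝ H]

lemma tendsto_integral_inner {f : ℕ → α → H} {f' g : α → H} (hf : ∀ n, MemLp (f n) 2 μ)
    (hf' : MemLp f' 2 μ) (hg : MemLp g 2 μ)
    (h : Tendsto (fun n => eLpNorm (fun x => f n x - f' x) 2 μ) atTop (𝓝 0)) :
    Tendsto (fun n => ∫ x, inner ℝ (f n x) (g x) ∂μ) atTop (𝓝 (∫ x, inner ℝ (f' x) (g x) ∂μ)) := by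
  have key : ∀ {k : α → H} (hk : MemLp k 2 μ),
      ∫ x, inner ℝ (k x) (g x) ∂μ = inner ℝ (hk.toLp k) (hg.toLp g) := by
    intro k hk
    rw [L2.inner_def]
    refine integral_congr_ae ?_
    filter_upwards [hk.coeFn_toLp, hg.coeFn_toLp] with x h1 h2
    rw [h1, h2]
  simp_rw [fun n => key (hf n), key hf']
  have h1 := (Lp.tendsto_Lp_iff_tendsto_eLpNorm'' f hf f' hf').2 h
  exact h1.inner tendsto_const_nhds

lemma tendsto_integral_mul {f : ℕ → α → ℝ} {f' g : α → ℝ} (hf : ∀ n, MemLp (f n) 2 μ)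
    (hf' : MemLp f' 2 μ) (hg : MemLp g 2 μ)
    (h : Tendsto (fun n => eLpNorm (fun x => f n x - f' x) 2 μ) atTop (𝓝 0)) :
    Tendsto (fun n => ∫ x, f n x * g x ∂μ) atTop (𝓝 (∫ x, f' x * g x ∂μ)) := by
  simpa [mul_comm] using tendsto_integral_inner hf hf' hg h

lemma integrable_mul_of_memLp {f g : α → ℝ} (hf : MemLp f 2 μ) (hg : MemLp g 2 μ) :
    Integrable (fun x => f x * g x) μ := hf.integrable_mul hg

lemma MeasureTheory.MemLp.smul_prod {β : Type*} {mβ : MeasurableSpace β} {ν : Measure β}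
    [SFinite μ] [SFinite ν] {f : β → ℝ} {g : α → H} (hf : MemLp f 2 ν) (hg : MemLp g 2 μ) :
    MemLp (fun p : α × β => f p.2 • g p.1) 2 (μ.prod ν) := by
  refine (memLp_two_iff_integrable_sq_norm (hf.1.comp_snd.smul hg.1.comp_fst)).2 ?_
  have h1 := (hg.integrable_norm_pow two_ne_zero).mul_prod (hf.integrable_norm_pow two_ne_zero)
  refine h1.congr (Eventually.of_forall fun p => ?_)
  change _ = ‖f p.2 • g p.1‖ ^ 2
  rw [norm_smul]
  ring

end L2Limits

/-! ### The Malliavin derivative: duality, closability, first chaos -/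

section Malliavin

variable {Ω : Type*} {mΩ : MeasurableSpace Ω} {d : ℕ} {P : Measure Ω}
  {F : Filtration ℝ≥0 mΩ} {B : Fin d → ℝ≥0 → Ω → ℝ}

namespace SmoothFunctional

/-- The partial derivative of a smooth functional. -/
def partialDeriv (S : SmoothFunctional B P) (i : Fin S.n) : SmoothFunctional B P where
  n := S.n
  h := S.h
  W := S.W
  isWienerIntegral := S.isWienerIntegral
  f x := fderiv ℝ S.f x (Pi.single i 1)
  growth := S.growth.fderiv_apply _

lemma deriv_eq (S : SmoothFunctional B P) (t : ℝ≥0) (ω : Ω) :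
    S.deriv t ω = ∑ i, (S.partialDeriv i).toFun ω • S.h i t := rfl

lemma integral_inner_deriv (S : SmoothFunctional B P) {g : ℝ≥0 → EuclideanSpace ℝ (Fin d)}
    (hg : MemLp g 2 timeMeasure) (ω : Ω) :
    ∫ t, inner ℝ (S.deriv t ω) (g t) ∂timeMeasure =
      ∑ i, (S.partialDeriv i).toFun ω * ∫ t, inner ℝ (S.h i t) (g t) ∂timeMeasure := by
  simp_rw [deriv_eq, sum_inner, real_inner_smul_left]
  rw [integral_finsetSum _ fun i _ =>
    (integrable_inner_of_memLp (S.isWienerIntegral i).memLp_integrand hg).const_mul _]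
  simp_rw [integral_const_mul]

end SmoothFunctional

lemma IsMalliavinDerivative.congr_left {G G' : Ω → ℝ}
    {D : ℝ≥0 → Ω → EuclideanSpace ℝ (Fin d)} (h : IsMalliavinDerivative B P G D)
    (hG : G =ᵐ[P] G') : IsMalliavinDerivative B P G' D := by
  obtain ⟨h1, h2, S, h3, h4⟩ := h
  refine ⟨h1.ae_eq hG, h2, S, h3.congr fun n => eLpNorm_congr_ae ?_, h4⟩
  filter_upwards [hG] with ω hω
  rw [hω]

variable [IsProbabilityMeasure P]

namespace SmoothFunctional

lemma hasGaussianLaw (hB : IsBrownianMotion F B P) (S : SmoothFunctional B P) :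
    HasGaussianLaw (fun ω i => S.W i ω) P :=
  IsWienerIntegral.hasGaussianLaw_pi hB S.isWienerIntegral

lemma memLp_toFun (hB : IsBrownianMotion F B P) (S : SmoothFunctional B P) {p : ℝ≥0∞}
    (hp : p ≠ ∞) : MemLp S.toFun p P :=
  (S.hasGaussianLaw hB).memLp_comp_hasTemperateGrowth S.growth hp

lemma memLp_deriv (hB : IsBrownianMotion F B P) (S : SmoothFunctional B P) :
    MemLp (fun p : ℝ≥0 × Ω => S.deriv p.1 p.2) 2 (timeMeasure.prod P) :=
  memLp_finsetSum _ fun i _ =>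
    ((S.partialDeriv i).memLp_toFun hB (p := 2) (by simp)).smul_prod
      (S.isWienerIntegral i).memLp_integrand

lemma memLp_integral_inner_deriv (hB : IsBrownianMotion F B P) (S : SmoothFunctional B P)
    {g : ℝ≥0 → EuclideanSpace ℝ (Fin d)} (hg : MemLp g 2 timeMeasure) {p : ℝ≥0∞} (hp : p ≠ ∞) :
    MemLp (fun ω => ∫ t, inner ℝ (S.deriv t ω) (g t) ∂timeMeasure) p P := by
  simp_rw [S.integral_inner_deriv hg]
  exact memLp_finsetSum _ fun i _ => ((S.partialDeriv i).memLp_toFun hB hp).mul_const _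

/-- Integration by parts for a product of smooth functionals. -/
lemma integral_mul_mul_wienerIntegral (hB : IsBrownianMotion F B P) (S S' : SmoothFunctional B P)
    {g : ℝ≥0 → EuclideanSpace ℝ (Fin d)} {V : Ω → ℝ} (hV : IsWienerIntegral B P g V) :
    ∫ ω, S.toFun ω * S'.toFun ω * V ω ∂P =
      ∫ ω, S'.toFun ω * ∫ t, inner ℝ (S.deriv t ω) (g t) ∂timeMeasure ∂P +
      ∫ ω, S.toFun ω * ∫ t, inner ℝ (S'.deriv t ω) (g t) ∂timeMeasure ∂P := by
  -- The product is a function of the concatenated family of Wiener integrals; `L` and `R` recover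
  -- the two blocks, and the product rule separates the partial derivatives accordingly.
  let L : (Fin S.n ⊕ Fin S'.n → ℝ) →L[ℝ] (Fin S.n → ℝ) :=
    ContinuousLinearMap.pi fun i => ContinuousLinearMap.proj (Sum.inl i)
  let R : (Fin S.n ⊕ Fin S'.n → ℝ) →L[ℝ] (Fin S'.n → ℝ) :=
    ContinuousLinearMap.pi fun i => ContinuousLinearMap.proj (Sum.inr i)
  have hgrowth : Function.HasTemperateGrowth (fun x => S.f (L x) * S'.f (R x)) :=
    (S.growth.comp L.hasTemperateGrowth).mul (S'.growth.comp R.hasTemperateGrowth)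
  have hfd : ∀ x, HasFDerivAt (fun x => S.f (L x) * S'.f (R x))
      (S.f (L x) • (fderiv ℝ S'.f (R x)).comp R + S'.f (R x) • (fderiv ℝ S.f (L x)).comp L) x := by
    intro x
    have h1 : HasFDerivAt (fun x => S.f (L x)) ((fderiv ℝ S.f (L x)).comp L) x :=
      (S.growth.1.differentiable (by simp)).differentiableAt.hasFDerivAt.comp x L.hasFDerivAt
    have h2 : HasFDerivAt (fun x => S'.f (R x)) ((fderiv ℝ S'.f (R x)).comp R) x :=
      (S'.growth.1.differentiable (by simp)).differentiableAt.hasFDerivAt.comp x R.hasFDerivAt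
    exact h1.mul h2
  have key := integral_comp_mul_wienerIntegral hB (ι := Fin S.n ⊕ Fin S'.n)
    (h := Sum.elim S.h S'.h) (W := Sum.elim S.W S'.W)
    (by rintro (i | i); exacts [S.isWienerIntegral i, S'.isWienerIntegral i]) hV hgrowth
  have hLl : ∀ i, L (Pi.single (Sum.inl i) 1) = Pi.single i 1 := fun i => by
    ext j; simp [L, Pi.single_apply]
  have hLr : ∀ i, L (Pi.single (Sum.inr i) 1) = 0 := fun i => by
    ext j; simp [L]
  have hRl : ∀ i, R (Pi.single (Sum.inl i) 1) = 0 := fun i => by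
    ext j; simp [R]
  have hRr : ∀ i, R (Pi.single (Sum.inr i) 1) = Pi.single i 1 := fun i => by
    ext j; simp [R, Pi.single_apply]
  have hLW : ∀ ω, L (fun i => Sum.elim S.W S'.W i ω) = fun i => S.W i ω := fun ω => rfl
  have hRW : ∀ ω, R (fun i => Sum.elim S.W S'.W i ω) = fun i => S'.W i ω := fun ω => rfl
  simp only [(hfd _).fderiv, Fintype.sum_sum_type, _root_.add_apply,
    _root_.smul_apply, ContinuousLinearMap.comp_apply, hLl, hLr, hRl, hRr, map_zero,
    mul_zero, zero_add, add_zero, hLW, hRW, Sum.elim_inl, Sum.elim_inr, smul_eq_mul] at key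
  refine key.trans ?_
  congr 1
  · simp_rw [S.integral_inner_deriv hV.memLp_integrand, Finset.mul_sum, ← mul_assoc]
    rw [integral_finsetSum _ fun i _ => (integrable_mul_of_memLp
      (S'.memLp_toFun hB (p := 2) (by simp))
      ((S.partialDeriv i).memLp_toFun hB (p := 2) (by simp))).mul_const _]
    exact Finset.sum_congr rfl fun i _ => (integral_mul_const _ _).symm
  · simp_rw [S'.integral_inner_deriv hV.memLp_integrand, Finset.mul_sum, ← mul_assoc]
    rw [integral_finsetSum _ fun i _ => (integrable_mul_of_memLp
      (S.memLp_toFun hB (p := 2) (by simp))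
      ((S'.partialDeriv i).memLp_toFun hB (p := 2) (by simp))).mul_const _]
    exact Finset.sum_congr rfl fun i _ => (integral_mul_const _ _).symm

lemma isMalliavinDerivative (hB : IsBrownianMotion F B P) (S : SmoothFunctional B P) :
    IsMalliavinDerivative B P S.toFun S.deriv :=
  ⟨S.memLp_toFun hB (by simp), S.memLp_deriv hB, fun _ => S, by simp, by simp⟩

/-- A constant functional. -/
def const (B : Fin d → ℝ≥0 → Ω → ℝ) (P : Measure Ω) (c : ℝ) : SmoothFunctional B P where
  n := 0
  h := Fin.elim0
  W := Fin.elim0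
  isWienerIntegral i := i.elim0
  f _ := c
  growth := Function.HasTemperateGrowth.const c

end SmoothFunctional

namespace IsMalliavinDerivative

variable {G : Ω → ℝ} {D D' : ℝ≥0 → Ω → EuclideanSpace ℝ (Fin d)}

/-- Integration by parts in `𝔻^{1,2}`, tested against a smooth functional times an element of
`L²([0, ∞); ℝ^d)`. -/
lemma integral_inner_smul (hB : IsBrownianMotion F B P) (hD : IsMalliavinDerivative B P G D)
    (S : SmoothFunctional B P) {g : ℝ≥0 → EuclideanSpace ℝ (Fin d)} {V : Ω → ℝ}
    (hV : IsWienerIntegral B P g V) :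
    ∫ p : ℝ≥0 × Ω, inner ℝ (D p.1 p.2) (S.toFun p.2 • g p.1) ∂(timeMeasure.prod P) =
      ∫ ω, G ω * (S.toFun ω * V ω - ∫ t, inner ℝ (S.deriv t ω) (g t) ∂timeMeasure) ∂P := by
  obtain ⟨hG, hD', T, h3, h4⟩ := hD
  -- Fourth moments are needed so that the product of `S` and `V` lies in `L²` and can be paired
  -- with `G`.
  have hS4 := S.memLp_toFun hB (p := 4) (by simp)
  have hV4 : MemLp V 4 P := (hV.hasGaussianLaw hB).memLp (by simp)
  have : ENNReal.HolderTriple 4 4 2 := ⟨by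
    rw [← two_mul, show (4 : ℝ≥0∞) = 2 * 2 by norm_num,
      ENNReal.mul_inv (by simp) (by simp), ← mul_assoc,
      ENNReal.mul_inv_cancel (by simp) (by simp), one_mul]⟩
  have hSV : MemLp (fun ω => S.toFun ω * V ω) 2 P := hV4.mul' hS4
  have hSd := S.memLp_integral_inner_deriv hB hV.memLp_integrand (p := 2) (by simp)
  have hSg := (S.memLp_toFun hB (p := 2) (by simp)).smul_prod hV.memLp_integrand
  -- Both sides are continuous under convergence of the pair `(G, D)` in `L²`, so it suffices to
  -- verify the identity for the approximating smooth functionals.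
  have l1 := tendsto_integral_inner (fun n => (T n).memLp_deriv hB) hD' hSg h4
  have l2 := tendsto_integral_mul (fun n => (T n).memLp_toFun hB (by simp)) hG
    (hSV.sub hSd) h3
  refine tendsto_nhds_unique l1 (l2.congr fun n => ?_)
  have e1 := (T n).integral_mul_mul_wienerIntegral hB S hV
  have hTn := (T n).memLp_toFun hB (p := 2) (by simp)
  have e2 : ∫ ω, (T n).toFun ω * (S.toFun ω * V ω -
      ∫ t, inner ℝ (S.deriv t ω) (g t) ∂timeMeasure) ∂P =
      ∫ ω, (T n).toFun ω * S.toFun ω * V ω ∂P -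
      ∫ ω, (T n).toFun ω * ∫ t, inner ℝ (S.deriv t ω) (g t) ∂timeMeasure ∂P := by
    rw [← integral_sub]
    · congr 1
      ext ω
      ring
    · simpa only [mul_assoc] using integrable_mul_of_memLp hTn hSV
    · exact hTn.integrable_mul hSd
  refine e2.trans ?_
  rw [e1, add_sub_cancel_right, integral_prod_symm _
    (integrable_inner_of_memLp ((T n).memLp_deriv hB) hSg)]
  simp_rw [real_inner_smul_right, integral_const_mul]

/-- The duality between the Malliavin derivative and the Wiener integral. -/
lemma integral_inner (hB : IsBrownianMotion F B P) (hD : IsMalliavinDerivative B P G D)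
    {g : ℝ≥0 → EuclideanSpace ℝ (Fin d)} {V : Ω → ℝ} (hV : IsWienerIntegral B P g V) :
    ∫ ω, G ω * V ω ∂P = ∫ ω, ∫ t, inner ℝ (D t ω) (g t) ∂timeMeasure ∂P := by
  have h1 := hD.integral_inner_smul hB (SmoothFunctional.const B P 1) hV
  have h2 : ∀ ω, (SmoothFunctional.const B P 1).toFun ω = 1 := fun _ => rfl
  have h3 : ∀ t ω, (SmoothFunctional.const B P 1).deriv t ω = 0 := fun _ _ => rfl
  simp only [h2, h3, one_smul, one_mul, inner_zero_left, integral_zero, sub_zero] at h1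
  rw [← h1]
  exact integral_prod_symm _ (integrable_inner_of_memLp hD.2.1 (hV.memLp_integrand.comp_fst P))

/-- The Malliavin derivative is closable. -/
lemma ae_eq (hB : IsBrownianMotion F B P) (hD : IsMalliavinDerivative B P G D)
    (hD' : IsMalliavinDerivative B P G D') :
    (fun p : ℝ≥0 × Ω => D p.1 p.2) =ᵐ[timeMeasure.prod P] fun p => D' p.1 p.2 := by
  have hΔ : MemLp (fun p : ℝ≥0 × Ω => D p.1 p.2 - D' p.1 p.2) 2 (timeMeasure.prod P) :=
    hD.2.1.sub hD'.2.1
  -- The pairing with such test fields depends on `G` only, so `D - D'` is orthogonal to the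
  -- derivative of every smooth functional.
  have key : ∀ S : SmoothFunctional B P, ∫ p : ℝ≥0 × Ω, inner ℝ (S.deriv p.1 p.2)
      (D p.1 p.2 - D' p.1 p.2) ∂(timeMeasure.prod P) = 0 := by
    intro S
    simp_rw [S.deriv_eq, sum_inner]
    have hm : ∀ i, MemLp (fun p : ℝ≥0 × Ω => (S.partialDeriv i).toFun p.2 • S.h i p.1) 2
        (timeMeasure.prod P) := fun i =>
      ((S.partialDeriv i).memLp_toFun hB (by simp)).smul_prod (S.isWienerIntegral i).memLp_integrand
    rw [integral_finsetSum _ fun i _ => integrable_inner_of_memLp (hm i) hΔ]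
    refine Finset.sum_eq_zero fun i _ => ?_
    have h1 := hD.integral_inner_smul hB (S.partialDeriv i) (S.isWienerIntegral i)
    rw [← hD'.integral_inner_smul hB (S.partialDeriv i) (S.isWienerIntegral i), ← sub_eq_zero,
      ← integral_sub (integrable_inner_of_memLp hD.2.1 (hm i))
        (integrable_inner_of_memLp hD'.2.1 (hm i))] at h1
    rw [← h1]
    congr 1
    ext p
    rw [← inner_sub_left, real_inner_comm]
  obtain ⟨-, hDm, S, -, h4⟩ := hD
  obtain ⟨-, hDm', S', -, h4'⟩ := hD'
  -- Both `D` and `D'` are limits of smooth derivatives, hence `D - D'` is orthogonal to itself.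
  have l1 := tendsto_integral_inner (fun n => (S n).memLp_deriv hB) hDm hΔ h4
  have l2 := tendsto_integral_inner (fun n => (S' n).memLp_deriv hB) hDm' hΔ h4'
  simp_rw [key] at l1 l2
  have h5 : ∫ p : ℝ≥0 × Ω, ‖D p.1 p.2 - D' p.1 p.2‖ ^ 2 ∂(timeMeasure.prod P) = 0 := by
    simp_rw [← real_inner_self_eq_norm_sq, inner_sub_left (D _ _)]
    rw [integral_sub (integrable_inner_of_memLp hDm hΔ) (integrable_inner_of_memLp hDm' hΔ),
      tendsto_nhds_unique l1 tendsto_const_nhds, tendsto_nhds_unique l2 tendsto_const_nhds,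
      sub_zero]
  have h6 : eLpNorm (fun p : ℝ≥0 × Ω => D p.1 p.2 - D' p.1 p.2) 2 (timeMeasure.prod P) = 0 := by
    rw [eLpNorm_two_eq_ofReal_sqrt hΔ, h5]
    simp
  filter_upwards [(eLpNorm_eq_zero_iff hΔ.1 two_ne_zero).1 h6] with p hp
  exact sub_eq_zero.1 hp

end IsMalliavinDerivative

namespace IsWienerIntegral

variable {h : ℝ≥0 → EuclideanSpace ℝ (Fin d)} {W : Ω → ℝ}

/-- The Malliavin derivative of `c + B(h)` is `h`. -/
lemma isMalliavinDerivative (hB : IsBrownianMotion F B P) (hW : IsWienerIntegral B P h W)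
    (c : ℝ) : IsMalliavinDerivative B P (fun ω => c + W ω) (fun t _ => h t) := by
  let S : SmoothFunctional B P :=
    { n := 1
      h := fun _ => h
      W := fun _ => W
      isWienerIntegral := fun _ => hW
      f := fun x => c + x 0
      growth := (Function.HasTemperateGrowth.const c).add
        (ContinuousLinearMap.proj (R := ℝ) (φ := fun _ : Fin 1 => ℝ) 0).hasTemperateGrowth }
  have h1 : S.deriv = fun t _ => h t := by
    ext1 t
    ext1 ω
    have h2 : ∀ x, fderiv ℝ S.f x = ContinuousLinearMap.proj (R := ℝ) (φ := fun _ : Fin 1 => ℝ) 0 :=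
      fun x => ((ContinuousLinearMap.proj (R := ℝ) (φ := fun _ : Fin 1 => ℝ) 0).hasFDerivAt.const_add
        c).fderiv
    change ∑ i : Fin 1, fderiv ℝ S.f (fun _ => W ω) (Pi.single i 1) • h t = h t
    simp [h2]
  have h3 := S.isMalliavinDerivative hB
  rw [h1] at h3
  exact h3

/-- Closability identifies the chosen version of the derivative with the explicit one. -/
lemma malliavinDerivative_ae_eq (hB : IsBrownianMotion F B P) (hW : IsWienerIntegral B P h W)
    {c : ℝ} {G : Ω → ℝ} (hG : G =ᵐ[P] fun ω => c + W ω) :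
    (fun p : ℝ≥0 × Ω => malliavinDerivative B P G p.1 p.2) =ᵐ[timeMeasure.prod P]
      fun p => h p.1 := by
  have h1 := (hW.isMalliavinDerivative hB c).congr_left hG.symm
  have h2 : ∃ D, IsMalliavinDerivative B P G D := ⟨_, h1⟩
  rw [malliavinDerivative, dif_pos h2]
  exact h2.choose_spec.ae_eq hB h1

end IsWienerIntegral

/-- The Malliavin matrix of a Gaussian vector in the first Wiener chaos is deterministic. -/
lemma malliavinMatrix_ae_eq (hB : IsBrownianMotion F B P) {m : ℕ} {G : Ω → Fin m → ℝ}
    {h : Fin m → ℝ≥0 → EuclideanSpace ℝ (Fin d)} {W : Fin m → Ω → ℝ} {c : Fin m → ℝ}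
    (hW : ∀ i, IsWienerIntegral B P (h i) (W i))
    (hG : ∀ i, (fun ω => G ω i) =ᵐ[P] fun ω => c i + W i ω) :
    ∀ᵐ ω ∂P, malliavinMatrix B P G ω =
      Matrix.of fun i j => ∫ t, inner ℝ (h i t) (h j t) ∂timeMeasure := by
  have h1 : ∀ i, ∀ᵐ ω ∂P, ∀ᵐ t ∂timeMeasure,
      malliavinDerivative B P (fun ω' => G ω' i) t ω = h i t := fun i => by
    have h2 := (hW i).malliavinDerivative_ae_eq hB (hG i)
    -- Swapping the factors makes `ω` the outer variable, so that for almost every `ω` the time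
    -- integral defining the matrix can be evaluated.
    have h3 : ∀ᵐ q ∂(P.prod timeMeasure),
        malliavinDerivative B P (fun ω' => G ω' i) q.2 q.1 = h i q.2 :=
      Measure.measurePreserving_swap.quasiMeasurePreserving.ae h2
    exact Measure.ae_ae_of_ae_prod h3
  filter_upwards [ae_all_iff.2 h1] with ω hω
  ext i j
  simp only [malliavinMatrix, Matrix.of_apply]
  refine integral_congr_ae ?_
  filter_upwards [hω i, hω j] with t h2 h3
  rw [h2, h3]

end Malliavin

/-! ### Trigonometric test functions -/

section TrigonometricGrowth

lemma Real.hasTemperateGrowth_cos : Real.cos.HasTemperateGrowth :=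
  ⟨Real.contDiff_cos, fun n => ⟨0, 1, fun x => by
    simpa [norm_iteratedFDeriv_eq_norm_iteratedDeriv] using Real.abs_iteratedDeriv_cos_le_one n x⟩⟩

lemma Real.hasTemperateGrowth_sin : Real.sin.HasTemperateGrowth :=
  ⟨Real.contDiff_sin, fun n => ⟨0, 1, fun x => by
    simpa [norm_iteratedFDeriv_eq_norm_iteratedDeriv] using Real.abs_iteratedDeriv_sin_le_one n x⟩⟩

end TrigonometricGrowth

/-! ### Wiener integrals as Skorokhod integrals, and uniqueness of the divergence -/

section Skorokhod

variable {Ω : Type*} {mΩ : MeasurableSpace Ω} {d : ℕ} {P : Measure Ω}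
  {F : Filtration ℝ≥0 mΩ} {B : Fin d → ℝ≥0 → Ω → ℝ}

lemma measurable_brownianSigma (B : Fin d → ℝ≥0 → Ω → ℝ) (l : Fin d) (t : ℝ≥0) :
    Measurable[brownianSigma B] (B l t) :=
  measurable_iff_comap_le.2 (le_iSup₂_of_le l t le_rfl)

lemma IsBrownianMotion.brownianSigma_le (hB : IsBrownianMotion F B P) : brownianSigma B ≤ mΩ :=
  iSup₂_le fun l t => (hB.stronglyMeasurable l t).measurable.comap_le

/-- The path of the Brownian motion, as a point of the product space. -/
def brownianPath (B : Fin d → ℝ≥0 → Ω → ℝ) (ω : Ω) : Fin d × ℝ≥0 → ℝ := fun p => B p.1 p.2 ω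

/-- Turns questions about the Brownian σ-algebra into questions about measures on path space, which
are determined by their finite-dimensional marginals. -/
lemma brownianSigma_eq_comap (B : Fin d → ℝ≥0 → Ω → ℝ) :
    brownianSigma B = MeasurableSpace.comap (brownianPath B) MeasurableSpace.pi := by
  rw [MeasurableSpace.pi, MeasurableSpace.comap_iSup, iSup_prod]
  simp_rw [MeasurableSpace.comap_comp]
  rfl

lemma IsBrownianMotion.measurable_brownianPath (hB : IsBrownianMotion F B P) :
    Measurable (brownianPath B) :=
  measurable_pi_lambda _ fun p => (hB.stronglyMeasurable p.1 p.2).measurable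

lemma StepFunction.measurable_integral (S : StepFunction d) (B : Fin d → ℝ≥0 → Ω → ℝ) :
    Measurable[brownianSigma B] (S.integral B) := by
  let _ : MeasurableSpace Ω := brownianSigma B
  refine Finset.measurable_fun_sum _ fun i _ => Finset.measurable_fun_sum _ fun l _ => ?_
  exact ((measurable_brownianSigma B l _).sub (measurable_brownianSigma B l _)).const_mul _

/-- A pointwise limit of measurable functions is almost surely equal to a measurable function,
also for a sub-σ-algebra that does not contain the null sets. -/
lemma aestronglyMeasurable_sub_of_tendsto_ae {m : MeasurableSpace Ω} {f : ℕ → Ω → ℝ} {g : Ω → ℝ}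
    (hf : ∀ n, Measurable[m] (f n)) (h : ∀ᵐ ω ∂P, Tendsto (fun n => f n ω) atTop (𝓝 (g ω))) :
    AEStronglyMeasurable[m] g P := by
  refine ⟨fun ω => limUnder atTop fun n => f n ω,
    StronglyMeasurable.limUnder fun n => (hf n).stronglyMeasurable, ?_⟩
  filter_upwards [h] with ω hω
  exact hω.limUnder_eq.symm

variable [IsProbabilityMeasure P]

/-- A subsequence of elementary integrals, each exactly measurable for the Brownian σ-algebra,
converges almost surely. -/
lemma IsWienerIntegral.aestronglyMeasurable_brownianSigma (hB : IsBrownianMotion F B P)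
    {h : ℝ≥0 → EuclideanSpace ℝ (Fin d)} {W : Ω → ℝ} (hW : IsWienerIntegral B P h W) :
    AEStronglyMeasurable[brownianSigma B] W P := by
  obtain ⟨-, h2, S, -, h4⟩ := hW
  obtain ⟨ns, -, hns⟩ := (tendstoInMeasure_of_tendsto_eLpNorm two_ne_zero
    (fun n => ((S n).memLp_integral hB).1) h2.1 h4).exists_seq_tendsto_ae
  exact aestronglyMeasurable_sub_of_tendsto_ae (fun n => (S (ns n)).measurable_integral B) hns

/-- Wiener integrals of deterministic functions are Skorokhod integrals. -/
lemma IsWienerIntegral.isSkorokhodIntegral (hB : IsBrownianMotion F B P)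
    {h : ℝ≥0 → EuclideanSpace ℝ (Fin d)} {W : Ω → ℝ} (hW : IsWienerIntegral B P h W)
    {u : ℝ≥0 → Ω → EuclideanSpace ℝ (Fin d)} (hu : ∀ᵐ ω ∂P, ∀ t, u t ω = h t) :
    IsSkorokhodIntegral B P u W := by
  have hu' : (fun p : ℝ≥0 × Ω => u p.1 p.2) =ᵐ[timeMeasure.prod P] fun p => h p.1 := by
    have := Measure.quasiMeasurePreserving_snd (μ := timeMeasure) (ν := P) |>.ae hu
    filter_upwards [this] with p hp using hp p.1
  refine ⟨(memLp_congr_ae hu').2 (hW.memLp_integrand.comp_fst P), ?_, hW.memLp_two,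
    hW.aestronglyMeasurable_brownianSigma hB, fun G D hD => ?_⟩
  · obtain ⟨g, hg, hgh⟩ := hW.memLp_integrand.1
    refine ⟨fun p => g p.1, ?_, hu'.trans ?_⟩
    · let _ : MeasurableSpace Ω := brownianSigma B
      exact hg.comp_measurable measurable_fst
    · exact Measure.quasiMeasurePreserving_fst.ae hgh
  · rw [hD.integral_inner hB hW]
    refine integral_congr_ae ?_
    filter_upwards [hu] with ω hω
    simp_rw [hω]

/-- Brownian motion starts at zero almost surely, so its value at `t` is the increment over `(0,
t]`. -/
lemma IsBrownianMotion.isWienerIntegral_eval (hB : IsBrownianMotion F B P) (l : Fin d) (t : ℝ≥0) :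
    ∃ h, IsWienerIntegral B P h (B l t) := by
  let S : StepFunction d := ⟨1, fun _ => 0, fun _ => t, fun _ => zero_le,
    fun _ => EuclideanSpace.single l 1⟩
  refine ⟨S.toFunction, (IsWienerIntegral.step hB S).congr_right ?_⟩
  filter_upwards [(hB.isBrownianReal l).toIsPreBrownianReal.eval_zero_ae_eq_zero] with ω hω
  simp [StepFunction.integral, S, hω]

section Uniqueness

variable {Z : Ω → ℝ}

/-- Orthogonality to smooth functionals passes to characteristic functions. -/
lemma integral_exp_smul_eq_zero (hB : IsBrownianMotion F B P) (hZ : MemLp Z 2 P)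
    (h0 : ∀ S : SmoothFunctional B P, ∫ ω, S.toFun ω * Z ω ∂P = 0)
    {h : ℝ≥0 → EuclideanSpace ℝ (Fin d)} {W : Ω → ℝ} (hW : IsWienerIntegral B P h W) :
    ∫ ω, Z ω • Complex.exp (W ω * Complex.I) ∂P = 0 := by
  have hcos : ∀ {f : ℝ → ℝ}, f.HasTemperateGrowth →
      Integrable (fun ω => f (W ω) * Z ω) P ∧ ∫ ω, f (W ω) * Z ω ∂P = 0 := fun {f} hf => by
    let S : SmoothFunctional B P :=
      { n := 1
        h := fun _ => h
        W := fun _ => W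
        isWienerIntegral := fun _ => hW
        f := fun x => f (x 0)
        growth := hf.comp
          (ContinuousLinearMap.proj (R := ℝ) (φ := fun _ : Fin 1 => ℝ) 0).hasTemperateGrowth }
    exact ⟨integrable_mul_of_memLp (S.memLp_toFun hB (by simp)) hZ, h0 S⟩
  obtain ⟨c1, c2⟩ := hcos Real.hasTemperateGrowth_cos
  obtain ⟨s1, s2⟩ := hcos Real.hasTemperateGrowth_sin
  have e : ∀ ω, Z ω • Complex.exp (W ω * Complex.I) =
      ((Real.cos (W ω) * Z ω : ℝ) : ℂ) + ((Real.sin (W ω) * Z ω : ℝ) : ℂ) * Complex.I := fun ω => by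
    rw [Complex.exp_mul_I, Complex.real_smul]
    push_cast
    ring
  simp_rw [e]
  rw [integral_add c1.ofReal (s1.ofReal.mul_const _), integral_mul_const,
    integral_complex_ofReal, integral_complex_ofReal, c2, s2]
  simp

/-- Smooth cylindrical functionals are total in `L²` of the Brownian σ-algebra. -/
lemma ae_eq_zero_of_forall_smoothFunctional (hB : IsBrownianMotion F B P) (hZ : MemLp Z 2 P)
    (hZm : AEStronglyMeasurable[brownianSigma B] Z P)
    (h0 : ∀ S : SmoothFunctional B P, ∫ ω, S.toFun ω * Z ω ∂P = 0) : Z =ᵐ[P] 0 := by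
  have hZi : Integrable Z P := hZ.integrable one_le_two
  have f1 := isFiniteMeasure_withDensity_ofReal hZi.2
  have f2 : IsFiniteMeasure (P.withDensity fun ω => ENNReal.ofReal (-Z ω)) :=
    isFiniteMeasure_withDensity_ofReal hZi.neg.2
  have hpath := hB.measurable_brownianPath
  -- The positive and negative parts of `Z` define two finite measures. Their images on path space
  -- agree because, for every finite set of coordinates, the difference of the characteristic
  -- functions is `∫ Z exp(iW)` for a Wiener integral `W`.
  have hmap : (P.withDensity fun ω => ENNReal.ofReal (Z ω)).map (brownianPath B) =
      (P.withDensity fun ω => ENNReal.ofReal (-Z ω)).map (brownianPath B) := by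
    refine IsProjectiveLimit.unique (P := fun I =>
      ((P.withDensity fun ω => ENNReal.ofReal (-Z ω)).map (brownianPath B)).map I.restrict)
      (fun I => ?_) (fun I => rfl)
    have hI : Measurable (I.restrict ∘ brownianPath B) :=
      (Finset.measurable_restrict I).comp hpath
    beta_reduce
    rw [Measure.map_map (Finset.measurable_restrict I) hpath,
      Measure.map_map (Finset.measurable_restrict I) hpath]
    refine Measure.ext_of_charFunDual ?_
    ext L
    choose h hh using fun p : I => hB.isWienerIntegral_eval p.1.1 p.1.2
    have hW := IsWienerIntegral.linearCombination hB Finset.univ (fun p _ => hh p)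
      (fun p => L (Pi.single p 1))
    have hL : ∀ ω, L (I.restrict (brownianPath B ω)) =
        ∑ p : I, L (Pi.single p 1) * B p.1.1 p.1.2 ω := fun ω => by
      conv_lhs => rw [← Finset.univ_sum_single (I.restrict (brownianPath B ω))]
      rw [map_sum]
      refine Finset.sum_congr rfl fun p _ => ?_
      rw [mul_comm, ← smul_eq_mul, ← map_smul, ← Pi.single_smul, smul_eq_mul, mul_one]
      rfl
    have hcont : Continuous fun x : I → ℝ => Complex.exp (L x * Complex.I) := by fun_prop
    have hexp : Measurable fun ω => Complex.exp (L (I.restrict (brownianPath B ω)) * Complex.I) :=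
      hcont.measurable.comp hI
    have hint : ∀ g : Ω → ℝ, Integrable g P → Integrable (fun ω =>
        g ω • Complex.exp (L (I.restrict (brownianPath B ω)) * Complex.I)) P := fun g hg =>
      hg.norm.mono' (hg.1.smul hexp.aestronglyMeasurable) (Eventually.of_forall fun ω => by
        rw [norm_smul, Complex.norm_exp_ofReal_mul_I, mul_one])
    rw [charFunDual_apply, charFunDual_apply,
      integral_map hI.aemeasurable hcont.aestronglyMeasurable,
      integral_map hI.aemeasurable hcont.aestronglyMeasurable,
      integral_withDensity_eq_integral_toReal_smul₀ hZi.1.aemeasurable.ennreal_ofReal (by simp),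
      integral_withDensity_eq_integral_toReal_smul₀
        hZi.1.aemeasurable.fun_neg.ennreal_ofReal (by simp),
      ← sub_eq_zero, ← integral_sub]
    · rw [← integral_exp_smul_eq_zero hB hZ h0 hW]
      refine integral_congr_ae (Eventually.of_forall fun ω => ?_)
      simp only [Function.comp_apply, ← hL, ← sub_smul, ENNReal.toReal_ofReal']
      rw [max_zero_sub_max_neg_zero_eq_self]
    · simpa only [ENNReal.toReal_ofReal', Function.comp_apply] using hint _ hZi.pos_part
    · simpa only [ENNReal.toReal_ofReal', Function.comp_apply] using hint _ hZi.neg_part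
  -- Brownian events are preimages of path sets, so both parts of `Z` give them the same mass.
  have key : ∀ A, MeasurableSet[brownianSigma B] A → ∫ ω in A, Z ω ∂P = 0 := by
    intro A hA
    have hA' := hB.brownianSigma_le A hA
    rw [brownianSigma_eq_comap] at hA
    obtain ⟨C, hC, rfl⟩ := hA
    have h1 := congrArg (fun μ => μ C) hmap
    simp only [Measure.map_apply hpath hC, withDensity_apply _ hA'] at h1
    rw [integral_eq_lintegral_pos_part_sub_lintegral_neg_part hZi.integrableOn, h1, sub_self]
  refine ae_eq_of_forall_setIntegral_eq_of_sigmaFinite' hB.brownianSigma_le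
    (fun _ _ _ => hZi.integrableOn) (fun _ _ _ => integrableOn_zero)
    (fun A hA _ => ?_) hZm aestronglyMeasurable_const
  simpa using key A hA

end Uniqueness

/-- Duality shows the difference orthogonal to every smooth functional. Measurability for the
Brownian σ-algebra, required of both candidates, is what then forces it to vanish. -/
lemma IsSkorokhodIntegral.ae_eq (hB : IsBrownianMotion F B P)
    {u : ℝ≥0 → Ω → EuclideanSpace ℝ (Fin d)} {Z Z' : Ω → ℝ} (h : IsSkorokhodIntegral B P u Z)
    (h' : IsSkorokhodIntegral B P u Z') : Z =ᵐ[P] Z' := by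
  obtain ⟨-, -, h1, h2, h3⟩ := h
  obtain ⟨-, -, h1', h2', h3'⟩ := h'
  have := ae_eq_zero_of_forall_smoothFunctional hB (h1.sub h1') (h2.sub h2') fun S => by
    have hS := S.memLp_toFun hB (p := 2) (by simp)
    simp_rw [Pi.sub_apply, mul_sub]
    rw [integral_sub (integrable_mul_of_memLp hS h1) (integrable_mul_of_memLp hS h1'),
      h3 _ _ (S.isMalliavinDerivative hB), h3' _ _ (S.isMalliavinDerivative hB), sub_self]
  filter_upwards [this] with ω hω using sub_eq_zero.1 hω

lemma IsSkorokhodIntegral.skorokhodIntegral_ae_eq (hB : IsBrownianMotion F B P)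
    {u : ℝ≥0 → Ω → EuclideanSpace ℝ (Fin d)} {Z : Ω → ℝ} (h : IsSkorokhodIntegral B P u Z) :
    skorokhodIntegral B P u =ᵐ[P] Z := by
  have hd : InSkorokhodDomain B P u := ⟨Z, h⟩
  rw [skorokhodIntegral, dif_pos hd]
  exact hd.choose_spec.ae_eq hB h

end Skorokhod

/-! ### Linear differential equations with continuous coefficients -/

section LinearODE

lemma hasDerivWithinAt_setIntegral_timeMeasure {E : Type*} [NormedAddCommGroup E]
    [NormedSpace ℝ E] [CompleteSpace E] {T : ℝ≥0} {g : ℝ≥0 → E}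
    (hg : ContinuousOn g (Set.Icc 0 T)) {x : ℝ} (hx : x ∈ Set.Icc (0 : ℝ) T) :
    HasDerivWithinAt (fun x : ℝ => ∫ s in Set.Icc 0 x.toNNReal, g s ∂timeMeasure)
      (g x.toNNReal) (Set.Icc 0 T) x := by
  -- Clamping the argument to `[0, T]` gives a globally continuous integrand, so the fundamental
  -- theorem applies at the end points too.
  have hc : Continuous fun x : ℝ => g (min x.toNNReal T) :=
    hg.comp_continuous (by fun_prop) fun x => ⟨zero_le, min_le_right _ _⟩
  have hmin : ∀ y ∈ Set.Icc (0 : ℝ) T, min y.toNNReal T = y.toNNReal := fun y hy =>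
    min_eq_left (Real.toNNReal_le_iff_le_coe.2 hy.2)
  have h1 := (hc.integral_hasStrictDerivAt 0 x).hasDerivAt.hasDerivWithinAt (s := Set.Icc 0 (T : ℝ))
  rw [hmin x hx] at h1
  have h2 : ∀ y ∈ Set.Icc (0 : ℝ) T, ∫ s in Set.Icc 0 y.toNNReal, g s ∂timeMeasure =
      ∫ x in (0 : ℝ)..y, g (min x.toNNReal T) := fun y hy => by
    rw [setIntegral_timeMeasure, Real.coe_toNNReal _ hy.1]
    refine intervalIntegral.integral_congr fun z hz => ?_
    rw [Set.uIcc_of_le hy.1] at hz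
    simp only [hmin z ⟨hz.1, hz.2.trans hy.2⟩]
  exact h1.congr h2 (h2 x hx)

instance : IsFiniteMeasureOnCompacts timeMeasure where
  lt_top_of_isCompact K hK := by
    rw [timeMeasure, measurableEmbedding_nnreal_coe.comap_apply]
    exact (hK.image NNReal.continuous_coe).measure_lt_top

lemma toNNReal_mem_Icc {T : ℝ≥0} {x : ℝ} (hx : x ∈ Set.Icc (0 : ℝ) T) :
    x.toNNReal ∈ Set.Icc 0 T :=
  ⟨zero_le, Real.toNNReal_le_iff_le_coe.2 hx.2⟩

/-- A solution of a homogeneous linear equation that vanishes somewhere vanishes everywhere. -/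
lemma eqOn_zero_of_hasDerivWithinAt_linear {E : Type*} [NormedAddCommGroup E] [NormedSpace ℝ E]
    {T : ℝ≥0} {a : ℝ≥0 → E →L[ℝ] E} (ha : ContinuousOn a (Set.Icc 0 T)) {w : ℝ → E}
    (hw : ∀ x ∈ Set.Icc (0 : ℝ) T, HasDerivWithinAt w (a x.toNNReal (w x)) (Set.Icc 0 T) x)
    {t : ℝ} (ht : t ∈ Set.Icc (0 : ℝ) T) (h0 : w t = 0) : Set.EqOn w 0 (Set.Icc (0 : ℝ) T) := by
  obtain ⟨K, hK⟩ := isCompact_Icc.exists_bound_of_continuousOn ha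
  have hLip : ∀ x ∈ Set.Icc (0 : ℝ) T,
      LipschitzOnWith K.toNNReal (fun z => a x.toNNReal z) Set.univ := fun x hx =>
    ((a x.toNNReal).lipschitz.weaken (by
      rw [← norm_toNNReal]
      exact Real.toNNReal_le_toNNReal (hK _ (toNNReal_mem_Icc hx)))).lipschitzOnWith
  have hcont : ContinuousOn w (Set.Icc (0 : ℝ) T) := fun x hx => (hw x hx).continuousWithinAt
  have hz : ∀ (s : Set ℝ) (x : ℝ), HasDerivWithinAt (0 : ℝ → E) (a x.toNNReal ((0 : ℝ → E) x)) s x :=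
    fun s x => by
      rw [Pi.zero_apply, map_zero]
      exact hasDerivWithinAt_const x s (0 : E)
  -- Comparison with the zero solution, forward from `t` here and backward from `t` below; the
  -- backward half is what yields invertibility.
  have hr := ODE_solution_unique_of_mem_Icc_right (v := fun x z => a x.toNNReal z)
    (s := fun _ => Set.univ) (f := w) (g := 0) (K := K.toNNReal) (a := t) (b := T)
    (fun x hx => hLip x ⟨ht.1.trans hx.1, hx.2.le⟩)
    (hcont.mono (Set.Icc_subset_Icc_left ht.1))
    (fun x hx => (hw x ⟨ht.1.trans hx.1, hx.2.le⟩).mono_of_mem_nhdsWithin (mem_of_superset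
      (Icc_mem_nhdsGE hx.2) (Set.Icc_subset_Icc_left (ht.1.trans hx.1)))) (fun _ _ => Set.mem_univ _)
    continuousOn_const (fun x _ => hz _ x) (fun _ _ => Set.mem_univ _) h0
  have hl := ODE_solution_unique_of_mem_Icc_left (v := fun x z => a x.toNNReal z)
    (s := fun _ => Set.univ) (f := w) (g := 0) (K := K.toNNReal) (a := 0) (b := t)
    (fun x hx => hLip x ⟨hx.1.le, hx.2.trans ht.2⟩)
    (hcont.mono (Set.Icc_subset_Icc_right ht.2))
    (fun x hx => (hw x ⟨hx.1.le, hx.2.trans ht.2⟩).mono_of_mem_nhdsWithin (mem_of_superset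
      (Icc_mem_nhdsLE hx.1) (Set.Icc_subset_Icc_right (hx.2.trans ht.2)))) (fun _ _ => Set.mem_univ _)
    continuousOn_const (fun x _ => hz _ x) (fun _ _ => Set.mem_univ _) h0
  rw [← Set.Icc_union_Icc_eq_Icc ht.1 ht.2]
  exact hl.union hr

/-- Matrices as continuous linear operators. -/
def matrixOperator (m : ℕ) : Matrix (Fin m) (Fin m) ℝ ≃ₐ[ℝ] ((Fin m → ℝ) →L[ℝ] (Fin m → ℝ)) :=
  Matrix.toLinAlgEquiv'.trans (Module.End.toContinuousLinearMap (Fin m → ℝ))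

lemma matrixOperator_apply {m : ℕ} (A : Matrix (Fin m) (Fin m) ℝ) (v : Fin m → ℝ) :
    matrixOperator m A v = A.mulVec v := rfl

lemma continuous_matrixOperator (m : ℕ) : Continuous (matrixOperator m) :=
  (matrixOperator m).toLinearMap.continuous_of_finiteDimensional

lemma continuous_matrixOperator_symm (m : ℕ) : Continuous (matrixOperator m).symm :=
  (matrixOperator m).symm.toLinearMap.continuous_of_finiteDimensional

section Exponential

variable {𝔸 : Type*} [NormedRing 𝔸] [NormedAlgebra ℝ 𝔸]

/-- Commutation factors `exp (A y)` as `exp (A x) * exp (A y - A x)`, which reduces the claim to the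
derivative of the exponential at zero. -/
lemma hasDerivWithinAt_exp_of_commute [CompleteSpace 𝔸] {A : ℝ → 𝔸} {a : 𝔸} {s : Set ℝ} {x : ℝ}
    (h : HasDerivWithinAt A a s x) (hc : ∀ y ∈ s, Commute (A x) (A y)) (hx : x ∈ s) :
    HasDerivWithinAt (fun y => NormedSpace.exp (A y)) (NormedSpace.exp (A x) * a) s x := by
  let _ : NormedAlgebra ℚ 𝔸 := NormedAlgebra.restrictScalars ℚ ℝ 𝔸
  have h1 : HasFDerivAt (NormedSpace.exp : 𝔸 → 𝔸) (1 : 𝔸 →L[ℝ] 𝔸) (A x - A x) := by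
    rw [sub_self]
    exact hasFDerivAt_exp_zero
  have h2 := (h1.comp_hasDerivWithinAt x (h.sub_const (A x))).const_mul (NormedSpace.exp (A x))
  have h3 : ∀ y ∈ s, NormedSpace.exp (A y) =
      NormedSpace.exp (A x) * NormedSpace.exp (A y - A x) := fun y hy => by
    rw [← NormedSpace.exp_add_of_commute ((hc y hy).sub_right (Commute.refl _)),
      add_sub_cancel]
  exact h2.congr h3 (h3 x hx)

lemma commute_setIntegral {α : Type*} {mα : MeasurableSpace α} {μ : Measure α} {s : Set α}
    (hs : MeasurableSet s) {f : α → 𝔸} {c : 𝔸} (hf : IntegrableOn f s μ)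
    (h : ∀ x ∈ s, Commute c (f x)) : Commute c (∫ x in s, f x ∂μ) := by
  rw [commute_iff_eq, ← integral_const_mul_of_integrable hf, ← integral_mul_const_of_integrable hf]
  exact setIntegral_congr_fun hs fun x hx => h x hx

end Exponential

namespace SolvesVariationEquation

variable {m : ℕ} {T : ℝ≥0} {b y Φ : ℝ≥0 → Matrix (Fin m) (Fin m) ℝ}

lemma apply_zero (hy : SolvesVariationEquation T b y) : y 0 = 1 := by
  ext i j
  rw [hy.2 0 zero_le i j, setIntegral_timeMeasure]
  simp

lemma mono {t : ℝ≥0} (ht : t ≤ T) (hy : SolvesVariationEquation T b y) :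
    SolvesVariationEquation t b y :=
  ⟨hy.1.mono (Set.Icc_subset_Icc_right ht), fun s hs => hy.2 s (hs.trans ht)⟩

lemma hasDerivWithinAt (hy : SolvesVariationEquation T b y) (hb : ContinuousOn b (Set.Icc 0 T))
    {x : ℝ} (hx : x ∈ Set.Icc (0 : ℝ) T) (i j : Fin m) :
    HasDerivWithinAt (fun x : ℝ => y x.toNNReal i j) ((b x.toNNReal * y x.toNNReal) i j)
      (Set.Icc 0 T) x := by
  have hc : ContinuousOn (fun s => (b s * y s) i j) (Set.Icc 0 T) :=
    (continuous_id.matrix_elem i j).comp_continuousOn (hb.mul hy.1)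
  have h1 := (hasDerivWithinAt_setIntegral_timeMeasure hc hx).const_add
    ((1 : Matrix (Fin m) (Fin m) ℝ) i j)
  exact h1.congr (fun z hz => hy.2 _ (toNNReal_mem_Icc hz).2 i j) (hy.2 _ (toNNReal_mem_Icc hx).2 i j)

/-- Constant `k` serves uniqueness, invertibility and the exponential formula; a moving `k` is
needed for variation of constants. -/
lemma hasDerivWithinAt_mulVec (hy : SolvesVariationEquation T b y)
    (hb : ContinuousOn b (Set.Icc 0 T)) {k : ℝ → Fin m → ℝ} {k' : Fin m → ℝ}
    {x : ℝ} (hx : x ∈ Set.Icc (0 : ℝ) T) (hk : HasDerivWithinAt k k' (Set.Icc 0 T) x) :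
    HasDerivWithinAt (fun x : ℝ => (y x.toNNReal).mulVec (k x))
      ((b x.toNNReal).mulVec ((y x.toNNReal).mulVec (k x)) + (y x.toNNReal).mulVec k')
      (Set.Icc 0 T) x := by
  rw [hasDerivWithinAt_pi] at hk ⊢
  intro i
  refine (HasDerivWithinAt.fun_sum (u := Finset.univ) fun j _ =>
    (hy.hasDerivWithinAt hb hx i j).mul (hk j)).congr_deriv ?_
  rw [Finset.sum_add_distrib, Matrix.mulVec_mulVec]
  rfl

/-- The linear equation for the first variation has at most one solution. -/
lemma eq_of_le (hy : SolvesVariationEquation T b y) (hΦ : SolvesVariationEquation T b Φ)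
    (hb : ContinuousOn b (Set.Icc 0 T)) {t : ℝ≥0} (ht : t ≤ T) : y t = Φ t := by
  refine Matrix.ext_of_mulVec_single fun i => ?_
  have hk : ∀ x, HasDerivWithinAt (fun _ : ℝ => (Pi.single i 1 : Fin m → ℝ)) 0 (Set.Icc 0 T) x :=
    fun x => hasDerivWithinAt_const _ _ _
  have h := eqOn_zero_of_hasDerivWithinAt_linear
    ((continuous_matrixOperator m).comp_continuousOn hb)
    (w := fun x => (y x.toNNReal).mulVec (Pi.single i 1) - (Φ x.toNNReal).mulVec (Pi.single i 1))
    (fun x hx => by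
      refine ((hy.hasDerivWithinAt_mulVec hb hx (hk x)).sub
        (hΦ.hasDerivWithinAt_mulVec hb hx (hk x))).congr_deriv ?_
      rw [Function.comp_apply, map_sub, matrixOperator_apply, matrixOperator_apply]
      simp)
    (t := 0) ⟨le_rfl, T.2⟩ (by simp [hy.apply_zero, hΦ.apply_zero])
  have h2 := h (x := t) ⟨t.2, ht⟩
  simpa [sub_eq_zero] using h2

/-- The first variation is invertible. -/
lemma isUnit (hy : SolvesVariationEquation T b y) (hb : ContinuousOn b (Set.Icc 0 T))
    {t : ℝ≥0} (ht : t ≤ T) : IsUnit (y t) := by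
  rw [← Matrix.mulVec_injective_iff_isUnit]
  -- If `y t` kills `v`, then the solution `y v` vanishes at time `t`, hence at time `0`, where it
  -- equals `v`.
  refine (injective_iff_map_eq_zero (Matrix.mulVecLin (y t))).2 fun v hv => ?_
  have h := eqOn_zero_of_hasDerivWithinAt_linear
    ((continuous_matrixOperator m).comp_continuousOn hb)
    (w := fun x => (y x.toNNReal).mulVec v)
    (fun x hx => by
      refine (hy.hasDerivWithinAt_mulVec hb hx (hasDerivWithinAt_const x _ v)).congr_deriv ?_
      rw [Function.comp_apply, matrixOperator_apply]
      simp)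
    (t := t) ⟨t.2, ht⟩ (by simpa using hv)
  have h2 := h (x := 0) ⟨le_rfl, T.2⟩
  simpa [hy.apply_zero] using h2

/-- By the adjugate formula, since the determinant never vanishes. -/
lemma continuousOn_inv (hy : SolvesVariationEquation T b y) (hb : ContinuousOn b (Set.Icc 0 T)) :
    ContinuousOn (fun t => (y t)⁻¹) (Set.Icc 0 T) := by
  simp_rw [Matrix.inv_def, Ring.inverse_eq_inv']
  have hdet : ContinuousOn (fun t => (y t).det) (Set.Icc 0 T) :=
    (continuous_id (X := Matrix (Fin m) (Fin m) ℝ)).matrix_det.comp_continuousOn hy.1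
  have hadj : ContinuousOn (fun t => (y t).adjugate) (Set.Icc 0 T) :=
    (continuous_id (X := Matrix (Fin m) (Fin m) ℝ)).matrix_adjugate.comp_continuousOn hy.1
  exact (hdet.inv₀ fun t ht =>
    ((Matrix.isUnit_iff_isUnit_det _).1 (hy.isUnit hb ht.2)).ne_zero).smul hadj

/-- The first variation is the exponential of the integrated drift, when the drift commutes. -/
lemma eq_exp (hy : SolvesVariationEquation T b y) (hb : ContinuousOn b (Set.Icc 0 T))
    (hc : ∀ r ≤ T, ∀ s ≤ T, b r * b s = b s * b r) :
    y T = NormedSpace.exp (Matrix.of fun i j => ∫ s in Set.Icc 0 T, b s i j ∂timeMeasure) := by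
  have ha : ContinuousOn (fun s => matrixOperator m (b s)) (Set.Icc 0 T) :=
    (continuous_matrixOperator m).comp_continuousOn hb
  have hint : ∀ t ≤ T, IntegrableOn (fun s => matrixOperator m (b s)) (Set.Icc 0 t) timeMeasure :=
    fun t ht => (ha.mono (Set.Icc_subset_Icc_right ht)).integrableOn_compact isCompact_Icc
  set A : ℝ≥0 → (Fin m → ℝ) →L[ℝ] (Fin m → ℝ) := fun t =>
    ∫ s in Set.Icc 0 t, matrixOperator m (b s) ∂timeMeasure with hA
  have hcb : ∀ r ≤ T, ∀ t ≤ T, Commute (matrixOperator m (b r)) (A t) := fun r hr t ht =>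
    commute_setIntegral measurableSet_Icc (hint t ht) fun s hs =>
      (show Commute (b r) (b s) from hc r hr s (hs.2.trans ht)).map (matrixOperator m)
  have hcA : ∀ r ≤ T, ∀ t ≤ T, Commute (A r) (A t) := fun r hr t ht =>
    commute_setIntegral measurableSet_Icc (hint t ht) fun s hs =>
      (hcb s (hs.2.trans ht) r hr).symm
  -- The exponential of the integrated drift solves the same equation; commutation moves the drift
  -- to the left of the exponential. The calculation takes place among continuous linear operators,
  -- which carry a canonical norm.
  have hE : ∀ x ∈ Set.Icc (0 : ℝ) T, HasDerivWithinAt (fun x : ℝ => NormedSpace.exp (A x.toNNReal))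
      (matrixOperator m (b x.toNNReal) * NormedSpace.exp (A x.toNNReal)) (Set.Icc 0 T) x :=
    fun x hx => by
      have hx' := (toNNReal_mem_Icc hx).2
      rw [(hcb _ hx' _ hx').exp_right.eq]
      exact hasDerivWithinAt_exp_of_commute (hasDerivWithinAt_setIntegral_timeMeasure ha hx)
        (fun z hz => hcA _ hx' _ (toNNReal_mem_Icc hz).2) hx
  have hA0 : A 0 = 0 := (setIntegral_timeMeasure _ 0).trans (by simp)
  have hyE : matrixOperator m (y T) = NormedSpace.exp (A T) := by
    ext1 v
    have h := eqOn_zero_of_hasDerivWithinAt_linear ha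
      (w := fun x => (y x.toNNReal).mulVec v - NormedSpace.exp (A x.toNNReal) v)
      (fun x hx => by
        refine ((hy.hasDerivWithinAt_mulVec hb hx (hasDerivWithinAt_const x _ v)).sub
          ((hE x hx).clm_apply (hasDerivWithinAt_const x _ v))).congr_deriv ?_
        simp [matrixOperator_apply, Matrix.mulVec_sub])
      (t := 0) ⟨le_rfl, T.2⟩ (by simp [hy.apply_zero, hA0])
    have h2 := h (x := T) ⟨T.2, le_rfl⟩
    simpa [sub_eq_zero, matrixOperator_apply] using h2
  let _ : NormedAlgebra ℚ ((Fin m → ℝ) →L[ℝ] (Fin m → ℝ)) := NormedAlgebra.restrictScalars ℚ ℝ _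
  -- Return from operators to matrices; the matrix norm is installed locally for this transport
  -- only.
  have hexp : ∀ L, (matrixOperator m).symm (NormedSpace.exp L) =
      NormedSpace.exp ((matrixOperator m).symm L) := fun L => by
    let _ : NormedRing (Matrix (Fin m) (Fin m) ℝ) := Matrix.linftyOpNormedRing
    exact NormedSpace.map_exp (matrixOperator m).symm (continuous_matrixOperator_symm m) L
  rw [← (matrixOperator m).symm_apply_apply (y T), hyE, hexp]
  congr 1
  ext i j
  change A T (Pi.single j 1) i = _
  have hL := ((ContinuousLinearMap.proj (R := ℝ) (φ := fun _ : Fin m => ℝ) i).comp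
    (ContinuousLinearMap.apply ℝ (Fin m → ℝ) (Pi.single j 1))).integral_comp_comm (hint T le_rfl)
  refine hL.symm.trans ?_
  simp [matrixOperator_apply]

/-- The variation of constants formula. -/
lemma variation_of_constants (hy : SolvesVariationEquation T b y)
    (hb : ContinuousOn b (Set.Icc 0 T)) {X N : ℝ≥0 → Fin m → ℝ} {x₀ : Fin m → ℝ}
    (hX : ContinuousOn X (Set.Icc 0 T)) (hN : ContinuousOn N (Set.Icc 0 T))
    (h : ∀ t ≤ T, ∀ i, X t i = x₀ i + ∫ s in Set.Icc 0 t, (b s).mulVec (X s) i ∂timeMeasure + N t i) :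
    X T = N T + (y T).mulVec
      (x₀ + fun i => ∫ s in Set.Icc 0 T, ((y s)⁻¹ * b s).mulVec (N s) i ∂timeMeasure) := by
  have hcX : ∀ i, ContinuousOn (fun s => (b s).mulVec (X s) i) (Set.Icc 0 T) := fun i =>
    (continuous_apply i).comp_continuousOn
      ((continuous_fst.matrix_mulVec continuous_snd).comp_continuousOn (hb.prodMk hX))
  have hcN : ∀ i, ContinuousOn (fun s => ((y s)⁻¹ * b s).mulVec (N s) i) (Set.Icc 0 T) := fun i =>
    (continuous_apply i).comp_continuousOn ((continuous_fst.matrix_mulVec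
      continuous_snd).comp_continuousOn (((hy.continuousOn_inv hb).mul hb).prodMk hN))
  set k : ℝ≥0 → Fin m → ℝ := fun t =>
    x₀ + fun i => ∫ s in Set.Icc 0 t, ((y s)⁻¹ * b s).mulVec (N s) i ∂timeMeasure with hk
  -- `J = X - N` is differentiable although `X` and `N` are only continuous, so no stochastic
  -- calculus enters. Both `J` and `y k` solve `z' = b z + b N` from `x₀`, and their difference
  -- solves the homogeneous equation.
  set J : ℝ≥0 → Fin m → ℝ := fun t =>
    x₀ + fun i => ∫ s in Set.Icc 0 t, (b s).mulVec (X s) i ∂timeMeasure with hJ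
  have hXJ : ∀ t ≤ T, X t = J t + N t := fun t ht => funext fun i => h t ht i
  have hk' : ∀ x ∈ Set.Icc (0 : ℝ) T, HasDerivWithinAt (fun x : ℝ => k x.toNNReal)
      (((y x.toNNReal)⁻¹ * b x.toNNReal).mulVec (N x.toNNReal)) (Set.Icc 0 T) x := fun x hx =>
    (hasDerivWithinAt_pi.2 fun i =>
      hasDerivWithinAt_setIntegral_timeMeasure (hcN i) hx).const_add x₀
  have hJ' : ∀ x ∈ Set.Icc (0 : ℝ) T, HasDerivWithinAt (fun x : ℝ => J x.toNNReal)
      ((b x.toNNReal).mulVec (X x.toNNReal)) (Set.Icc 0 T) x := fun x hx =>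
    (hasDerivWithinAt_pi.2 fun i =>
      hasDerivWithinAt_setIntegral_timeMeasure (hcX i) hx).const_add x₀
  have hw := eqOn_zero_of_hasDerivWithinAt_linear
    ((continuous_matrixOperator m).comp_continuousOn hb)
    (w := fun x => J x.toNNReal - (y x.toNNReal).mulVec (k x.toNNReal))
    (fun x hx => by
      have hx' := (toNNReal_mem_Icc hx).2
      have hdet := (Matrix.isUnit_iff_isUnit_det _).1 (hy.isUnit hb hx')
      refine ((hJ' x hx).sub (hy.hasDerivWithinAt_mulVec hb hx (hk' x hx))).congr_deriv ?_
      rw [Function.comp_apply, map_sub, matrixOperator_apply, matrixOperator_apply, hXJ _ hx',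
        Matrix.mulVec_mulVec _ (y x.toNNReal), Matrix.mul_nonsing_inv_cancel_left _ _ hdet,
        Matrix.mulVec_add]
      abel)
    (t := 0) ⟨le_rfl, T.2⟩ (by simp [hy.apply_zero, hJ, hk, setIntegral_timeMeasure])
  have h2 : J T - (y T).mulVec (k T) = 0 := by
    have := hw (x := T) ⟨T.2, le_rfl⟩
    simpa using this
  rw [hXJ T le_rfl, sub_eq_zero.1 h2, add_comm]

end SolvesVariationEquation

end LinearODE

/-! ### The equation with additive noise -/

section AdditiveNoise

lemma continuousOn_setIntegral_timeMeasure {E : Type*} [NormedAddCommGroup E]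
    [NormedSpace ℝ E] [CompleteSpace E] {T : ℝ≥0} {g : ℝ≥0 → E}
    (hg : ContinuousOn g (Set.Icc 0 T)) :
    ContinuousOn (fun t => ∫ s in Set.Icc 0 t, g s ∂timeMeasure) (Set.Icc 0 T) := by
  have h1 : ContinuousOn (fun x : ℝ => ∫ s in Set.Icc 0 x.toNNReal, g s ∂timeMeasure)
      (Set.Icc (0 : ℝ) T) := fun x hx =>
    (hasDerivWithinAt_setIntegral_timeMeasure hg hx).continuousWithinAt
  have h2 := h1.comp NNReal.continuous_coe.continuousOn
    (s := Set.Icc 0 T) fun t ht => ⟨t.2, NNReal.coe_le_coe.2 ht.2⟩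
  exact h2.congr fun t _ => by simp

variable {Ω : Type*} {mΩ : MeasurableSpace Ω} {d m : ℕ} {P : Measure Ω}
  {F : Filtration ℝ≥0 mΩ} {B : Fin d → ℝ≥0 → Ω → ℝ}

lemma continuousOn_toLp_row {T : ℝ≥0} {σ : ℝ≥0 → Matrix (Fin m) (Fin d) ℝ}
    (hσ : ContinuousOn σ (Set.Icc 0 T)) (i : Fin m) :
    ContinuousOn (fun t => WithLp.toLp 2 (fun l => σ t i l)) (Set.Icc 0 T) :=
  ((PiLp.continuous_toLp 2 _).comp (continuous_apply i)).comp_continuousOn hσ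

/-- At each time every preimage is null or has null complement, and completeness puts such sets into
`F 0`. -/
lemma adapted_of_ae_eq_const (hF : IsCompleteFiltration F P) {E : Type*}
    [NormedAddCommGroup E] [MeasurableSpace E] [BorelSpace E] [SecondCountableTopology E]
    {u : ℝ≥0 → Ω → E} {v : ℝ≥0 → E} (h : ∀ t, ∀ᵐ ω ∂P, u t ω = v t) : StronglyAdapted F u := by
  intro t
  have hnull : ∀ s, P s = 0 → MeasurableSet[F t] s := fun s hs => F.mono zero_le _ (hF s hs)
  have hm : Measurable[F t] (u t) := by
    intro s _
    by_cases hv : v t ∈ s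
    · refine MeasurableSet.of_compl (hnull _ ?_)
      refine measure_mono_null (fun ω hω => ?_) (h t)
      exact fun h' => hω (by rwa [Set.mem_preimage, h'])
    · refine hnull _ (measure_mono_null (fun ω hω => ?_) (h t))
      exact fun h' => hv (by rwa [Set.mem_preimage, h'] at hω)
  exact hm.stronglyMeasurable

variable [IsProbabilityMeasure P]

lemma IsWienerIntegral.isItoIntegral_of_ae_eq {h : ℝ≥0 → EuclideanSpace ℝ (Fin d)} {W : Ω → ℝ}
    (hW : IsWienerIntegral B P h W) {u : ℝ≥0 → Ω → EuclideanSpace ℝ (Fin d)}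
    (hu : ∀ᵐ ω ∂P, ∀ t, u t ω = h t) : IsItoIntegral F B P u W := by
  refine (hW.isItoIntegral (F := F)).congr ?_ (ae_eq_refl _)
  filter_upwards [Measure.quasiMeasurePreserving_snd (μ := timeMeasure) (ν := P) |>.ae hu]
    with p hp using (hp p.1).symm

namespace IsLinearSDESolution

variable {T : ℝ≥0} {b : ℝ≥0 → Matrix (Fin m) (Fin m) ℝ} {σ : ℝ≥0 → Matrix (Fin m) (Fin d) ℝ}
  {x₀ : Fin m → ℝ} {X : ℝ≥0 → Ω → Fin m → ℝ}

/-- The noise of a linear equation is a Wiener integral. -/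
lemma exists_isWienerIntegral_noise (hX : IsLinearSDESolution F B P T b σ x₀ X)
    (hB : IsBrownianMotion F B P) (hσ : ContinuousOn σ (Set.Icc 0 T)) (i : Fin m) {t : ℝ≥0}
    (ht : t ≤ T) : ∃ h, IsWienerIntegral B P h fun ω =>
      X t ω i - (x₀ i + ∫ s in Set.Icc 0 t, ((b s).mulVec (X s ω)) i ∂timeMeasure) := by
  obtain ⟨W, hW⟩ := exists_isWienerIntegral_indicator hB
    ((continuousOn_toLp_row hσ i).mono (Set.Icc_subset_Icc_right ht))
  refine ⟨_, hW.congr_right ?_⟩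
  filter_upwards [hX.equation t ht, hW.itoIntegral_ae_eq hB] with ω h1 h2
  rw [h1 i, h2]
  ring

/-- The solution of a linear equation with additive noise is a constant plus a Wiener integral. -/
lemma exists_isWienerIntegral (hX : IsLinearSDESolution F B P T b σ x₀ X)
    (hB : IsBrownianMotion F B P) (hb : ContinuousOn b (Set.Icc 0 T))
    (hσ : ContinuousOn σ (Set.Icc 0 T)) {Φ : ℝ≥0 → Matrix (Fin m) (Fin m) ℝ}
    (hΦ : SolvesVariationEquation T b Φ) (i : Fin m) :
    ∃ h W, IsWienerIntegral B P h W ∧ ∀ᵐ ω ∂P, X T ω i = (Φ T).mulVec x₀ i + W ω := by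
  -- The noise is defined pathwise as the residual of the equation. It is then continuous wherever
  -- `X` is, and the equation is needed only at each fixed time, never simultaneously at all times.
  set N : Fin m → ℝ≥0 → Ω → ℝ := fun i t ω =>
    X t ω i - (x₀ i + ∫ s in Set.Icc 0 t, ((b s).mulVec (X s ω)) i ∂timeMeasure) with hNdef
  have hN : ∀ i, ∀ t ≤ T, ∃ h, IsWienerIntegral B P h (N i t) := fun i t ht =>
    hX.exists_isWienerIntegral_noise hB hσ i ht
  have hNc : ∀ ω, ContinuousOn (fun t => X t ω) (Set.Icc 0 T) → ∀ i,
      ContinuousOn (fun t => N i t ω) (Set.Icc 0 T) := fun ω hω i => by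
    have h1 : ContinuousOn (fun s => ((b s).mulVec (X s ω)) i) (Set.Icc 0 T) :=
      (continuous_apply i).comp_continuousOn
        ((continuous_fst.matrix_mulVec continuous_snd).comp_continuousOn (hb.prodMk hω))
    exact ((continuous_apply i).comp_continuousOn hω).sub
      (continuousOn_const.add (continuousOn_setIntegral_timeMeasure h1))
  have hc : ∀ l j, ContinuousOn (fun s => ((Φ s)⁻¹ * b s) l j) (Set.Icc 0 T) := fun l j =>
    (continuous_id.matrix_elem l j).comp_continuousOn ((hΦ.continuousOn_inv hb).mul hb)
  obtain ⟨h, hh⟩ := hN i T le_rfl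
  choose h' hh' using fun l => exists_isWienerIntegral_integral hB hN (hc l)
    (fun j => hX.continuous_paths.mono fun ω hω => hNc ω hω j)
  refine ⟨_, _, hh.add hB
    (IsWienerIntegral.linearCombination hB Finset.univ (fun l _ => hh' l) (Φ T i)), ?_⟩
  filter_upwards [hX.continuous_paths] with ω hω
  have h1 := hΦ.variation_of_constants hb hω (continuousOn_pi.2 (hNc ω hω))
    (x₀ := x₀) fun t _ i => by simp [hNdef]
  rw [h1, Matrix.mulVec_add, Pi.add_apply, Pi.add_apply]
  simp only [Matrix.mulVec, dotProduct]
  ring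

/-- The Malliavin matrix of the solution of a linear equation with additive noise is
deterministic. -/
lemma exists_malliavinMatrix_eq (hX : IsLinearSDESolution F B P T b σ x₀ X)
    (hB : IsBrownianMotion F B P) (hb : ContinuousOn b (Set.Icc 0 T))
    (hσ : ContinuousOn σ (Set.Icc 0 T)) {Φ : ℝ≥0 → Matrix (Fin m) (Fin m) ℝ}
    (hΦ : SolvesVariationEquation T b Φ) :
    ∃ γ, ∀ᵐ ω ∂P, malliavinMatrix B P (X T) ω = γ := by
  choose h W hW hXW using hX.exists_isWienerIntegral hB hb hσ hΦ
  exact ⟨_, malliavinMatrix_ae_eq hB hW hXW⟩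

end IsLinearSDESolution

end AdditiveNoise

end

/-! ### Proof of the theorem -/

theorem mainTheorem4 {Ω : Type*} {mΩ : MeasurableSpace Ω} (P : Measure Ω) [IsProbabilityMeasure P]
    {m d : ℕ} (F : Filtration ℝ≥0 mΩ) (hF : IsCompleteFiltration F P)
    (B : Fin d → ℝ≥0 → Ω → ℝ) (hB : IsBrownianMotion F B P)
    (T : ℝ≥0) (hT : 0 < T)
    (b : ℝ≥0 → Matrix (Fin m) (Fin m) ℝ) (hb : ContinuousOn b (Set.Icc 0 T))
    (σ : ℝ≥0 → Matrix (Fin m) (Fin d) ℝ) (hσ : ContinuousOn σ (Set.Icc 0 T))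
    (x₀ : Fin m → ℝ) (X : ℝ≥0 → Ω → Fin m → ℝ) (hX : IsLinearSDESolution F B P T b σ x₀ X)
    (Y : ℝ≥0 → Ω → Matrix (Fin m) (Fin m) ℝ)
    (hY : ∀ᵐ ω ∂P, SolvesVariationEquation T b (fun t => Y t ω))
    (hγ : ∀ᵐ ω ∂P, IsUnit (malliavinMatrix B P (X T) ω)) :
    -- the first variation process is deterministic (and invertible)
    (∃ Φ : ℝ≥0 → Matrix (Fin m) (Fin m) ℝ,
      SolvesVariationEquation T b Φ ∧
      (∀ᵐ ω ∂P, ∀ t ≤ T, Y t ω = Φ t) ∧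
      (∀ t ≤ T, IsUnit (Φ t)) ∧
      ∀ t ≤ T, (∀ r ≤ t, ∀ s ≤ t, b r * b s = b s * b r) →
        Φ t = NormedSpace.exp (Matrix.of fun i j => ∫ s in Set.Icc 0 t, b s i j ∂timeMeasure)) ∧
    -- the covering vector field is deterministic, hence adapted
    (∃ v : Fin m → ℝ≥0 → EuclideanSpace ℝ (Fin d),
      ∀ᵐ ω ∂P, ∀ k t, coveringField B P T σ Y (X T) k t ω = v k t) ∧
    (∀ k, StronglyAdapted F (coveringField B P T σ Y (X T) k)) ∧
    -- its Skorokhod integral is its Itô integral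
    (∀ j, ItoIntegrable F B P (rowProcess T σ Y j)) ∧
    ∀ k, InSkorokhodDomain B P (coveringField B P T σ Y (X T) k) ∧
      ItoIntegrable F B P (coveringField B P T σ Y (X T) k) ∧
      skorokhodIntegral B P (coveringField B P T σ Y (X T) k)
        =ᵐ[P] itoIntegral F B P (coveringField B P T σ Y (X T) k) ∧
      itoIntegral F B P (coveringField B P T σ Y (X T) k)
        =ᵐ[P] fun ω => ∑ j, (malliavinMatrix B P (X T) ω)⁻¹ k j *
          itoIntegral F B P (rowProcess T σ Y j) ω := by
  -- No existence theorem for the equation is needed: one good path of `Y` serves as the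
  -- deterministic solution.
  obtain ⟨ω₀, hω₀⟩ := hY.exists
  set Φ : ℝ≥0 → Matrix (Fin m) (Fin m) ℝ := fun t => Y t ω₀
  have hYΦ : ∀ᵐ ω ∂P, ∀ t ≤ T, Y t ω = Φ t := hY.mono fun ω hω t ht => hω.eq_of_le hω₀ hb ht
  obtain ⟨γ, hγ'⟩ := hX.exists_malliavinMatrix_eq hB hb hσ hω₀
  set g : Fin m → ℝ≥0 → EuclideanSpace ℝ (Fin d) := fun j => (Set.Icc 0 T).indicator
    fun s => WithLp.toLp 2 (fun l => (Φ T * (Φ s)⁻¹ * σ s) j l) with hg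
  have hrow : ∀ j, ∀ᵐ ω ∂P, ∀ t, rowProcess T σ Y j t ω = g j t := fun j => by
    filter_upwards [hYΦ] with ω hω t
    by_cases ht : t ∈ Set.Icc 0 T
    · simp only [rowProcess, hg, Set.indicator_of_mem ht, hω t ht.2, hω T le_rfl]
    · simp only [rowProcess, hg, Set.indicator_of_notMem ht]
  have hΦσ : ContinuousOn (fun s => Φ T * (Φ s)⁻¹ * σ s) (Set.Icc 0 T) :=
    (continuous_fst.matrix_mul continuous_snd).comp_continuousOn
      ((continuousOn_const.mul (hω₀.continuousOn_inv hb)).prodMk hσ)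
  choose W hW using fun j => exists_isWienerIntegral_indicator hB (continuousOn_toLp_row hΦσ j)
  have hv : ∀ᵐ ω ∂P, ∀ k t,
      coveringField B P T σ Y (X T) k t ω = ∑ j, γ⁻¹ k j • g j t := by
    filter_upwards [ae_all_iff.2 hrow, hγ'] with ω h1 h2 k t
    simp only [coveringField, h1, h2]
  -- This single random variable is a version of both the Skorokhod and the Itô integral of the
  -- covering field.
  have hvW : ∀ k, IsWienerIntegral B P (fun t => ∑ j, γ⁻¹ k j • g j t)
      (fun ω => ∑ j, γ⁻¹ k j * W j ω) := fun k =>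
    IsWienerIntegral.linearCombination hB Finset.univ (fun j _ => hW j) (γ⁻¹ k)
  have hcov : ∀ k, ∀ᵐ ω ∂P, ∀ t, coveringField B P T σ Y (X T) k t ω = ∑ j, γ⁻¹ k j • g j t :=
    fun k => hv.mono fun ω hω => hω k
  have hItoRow : ∀ j, IsItoIntegral F B P (rowProcess T σ Y j) (W j) := fun j =>
    (hW j).isItoIntegral_of_ae_eq (hrow j)
  refine ⟨⟨Φ, hω₀, hYΦ, fun t ht => hω₀.isUnit hb ht, fun t ht hc =>
      (hω₀.mono ht).eq_exp (hb.mono (Set.Icc_subset_Icc_right ht)) hc⟩,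
    ⟨_, hv⟩, fun k => adapted_of_ae_eq_const hF fun t => (hcov k).mono fun ω hω => hω t,
    fun j => ⟨_, hItoRow j⟩, fun k => ?_⟩
  have hS := (hvW k).isSkorokhodIntegral hB (hcov k)
  have hI : IsItoIntegral F B P (coveringField B P T σ Y (X T) k) _ :=
    (hvW k).isItoIntegral_of_ae_eq (hcov k)
  refine ⟨⟨_, hS⟩, ⟨_, hI⟩, (hS.skorokhodIntegral_ae_eq hB).trans (hI.ae_eq_itoIntegral hB).symm,
    (hI.ae_eq_itoIntegral hB).trans ?_⟩
  filter_upwards [hγ', ae_all_iff.2 fun j => (hItoRow j).ae_eq_itoIntegral hB] with ω h1 h2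
  simp only [h1, h2]
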